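/- Let $\Omega\subset\mathbb R^d$ ($d\ge 1$) be a bounded polytopic domain with a conforming initial simplicial mesh $\mathcal T_{h_0}$, and let $\{\mathcal T_h\}$ be a family of conforming simplicial meshes of $\Omega$ refining $\mathcal T_{h_0}$ and shape regular, $h_T/\rho_T\le\gamma^*$ for all $T\in\bigcup_h\mathcal T_h$, where $h_T$ is the diameter of $T$ and $\rho_T$ that of its biggest inscribed ball; $h=\max_T h_T$. For a fixed $k\ge 1$ let $V_h\subset H^1_0(\Omega)$ be the space of continuous functions on $\bar\Omega$, in $H_0^1(\Omega)$, that are polynomials of degree at most $k$ on each $T\in\mathcal T_h$, and $n_h=\dim V_h$. Let $$a(u,v)=(A\nabla u,\nabla v)+(cu,v),\qquad b(u,v)=(u,v),\qquad \|u\|_a=a(u,u)^{1/2},\qquad \|u\|_b=b(u,u)^{1/2},$$ where $A$ is Lipschitz on each element of $\mathcal T_{h_0}$, symmetric and uniformly positive definite, $0\le c\in L^\infty(\Omega)$, and $(\cdot,\cdot)$ is the $L^2(\Omega)$ inner product. Let $K:L^2(\Omega)\to H^1_0(\Omega)$ be given by $a(Kw,v)=b(w,v)$ for all $v\in H^1_0(\Omega)$,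 let $R_h:H_0^1(\Omega)\to V_h$ be the Galerkin projection, $a(u-R_hu,v)=0$ for all $v\in V_h$, and $K_h=R_hK$. Let $\lambda$ be an eigenvalue of $a(u,v)=\lambda b(u,v)$ for all $v\in H_0^1(\Omega)$, with eigenspace $M(\lambda)$ of dimension $q$, and let $k_0$ be the number of eigenvalues smaller than $\lambda$, counted with multiplicity. Let $\lambda_{1,h}\le\dots\le\lambda_{n_h,h}$ and $u_{1,h},\dots,u_{n_h,h}$ be the eigenvalues and $b$-orthonormal eigenfunctions of the discrete problem $a(u_h,v)=\lambda_hb(u_h,v)$ for all $v\in V_h$, and put $\lambda_{h,l}=\lambda_{k_0+l,h}$, $u_{h,l}=u_{k_0+l,h}$ for $1\le l\le q$. Let $\Gamma$ be a circle in $\mathbb C$ with centre $\lambda^{-1}$ such that the closed disc bounded by $\Gamma$ contains no eigenvalue of $K$ other than $\lambda^{-1}$, and let $$E_h=\frac1{2\pi i}\int_\Gamma (z-K_h)^{-1}\,dz .$$ Set $$\rho_\Omega(h)=\sup_{\|f\|_b=1}\inf_{v\in V_h}\|Kf-v\|_{1,\Omega},\qquad \delta_h(\lambda)=\sup_{w\in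 M(\lambda),\,\|w\|_b=1}\inf_{v\in V_h}\|w-v\|_a .$$ Then there are constants $C>0$ and $\bar h>0$, independent of the mesh, of $u$ and of the choice of discrete eigenfunctions, such that for every mesh of the family with $h<\bar h$ the following holds: $k_0+q\le n_h$; $\Gamma$ contains no point of the spectrum of $K_h$; and for every $u\in M(\lambda)$ with $\|u\|_b=1$ there are unique real numbers $\alpha_{h,1}(u),\dots,\alpha_{h,q}(u)$ with $E_hu=\sum_{l=1}^q\alpha_{h,l}(u)u_{h,l}$, and, with $w^h=\sum_{l=1}^q\alpha_{h,l}(u)\lambda_{h,l}Ku_{h,l}$, $$E_hu=R_hw^h,\qquad \Bigl|\,\|u-E_hu\|_a-\|w^h-R_hw^h\|_a\Bigr|\le C\,\bigl(\rho_\Omega(h)+\delta_h(\lambda)\bigr)\,\|u-E_hu\|_a .$$ -/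

import Mathlib

open MeasureTheory Set
open scoped ENNReal ContDiff

noncomputable section

namespace EigFEM

/-! ### Function spaces -/

/-- Euclidean space `ℝ^d`. -/
abbrev Pt (d : ℕ) := EuclideanSpace ℝ (Fin d)

variable {d : ℕ}

/-- The real space `L²(Ω)`. Its inner product is `b(f, g) = ∫_Ω f g`, its norm is `‖·‖_b`. -/
abbrev L2 (Ω : Set (Pt d)) := Lp ℝ 2 (volume.restrict Ω)

/-- The complex space `L²(Ω; ℂ)`. -/
abbrev L2C (Ω : Set (Pt d)) := Lp ℂ 2 (volume.restrict Ω)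

/-- Pairs (function, vector field) in `L²(Ω) × L²(Ω; ℝ^d)`, with the norm
`(‖f‖² + ‖g‖²)^{1/2}`. -/
abbrev L2Pair (Ω : Set (Pt d)) := WithLp 2 (L2 Ω × Lp (Pt d) 2 (volume.restrict Ω))

/-- The pairs `(φ, ∇φ)` with `φ ∈ C_c^∞(Ω)`. -/
def testPairs (Ω : Set (Pt d)) : Set (L2Pair Ω) :=
  {p | ∃ φ : Pt d → ℝ, ContDiff ℝ ∞ φ ∧ HasCompactSupport φ ∧ tsupport φ ⊆ Ω ∧
    p.fst =ᵐ[volume.restrict Ω] φ ∧ p.snd =ᵐ[volume.restrict Ω] gradient φ}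

/-- `H¹₀(Ω)`, the closure of `C_c^∞(Ω)` in the `H¹` norm. An element is stored as the pair
`(u, ∇u)` of a function and its weak gradient, so that the norm of `H10 Ω` is
`‖u‖_{1,Ω} = (‖u‖² + ‖∇u‖²)^{1/2}`. The set `testPairs Ω` is already a linear
subspace; the span only serves to make it a `Submodule`. -/
def H10 (Ω : Set (Pt d)) : Submodule ℝ (L2Pair Ω) :=
  (Submodule.span ℝ (testPairs Ω)).topologicalClosure

/-- The embedding `H¹₀(Ω) → L²(Ω)`. -/
def toL2 {Ω : Set (Pt d)} (u : H10 Ω) : L2 Ω := (u : L2Pair Ω).fst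

/-- The weak gradient of an element of `H¹₀(Ω)`. -/
def grad {Ω : Set (Pt d)} (u : H10 Ω) : Lp (Pt d) 2 (volume.restrict Ω) := (u : L2Pair Ω).snd

/-- The embedding `H¹₀(Ω) → L²(Ω)` as a linear map. -/
def toL2ₗ (Ω : Set (Pt d)) : H10 Ω →ₗ[ℝ] L2 Ω where
  toFun := toL2
  map_add' _ _ := rfl
  map_smul' _ _ := rfl

theorem norm_toL2_le {Ω : Set (Pt d)} (u : H10 Ω) : ‖toL2 u‖ ≤ 1 * ‖u‖ := by
  have h : ‖u‖ ^ 2 = ‖toL2 u‖ ^ 2 + ‖grad u‖ ^ 2 := by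
    rw [Submodule.coe_norm, WithLp.prod_norm_sq_eq_of_L2]
    rfl
  nlinarith [norm_nonneg u, norm_nonneg (toL2 u), sq_nonneg ‖grad u‖]

/-- The embedding `H¹₀(Ω) → L²(Ω)` as a bounded operator. -/
def toL2L (Ω : Set (Pt d)) : H10 Ω →L[ℝ] L2 Ω := (toL2ₗ Ω).mkContinuous 1 norm_toL2_le

/-! ### The bilinear forms -/

/-- `b(u, v) = (u, v)`, on `H¹₀(Ω)`. -/
def bForm {Ω : Set (Pt d)} (u v : H10 Ω) : ℝ := inner ℝ (toL2 u) (toL2 v)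

/-- `‖u‖_b`. -/
def bNorm {Ω : Set (Pt d)} (u : H10 Ω) : ℝ := Real.sqrt (bForm u u)

/-- `a(u, v) = (A ∇u, ∇v) + (c u, v)`. -/
def aForm {Ω : Set (Pt d)} (A : Pt d → Matrix (Fin d) (Fin d) ℝ) (c : Pt d → ℝ)
    (u v : H10 Ω) : ℝ :=
  ∫ x in Ω, ((∑ i, ∑ j, A x i j * grad u x j * grad v x i) + c x * toL2 u x * toL2 v x)

/-- The energy norm `‖u‖_a`. -/
def aNorm {Ω : Set (Pt d)} (A : Pt d → Matrix (Fin d) (Fin d) ℝ) (c : Pt d → ℝ)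
    (u : H10 Ω) : ℝ := Real.sqrt (aForm A c u u)

/-! ### Meshes and finite element spaces -/

/-- A conforming simplicial mesh of `Ω ⊆ ℝ^d`: a finite simplicial complex whose union is the
closure of `Ω` and each of whose faces is a face of a `d`-simplex of the complex. -/
structure Mesh (Ω : Set (Pt d)) extends Geometry.SimplicialComplex ℝ (Pt d) where
  finite_faces : faces.Finite
  pure_dim : ∀ s ∈ faces, ∃ T ∈ faces, s ⊆ T ∧ T.card = d + 1
  space_eq : (⋃ s ∈ faces, convexHull ℝ (s : Set (Pt d))) = closure Ω

/-- The elements of a mesh, given by their vertex sets. -/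
def Mesh.elements {Ω : Set (Pt d)} (𝒯 : Mesh Ω) : Set (Finset (Pt d)) :=
  {T ∈ 𝒯.faces | T.card = d + 1}

/-- The closed simplex with vertex set `T`. -/
def cell (T : Finset (Pt d)) : Set (Pt d) := convexHull ℝ (T : Set (Pt d))

/-- The diameter `ρ_T` of the biggest ball contained in the simplex. -/
def inDiam (T : Finset (Pt d)) : ℝ :=
  sSup {δ : ℝ | ∃ (x : Pt d) (r : ℝ), 0 ≤ r ∧ δ = 2 * r ∧ Metric.closedBall x r ⊆ cell T}

/-- `h_T / ρ_T ≤ γ` for all elements. -/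
def Mesh.ShapeRegular {Ω : Set (Pt d)} (γ : ℝ) (𝒯 : Mesh Ω) : Prop :=
  ∀ T ∈ 𝒯.elements, Metric.diam (cell T) / inDiam T ≤ γ

/-- The mesh size `h = max_T h_T`. -/
def Mesh.size {Ω : Set (Pt d)} (𝒯 : Mesh Ω) : ℝ :=
  sSup ((fun T => Metric.diam (cell T)) '' 𝒯.elements)

/-- Every element of `𝒯` lies in an element of `𝒯₀`. -/
def Mesh.Refines {Ω : Set (Pt d)} (𝒯 𝒯₀ : Mesh Ω) : Prop :=
  ∀ T ∈ 𝒯.elements, ∃ T₀ ∈ 𝒯₀.elements, cell T ⊆ cell T₀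

/-- `S^{h,k}(Ω)`: the function `v` is continuous on the closure of `Ω` and, on each element, a
polynomial of degree at most `k`. -/
def IsPiecewisePoly {Ω : Set (Pt d)} (𝒯 : Mesh Ω) (k : ℕ) (v : Pt d → ℝ) : Prop :=
  ContinuousOn v (closure Ω) ∧ ∀ T ∈ 𝒯.elements, ∃ p : MvPolynomial (Fin d) ℝ,
    p.totalDegree ≤ k ∧ ∀ x ∈ cell T, v x = MvPolynomial.eval (fun i => x i) p

/-- The finite element space `V_h = S^{h,k}_0(Ω) = S^{h,k}(Ω) ∩ H¹₀(Ω)`. -/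
def feSpace {Ω : Set (Pt d)} (𝒯 : Mesh Ω) (k : ℕ) : Submodule ℝ (H10 Ω) where
  carrier := {u | ∃ v : Pt d → ℝ, IsPiecewisePoly 𝒯 k v ∧ toL2 u =ᵐ[volume.restrict Ω] v}
  zero_mem' := by
    refine ⟨0, ⟨continuousOn_const, fun T _ => ⟨0, by simp, by simp⟩⟩, ?_⟩
    exact Lp.coeFn_zero _ _ _
  add_mem' := by
    rintro u u' ⟨v, ⟨hv, hp⟩, hu⟩ ⟨v', ⟨hv', hp'⟩, hu'⟩
    refine ⟨v + v', ⟨hv.add hv', fun T hT => ?_⟩, ?_⟩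
    · obtain ⟨p, hp1, hp2⟩ := hp T hT
      obtain ⟨p', hp1', hp2'⟩ := hp' T hT
      refine ⟨p + p', (MvPolynomial.totalDegree_add p p').trans (max_le hp1 hp1'), ?_⟩
      intro x hx
      simp [hp2 x hx, hp2' x hx]
    · have h : toL2 (u + u') = toL2 u + toL2 u' := rfl
      rw [h]
      exact (Lp.coeFn_add _ _).trans (hu.add hu')
  smul_mem' := by
    rintro t u ⟨v, ⟨hv, hp⟩, hu⟩
    refine ⟨t • v, ⟨hv.const_smul t, fun T hT => ?_⟩, ?_⟩
    · obtain ⟨p, hp1, hp2⟩ := hp T hT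
      refine ⟨t • p, (MvPolynomial.totalDegree_smul_le t p).trans hp1, ?_⟩
      intro x hx
      simp [hp2 x hx]
    · have h : toL2 (t • u) = t • toL2 u := rfl
      rw [h]
      exact (Lp.coeFn_smul _ _).trans (hu.const_smul t)

/-! ### Coefficients -/

/-- Assumptions on the diffusion matrix: Lipschitz on each element of the initial mesh (its values
on the element boundaries, a null set, are irrelevant), symmetric and uniformly positive
definite. -/
structure IsDiffusion (Ω : Set (Pt d)) (𝒯₀ : Mesh Ω) (A : Pt d → Matrix (Fin d) (Fin d) ℝ) :
    Prop where
  lipschitz : ∀ T ∈ 𝒯₀.elements, ∃ L : NNReal, ∀ i j,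
    LipschitzOnWith L (fun x => A x i j) (interior (cell T) ∩ Ω)
  symm : ∀ᵐ x ∂(volume.restrict Ω), (A x).IsSymm
  elliptic : ∃ α > 0, ∀ᵐ x ∂(volume.restrict Ω), ∀ ξ : Pt d,
    α * ‖ξ‖ ^ 2 ≤ ∑ i, ∑ j, A x i j * ξ j * ξ i

/-- `0 ≤ c ∈ L^∞(Ω)`. -/
structure IsPotential (Ω : Set (Pt d)) (c : Pt d → ℝ) : Prop where
  bounded : MemLp c ∞ (volume.restrict Ω)
  nonneg : ∀ᵐ x ∂(volume.restrict Ω), 0 ≤ c x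

section Operators

variable {Ω : Set (Pt d)} (A : Pt d → Matrix (Fin d) (Fin d) ℝ) (c : Pt d → ℝ)

/-! ### Solution operators -/

/-- `S` is the solution operator of the source problem posed on `V`:
`S f ∈ V` and `a(S f, v) = b(f, v)` for all `v ∈ V`. -/
def IsSolOp (V : Submodule ℝ (H10 Ω)) (S : L2 Ω →L[ℝ] H10 Ω) : Prop :=
  ∀ f, S f ∈ V ∧ ∀ v ∈ V, aForm A c (S f) v = inner ℝ f (toL2 v)

open Classical in
/-- The solution operator of the source problem posed on `V`. For uniformly elliptic `a` and a
closed subspace `V` it exists and is unique (Lax-Milgram), so the default value is not used. -/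
def solOp (V : Submodule ℝ (H10 Ω)) : L2 Ω →L[ℝ] H10 Ω :=
  if h : ∃ S, IsSolOp A c V S then h.choose else 0

/-- `K : L²(Ω) → H¹₀(Ω)`, `a(K w, v) = b(w, v)` for all `v ∈ H¹₀(Ω)`. -/
def opK : L2 Ω →L[ℝ] H10 Ω := solOp A c ⊤

/-- `R` is the Galerkin projection onto `V`: `R u ∈ V` and `a(u - R u, v) = 0` for all `v ∈ V`. -/
def IsGalerkinProj (V : Submodule ℝ (H10 Ω)) (R : H10 Ω →L[ℝ] H10 Ω) : Prop :=
  ∀ u, R u ∈ V ∧ ∀ v ∈ V, aForm A c (u - R u) v = 0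

open Classical in
/-- The Galerkin projection onto `V`. For uniformly elliptic `a` and a closed subspace `V` it
exists and is unique (Lax-Milgram), so the default value is not used. -/
def galerkinProj (V : Submodule ℝ (H10 Ω)) : H10 Ω →L[ℝ] H10 Ω :=
  if h : ∃ R, IsGalerkinProj A c V R then h.choose else 0

/-- `ρ_Ω(h) = sup_{‖f‖_b = 1} inf_{v ∈ V} ‖K f - v‖_{1,Ω}`. -/
def rhoErr (V : Submodule ℝ (H10 Ω)) : ℝ :=
  ⨆ f : {f : L2 Ω // ‖f‖ = 1}, ⨅ v : V, ‖opK A c f.1 - v.1‖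

/-! ### The eigenvalue problem -/

/-- `u ∈ M(ν)`: `a(u, v) = ν b(u, v)` for all `v ∈ H¹₀(Ω)` (the zero function included). -/
def IsEigvec (ν : ℝ) (u : H10 Ω) : Prop := ∀ v : H10 Ω, aForm A c u v = ν * bForm u v

/-- `ν` is an eigenvalue of `a` relative to `b` on `H¹₀(Ω)`. -/
def IsEigval (Ω : Set (Pt d)) (A : Pt d → Matrix (Fin d) (Fin d) ℝ) (c : Pt d → ℝ) (ν : ℝ) :
    Prop := ∃ u : H10 Ω, u ≠ 0 ∧ IsEigvec A c ν u

/-- The eigenspace `M(ν)` as a subspace. The set of all `u` with `IsEigvec A c ν u` is already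
linear; the span only serves to make it a `Submodule`. -/
def eigenspace (Ω : Set (Pt d)) (A : Pt d → Matrix (Fin d) (Fin d) ℝ) (c : Pt d → ℝ) (ν : ℝ) :
    Submodule ℝ (H10 Ω) := Submodule.span ℝ {u | IsEigvec A c ν u}

/-- The multiplicity `q = dim M(ν)`. -/
def mult (Ω : Set (Pt d)) (A : Pt d → Matrix (Fin d) (Fin d) ℝ) (c : Pt d → ℝ) (ν : ℝ) : ℕ :=
  Module.finrank ℝ (eigenspace Ω A c ν)

/-- The number `k₀` of eigenvalues strictly below `ν`, counted with multiplicity. -/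
def numBelow (Ω : Set (Pt d)) (A : Pt d → Matrix (Fin d) (Fin d) ℝ) (c : Pt d → ℝ) (ν : ℝ) : ℕ :=
  Module.finrank ℝ (⨆ κ : Iio ν, eigenspace Ω A c κ : Submodule ℝ (H10 Ω))

/-- `δ_h(ν) = sup_{w ∈ M(ν), ‖w‖_b = 1} inf_{v ∈ V} ‖w - v‖_a`. -/
def deltaErr (V : Submodule ℝ (H10 Ω)) (ν : ℝ) : ℝ :=
  ⨆ w : {w : H10 Ω // IsEigvec A c ν w ∧ bNorm w = 1}, ⨅ v : V, aNorm A c (w.1 - v.1)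

/-- A discrete eigensystem on `V`: the eigenvalues `Λ 0 ≤ Λ 1 ≤ … ≤ Λ (n - 1)`, `n = dim V`, of
the discrete problem, repeated according to multiplicity, and associated `b`-orthonormal
eigenfunctions `U 0, …, U (n - 1)`. Values at indices `≥ n` are irrelevant. -/
structure IsDiscreteEigensystem (V : Submodule ℝ (H10 Ω)) (Λ : ℕ → ℝ) (U : ℕ → H10 Ω) : Prop where
  mono : ∀ i j, i ≤ j → j < Module.finrank ℝ V → Λ i ≤ Λ j
  mem : ∀ i < Module.finrank ℝ V, U i ∈ V
  orthonormal : ∀ i < Module.finrank ℝ V, ∀ j < Module.finrank ℝ V,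
    bForm (U i) (U j) = if i = j then 1 else 0
  eigen : ∀ i < Module.finrank ℝ V, ∀ v ∈ V, aForm A c (U i) v = Λ i * bForm (U i) v

end Operators

/-! ### Spectral projections -/

/-- The embedding `L²(Ω) → L²(Ω; ℂ)`. -/
def toC (Ω : Set (Pt d)) : L2 Ω →L[ℝ] L2C Ω := Complex.ofRealCLM.compLpL 2 (volume.restrict Ω)

/-- Real part `L²(Ω; ℂ) → L²(Ω)`. -/
def rePart (Ω : Set (Pt d)) : L2C Ω →L[ℝ] L2 Ω := Complex.reCLM.compLpL 2 (volume.restrict Ω)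

/-- Imaginary part `L²(Ω; ℂ) → L²(Ω)`. -/
def imPart (Ω : Set (Pt d)) : L2C Ω →L[ℝ] L2 Ω := Complex.imCLM.compLpL 2 (volume.restrict Ω)

theorem rePart_smul {Ω : Set (Pt d)} (z : ℂ) (f : L2C Ω) :
    rePart Ω (z • f) = z.re • rePart Ω f - z.im • imPart Ω f := by
  apply Lp.ext
  filter_upwards [Complex.reCLM.coeFn_compLpL (p := 2) (z • f), Lp.coeFn_smul z f,
    Lp.coeFn_sub (z.re • rePart Ω f) (z.im • imPart Ω f), Lp.coeFn_smul z.re (rePart Ω f),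
    Lp.coeFn_smul z.im (imPart Ω f), Complex.reCLM.coeFn_compLpL (p := 2) f,
    Complex.imCLM.coeFn_compLpL (p := 2) f] with x h1 h2 h3 h4 h5 h6 h7
  simp only [rePart, imPart] at *
  rw [h1, h2, h3]
  simp [h4, h5, h6, h7]

theorem imPart_smul {Ω : Set (Pt d)} (z : ℂ) (f : L2C Ω) :
    imPart Ω (z • f) = z.re • imPart Ω f + z.im • rePart Ω f := by
  apply Lp.ext
  filter_upwards [Complex.imCLM.coeFn_compLpL (p := 2) (z • f), Lp.coeFn_smul z f,
    Lp.coeFn_add (z.re • imPart Ω f) (z.im • rePart Ω f), Lp.coeFn_smul z.re (imPart Ω f),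
    Lp.coeFn_smul z.im (rePart Ω f), Complex.reCLM.coeFn_compLpL (p := 2) f,
    Complex.imCLM.coeFn_compLpL (p := 2) f] with x h1 h2 h3 h4 h5 h6 h7
  simp only [rePart, imPart] at *
  rw [h1, h2, h3]
  simp [h4, h5, h6, h7]

/-- The complexification `f ↦ T (Re f) + i T (Im f)` of a bounded operator on `L²(Ω)`. -/
def complexify {Ω : Set (Pt d)} (T : L2 Ω →L[ℝ] L2 Ω) : L2C Ω →L[ℂ] L2C Ω where
  toFun f := toC Ω (T (rePart Ω f)) + Complex.I • toC Ω (T (imPart Ω f))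
  map_add' f g := by simp only [map_add, smul_add]; abel
  map_smul' z f := by
    have hs : ∀ (t : ℝ) (g : L2C Ω), t • g = (t : ℂ) • g := fun t g => by
      apply Lp.ext
      filter_upwards [Lp.coeFn_smul t g, Lp.coeFn_smul (t : ℂ) g] with x h1 h2
      rw [h1, h2]
      simp
    have key : ∀ p q : L2C Ω, (z.re : ℂ) • p - (z.im : ℂ) • q
        + Complex.I • ((z.re : ℂ) • q + (z.im : ℂ) • p) = z • (p + Complex.I • q) := by
      intro p q
      obtain ⟨x, y⟩ := z
      rw [Complex.mk_eq_add_mul_I x y]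
      have hI : Complex.I * Complex.I = -1 := Complex.I_mul_I
      match_scalars
      · simp; ring
      · simp; linear_combination (-(y : ℂ)) * hI
    rw [rePart_smul, imPart_smul]
    simp only [map_add, map_sub, map_smul, hs, RingHom.id_apply]
    exact key _ _
  cont := by
    exact ((toC Ω).continuous.comp (T.continuous.comp (rePart Ω).continuous)).add
      (((toC Ω).continuous.comp (T.continuous.comp (imPart Ω).continuous)).const_smul Complex.I)

/-- The solution operator of the source problem posed on `V`, regarded as an operator on
`L²(Ω; ℂ)`. For `V = H¹₀(Ω)` this is `K`, for `V = V_h` it is `K_h`. -/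
def solOpC {Ω : Set (Pt d)} (A : Pt d → Matrix (Fin d) (Fin d) ℝ) (c : Pt d → ℝ)
    (V : Submodule ℝ (H10 Ω)) : L2C Ω →L[ℂ] L2C Ω :=
  complexify (toL2L Ω ∘L solOp A c V)

/-- The spectral projection `(2 π i)⁻¹ ∮_Γ (z - T)⁻¹ dz`, `Γ` the circle with centre `μ` and
radius `r`. -/
def rieszProj {Ω : Set (Pt d)} (T : L2C Ω →L[ℂ] L2C Ω) (μ : ℂ) (r : ℝ) : L2C Ω →L[ℂ] L2C Ω :=
  (2 * (Real.pi : ℂ) * Complex.I)⁻¹ • circleIntegral (fun z => resolvent T z) μ r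

end EigFEM

end

/-! Write `m = λ⁻¹`, `J` for the embedding of `H¹₀(Ω)` into `L²(Ω)`, `R = R_h`, and let `e_i` be the
discrete eigenfunctions in `L²`, with `μ_i = 1/λ_{i,h}`. Then `K_h = ∑ μ_i (e_i, ·) e_i`.

The estimate. Since `λ_{h,l} R K u_{h,l} = u_{h,l}`, applying `R` to `w^h` gives `E_h u`, so `(u -
E_h u) - (w^h - R w^h) = u - w^h`, and by the reverse triangle inequality it suffices to bound `‖u -
w^h‖_a` by `C ρ ‖u - E_h u‖_a`. As `u = m⁻¹ K u`, the difference `u - w^h` is `K` applied to `m⁻¹ u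
- ∑ μ_i⁻¹ (e_i, u) e_i`, the sum running over the cluster `|μ_i - m| < r`. In the eigenbasis this
vector is a bounded multiplier of the residual `K_h u - m u = -m (u - R u)`
(`IsDiagonal.norm_sub_cluster_le`). The Aubin-Nitsche argument bounds `‖u - R u‖_b` by `C ρ ‖u - R
u‖_a` (`IsEnergyForm.norm_map_galerkin_le`), and `R` gives the best approximation in the energy
norm, so `‖u - R u‖_a ≤ ‖u - E_h u‖_a`. These facts combine in `IsEnergyForm.exists_superclose`. The
bound holds with `ρ` alone; `δ ≥ 0` is added at the end.

The cluster. `K` is compact on `L²(Ω)` by Rellich's theorem (`isCompactOperator_toL2L`), and finite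
element functions approximate any fixed element of `H¹₀(Ω)` on fine meshes
(`exists_feSpace_approx`). Compactness reduces the convergence `K_h → K` in operator norm to the
approximation of finitely many functions (`IsEnergyForm.exists_finite_norm_sub_lt`). A min-max count
(`exists_forall_card_eq`) then shows that exactly `k₀` of the `μ_i` exceed `m + r`, exactly `k₀ + q`
exceed `m - r`, and none equals `m ± r`. So the cluster consists of the indices `k₀ + 1, …, k₀ + q`.

The contour integral. The complexified `K_h` is a combination of orthogonal idempotents, whose
resolvent is explicit, and the integral is evaluated term by term
(`circleIntegral_resolvent_combination`). This requires `0` to lie outside the disc, that is `r <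
m`: otherwise `K` would have no eigenvalue in `[0, m)`, which forces `L²(Ω)` to be
finite-dimensional (`isolated_eigenvalue`). -/

namespace EigFEM

/-! ### Spectral subspaces of compact symmetric operators -/

section Spectral

variable {X : Type*} [NormedAddCommGroup X] [InnerProductSpace ℝ X]

/-- The span of the eigenspaces of `T` for the eigenvalues in `P`. -/
def spectralSpan (T : X →L[ℝ] X) (P : Set ℝ) : Submodule ℝ X :=
  ⨆ μ : P, Module.End.eigenspace (T : X →ₗ[ℝ] X) μ

theorem eigenspace_le_spectralSpan (T : X →L[ℝ] X) {P : Set ℝ} {μ : ℝ} (hμ : μ ∈ P) :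
    Module.End.eigenspace (T : X →ₗ[ℝ] X) μ ≤ spectralSpan T P :=
  le_iSup (fun μ : P => Module.End.eigenspace (T : X →ₗ[ℝ] X) μ) ⟨μ, hμ⟩

theorem spectralSpan_union (T : X →L[ℝ] X) (P Q : Set ℝ) :
    spectralSpan T (P ∪ Q) = spectralSpan T P ⊔ spectralSpan T Q := by
  simp only [spectralSpan, iSup_subtype]
  exact iSup_union

theorem spectralSpan_isOrtho {T : X →L[ℝ] X} (hT : (T : X →ₗ[ℝ] X).IsSymmetric) {P Q : Set ℝ}
    (hPQ : Disjoint P Q) : spectralSpan T P ⟂ spectralSpan T Q := by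
  simp only [spectralSpan, Submodule.isOrtho_iSup_left, Submodule.isOrtho_iSup_right]
  intro μ ν
  exact hT.orthogonalFamily_eigenspaces.isOrtho
    fun h => (Set.disjoint_left.1 hPQ) ν.2 (by rw [h]; exact μ.2)

/-- Eigenspaces of a symmetric operator are mutually orthogonal, so the Rayleigh quotient is a
weighted mean of eigenvalues, with weights the squared norms of the components. A nonzero component
certifies that its `μ` is an eigenvalue. -/
theorem exists_inner_map_eq_sum {T : X →L[ℝ] X} (hT : (T : X →ₗ[ℝ] X).IsSymmetric) {P : Set ℝ}
    {v : X} (hv : v ∈ spectralSpan T P) :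
    ∃ (s : Finset P) (w : P → ℝ), (∀ μ, 0 ≤ w μ) ∧ (∀ μ ∈ s, w μ ≠ 0 →
        Module.End.HasEigenvalue (T : X →ₗ[ℝ] X) (μ : ℝ)) ∧
      inner ℝ (T v) v = ∑ μ ∈ s, (μ : ℝ) * w μ ∧ ‖v‖ ^ 2 = ∑ μ ∈ s, w μ := by
  obtain ⟨f, hf, rfl⟩ := (Submodule.mem_iSup_iff_exists_finsupp _ _).1 hv
  have hO := (hT.orthogonalFamily_eigenspaces).comp (Subtype.val_injective (p := (· ∈ P)))
  let g : ∀ μ : P, Module.End.eigenspace (T : X →ₗ[ℝ] X) μ := fun μ => ⟨f μ, hf μ⟩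
  refine ⟨f.support, fun μ => ‖f μ‖ ^ 2, fun μ => sq_nonneg _, ?_, ?_, ?_⟩
  · intro μ _ hne hbot
    have : f μ = 0 := by
      have h : f μ ∈ Module.End.genEigenspace (T : X →ₗ[ℝ] X) (μ : ℝ) 1 := hf μ
      rwa [hbot, Submodule.mem_bot] at h
    simp [this] at hne
  · have h1 : T (f.sum fun _ x => x) = ∑ μ ∈ f.support, (((μ : ℝ) • g μ :
        Module.End.eigenspace (T : X →ₗ[ℝ] X) μ) : X) := by
      rw [Finsupp.sum, map_sum]
      exact Finset.sum_congr rfl fun μ _ => Module.End.mem_eigenspace_iff.1 (hf μ)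
    have h2 := hO.inner_sum (fun μ => (μ : ℝ) • g μ) g f.support
    rw [h1]
    refine h2.trans (Finset.sum_congr rfl fun μ _ => ?_)
    rw [real_inner_smul_left, real_inner_self_eq_norm_sq]
    rfl
  · rw [← real_inner_self_eq_norm_sq]
    refine (hO.inner_sum g g f.support).trans (Finset.sum_congr rfl fun μ _ => ?_)
    rw [real_inner_self_eq_norm_sq]
    rfl

theorem le_inner_map_of_mem_spectralSpan {T : X →L[ℝ] X} (hT : (T : X →ₗ[ℝ] X).IsSymmetric)
    {P : Set ℝ} {t : ℝ}
    (ht : ∀ μ ∈ P, Module.End.HasEigenvalue (T : X →ₗ[ℝ] X) μ → t ≤ μ) {v : X}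
    (hv : v ∈ spectralSpan T P) : t * ‖v‖ ^ 2 ≤ inner ℝ (T v) v := by
  obtain ⟨s, w, hw, hs, h1, h2⟩ := exists_inner_map_eq_sum hT hv
  rw [h1, h2, Finset.mul_sum]
  refine Finset.sum_le_sum fun μ hμ => ?_
  by_cases h0 : w μ = 0
  · simp [h0]
  · exact mul_le_mul_of_nonneg_right (ht μ μ.2 (hs μ hμ h0)) (hw μ)

theorem inner_map_le_of_mem_spectralSpan {T : X →L[ℝ] X} (hT : (T : X →ₗ[ℝ] X).IsSymmetric)
    {P : Set ℝ} {t : ℝ}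
    (ht : ∀ μ ∈ P, Module.End.HasEigenvalue (T : X →ₗ[ℝ] X) μ → μ ≤ t) {v : X}
    (hv : v ∈ spectralSpan T P) : inner ℝ (T v) v ≤ t * ‖v‖ ^ 2 := by
  obtain ⟨s, w, hw, hs, h1, h2⟩ := exists_inner_map_eq_sum hT hv
  rw [h1, h2, Finset.mul_sum]
  refine Finset.sum_le_sum fun μ hμ => ?_
  by_cases h0 : w μ = 0
  · simp [h0]
  · exact mul_le_mul_of_nonneg_right (ht μ μ.2 (hs μ hμ h0)) (hw μ)

variable [CompleteSpace X]

/-- By the spectral theorem the eigenvectors span a dense subspace. Hence a vector orthogonal to the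
part belonging to `P` is a limit of combinations of eigenvectors for `Pᶜ`, and the Rayleigh bound on
these passes to the limit. -/
theorem inner_map_le_of_mem_spectralSpan_orthogonal {T : X →L[ℝ] X}
    (hT : (T : X →ₗ[ℝ] X).IsSymmetric) (hc : IsCompactOperator T) {P : Set ℝ} {t : ℝ}
    (ht : ∀ μ ∉ P, Module.End.HasEigenvalue (T : X →ₗ[ℝ] X) μ → μ ≤ t) {v : X}
    (hv : v ∈ (spectralSpan T P)ᗮ) : inner ℝ (T v) v ≤ t * ‖v‖ ^ 2 := by
  have hdense : (spectralSpan T P ⊔ spectralSpan T Pᶜ).topologicalClosure = ⊤ := by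
    rw [← spectralSpan_union, Set.union_compl_self, Submodule.topologicalClosure_eq_top_iff]
    have : spectralSpan T univ = ⨆ μ, Module.End.eigenspace (T : X →ₗ[ℝ] X) μ := by
      simp [spectralSpan, iSup_subtype]
    rw [this]
    exact ContinuousLinearMap.orthogonalComplement_iSup_eigenspaces_eq_bot hc hT
  have hvc : v ∈ closure ((spectralSpan T Pᶜ : Submodule ℝ X) : Set X) := by
    have hv' : v ∈ closure ((spectralSpan T P ⊔ spectralSpan T Pᶜ : Submodule ℝ X) : Set X) := by
      rw [← Submodule.topologicalClosure_coe, hdense]; trivial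
    rw [Metric.mem_closure_iff] at hv' ⊢
    intro ε hε
    obtain ⟨x, hx, hd⟩ := hv' ε hε
    obtain ⟨a, ha, b, hb, rfl⟩ := Submodule.mem_sup.1 hx
    -- Omitting `a` brings the approximation closer to `v`, since `a` is orthogonal to both `v` and
    -- `b`.
    refine ⟨b, hb, lt_of_le_of_lt ?_ hd⟩
    have hab : inner ℝ a b = 0 :=
      (Submodule.isOrtho_iff_inner_eq.1 (spectralSpan_isOrtho hT disjoint_compl_right)) a ha b hb
    have hav : inner ℝ a v = 0 := (Submodule.mem_orthogonal _ _).1 hv a ha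
    have h0 : inner ℝ a (v - b) = 0 := by rw [inner_sub_right, hab, hav, sub_zero]
    rw [dist_eq_norm, dist_eq_norm]
    have h1 : v - (a + b) = (v - b) - a := by abel
    have h2 : ‖(v - b) - a‖ ^ 2 = ‖v - b‖ ^ 2 + ‖a‖ ^ 2 := by
      rw [norm_sub_sq_real, real_inner_comm, h0]; ring
    rw [h1]
    exact le_of_sq_le_sq (by nlinarith [sq_nonneg ‖a‖]) (norm_nonneg _)
  have hcl : IsClosed {w : X | inner ℝ (T w) w ≤ t * ‖w‖ ^ 2} :=
    isClosed_le (by fun_prop) (by fun_prop)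
  exact closure_minimal (fun w hw => inner_map_le_of_mem_spectralSpan hT (P := Pᶜ)
    (fun μ hμ => ht μ hμ) hw) hcl hvc

/-- Being bounded below extends to the closure of `W`, which `T` therefore embeds with closed range.
The unit ball of the closure is mapped into a compact set, so it is compact, and Riesz's theorem
applies. -/
theorem finiteDimensional_of_bounded_below {T : X →L[ℝ] X} (hc : IsCompactOperator T)
    {W : Submodule ℝ X} {t : ℝ} (ht : 0 < t) (hW : ∀ v ∈ W, t * ‖v‖ ≤ ‖T v‖) :
    FiniteDimensional ℝ W := by
  have hcl : ∀ v ∈ W.topologicalClosure, t * ‖v‖ ≤ ‖T v‖ := by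
    have : IsClosed {v : X | t * ‖v‖ ≤ ‖T v‖} := isClosed_le (by fun_prop) (by fun_prop)
    exact fun v hv => closure_minimal hW this hv
  let S : W.topologicalClosure →L[ℝ] X := T ∘L W.topologicalClosure.subtypeL
  have : CompleteSpace W.topologicalClosure := W.isClosed_topologicalClosure.completeSpace_coe
  have hS : AntilipschitzWith (Real.toNNReal t⁻¹) S := by
    refine AddMonoidHomClass.antilipschitz_of_bound S fun x => ?_
    rw [Real.coe_toNNReal _ (inv_nonneg.2 ht.le), ← div_eq_inv_mul, le_div_iff₀' ht]
    exact hcl x x.2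
  have hE := hS.isClosedEmbedding S.uniformContinuous
  obtain ⟨K, hK, hKs⟩ :=
    (hc.comp_clm W.topologicalClosure.subtypeL).image_closedBall_subset_compact
      (f := (S : W.topologicalClosure →ₗ[ℝ] X)) 1
  have hball : IsCompact (Metric.closedBall (0 : W.topologicalClosure) 1) :=
    (hE.isCompact_preimage hK).of_isClosed_subset Metric.isClosed_closedBall
      (fun x hx => hKs ⟨x, hx, rfl⟩)
  have := FiniteDimensional.of_isCompact_closedBall ℝ one_pos hball
  exact Submodule.finiteDimensional_of_le W.le_topologicalClosure

theorem finiteDimensional_spectralSpan {T : X →L[ℝ] X} (hT : (T : X →ₗ[ℝ] X).IsSymmetric)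
    (hc : IsCompactOperator T) {P : Set ℝ} {t : ℝ} (ht : 0 < t) (hP : ∀ μ ∈ P, t ≤ μ) :
    FiniteDimensional ℝ (spectralSpan T P) := by
  refine finiteDimensional_of_bounded_below hc ht fun v hv => ?_
  have h1 := le_inner_map_of_mem_spectralSpan hT (fun μ hμ _ => hP μ hμ) hv
  have h2 := real_inner_le_norm (T v) v
  by_cases h0 : ‖v‖ = 0
  · simp [h0]
  · have : 0 < ‖v‖ := lt_of_le_of_ne (norm_nonneg _) (Ne.symm h0)
    by_contra hlt
    push Not at hlt
    nlinarith

/-- Eigenvectors for distinct eigenvalues are linearly independent, and here they all lie in one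
finite-dimensional spectral span. -/
theorem finite_eigenvalues_ge {T : X →L[ℝ] X} (hT : (T : X →ₗ[ℝ] X).IsSymmetric)
    (hc : IsCompactOperator T) {t : ℝ} (ht : 0 < t) :
    {μ : ℝ | t ≤ μ ∧ Module.End.HasEigenvalue (T : X →ₗ[ℝ] X) μ}.Finite := by
  set Q := {μ : ℝ | t ≤ μ ∧ Module.End.HasEigenvalue (T : X →ₗ[ℝ] X) μ}
  have hfd := finiteDimensional_spectralSpan hT hc (P := Q) ht fun μ hμ => hμ.1
  choose x hx using fun μ : Q => μ.2.2.exists_hasEigenvector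
  have hli := Module.End.eigenvectors_linearIndependent (T : X →ₗ[ℝ] X) Q x hx
  have hm : ∀ μ, x μ ∈ spectralSpan T Q := fun μ => eigenspace_le_spectralSpan T μ.2 (hx μ).1
  have hli' : LinearIndependent ℝ (fun μ => (⟨x μ, hm μ⟩ : spectralSpan T Q)) :=
    LinearIndependent.of_comp (spectralSpan T Q).subtype hli
  have := hli'.finite
  exact Set.toFinite Q

theorem exists_no_eigenvalue_left {T : X →L[ℝ] X} (hT : (T : X →ₗ[ℝ] X).IsSymmetric)
    (hc : IsCompactOperator T) {t : ℝ} (ht : 0 < t)  :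
    ∃ s, 0 < s ∧ s < t ∧ ∀ μ < t, Module.End.HasEigenvalue (T : X →ₗ[ℝ] X) μ → μ ≤ s := by
  have hfin := (finite_eigenvalues_ge hT hc (half_pos ht)).inter_of_left (Iio t)
  -- Inserting `t / 2` makes the finite set nonempty and keeps its maximum positive even if no
  -- eigenvalue lies in `[t / 2, t)`.
  obtain ⟨s, hs⟩ := (hfin.insert (t / 2)).exists_maximal (insert_nonempty _ _)
  have hle := hs.le_of_ge (y := t / 2) (mem_insert _ _)
  have hmax : ∀ y ∈ insert (t / 2) ({μ : ℝ | t / 2 ≤ μ ∧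
      Module.End.HasEigenvalue (T : X →ₗ[ℝ] X) μ} ∩ Iio t), y ≤ s := fun y hy =>
    (le_total y s).elim id fun h => hs.le_of_ge hy h
  have h2 : t / 2 ≤ s := hmax _ (mem_insert _ _)
  refine ⟨s, by linarith, ?_, fun μ hμ hev => ?_⟩
  · rcases hs.1 with h | h
    · rw [h]; linarith
    · exact h.2
  · by_cases h : t / 2 ≤ μ
    · exact hmax _ (mem_insert_of_mem _ ⟨⟨h, hev⟩, hμ⟩)
    · linarith

theorem exists_no_eigenvalue_right {T : X →L[ℝ] X} (hT : (T : X →ₗ[ℝ] X).IsSymmetric)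
    (hc : IsCompactOperator T) {t : ℝ} (ht : 0 < t)  :
    ∃ s, t < s ∧ ∀ μ, t < μ → Module.End.HasEigenvalue (T : X →ₗ[ℝ] X) μ → s ≤ μ := by
  have hfin := (finite_eigenvalues_ge hT hc ht).inter_of_left (Ioi t)
  obtain ⟨s, hs⟩ := (hfin.insert (t + 1)).exists_minimal (insert_nonempty _ _)
  refine ⟨s, ?_, fun μ hμ hev => ?_⟩
  · rcases hs.1 with h | h
    · rw [h]; linarith
    · exact h.2
  · exact (le_total s μ).elim id fun h => hs.le_of_le (mem_insert_of_mem _ ⟨⟨hμ.le, hev⟩, hμ⟩) h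

end Spectral


/-! ### Counting eigenvalues of finite rank perturbations -/

section Counting

variable {X : Type*} [NormedAddCommGroup X] [InnerProductSpace ℝ X] {ι : Type*} [Fintype ι]

/-- `T = ∑ μ_i ⟨e_i, ·⟩ e_i`. -/
def IsDiagonal (T : X →L[ℝ] X) (e : ι → X) (μ : ι → ℝ) : Prop :=
  ∀ f, T f = ∑ i, (μ i * inner ℝ (e i) f) • e i

theorem IsDiagonal.inner_map_self {T : X →L[ℝ] X} {e : ι → X} {μ : ι → ℝ} (h : IsDiagonal T e μ)
    (v : X) : inner ℝ (T v) v = ∑ i, μ i * inner ℝ (e i) v ^ 2 := by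
  rw [h, sum_inner]
  refine Finset.sum_congr rfl fun i _ => ?_
  rw [real_inner_smul_left]; ring

/-- Courant-Fischer by counting dimensions: were the inequality false, some nonzero vector of `S`
would be orthogonal to every `e i` with `a < μ i`, and its Rayleigh quotient would be at most `a`.
-/
theorem finrank_le_card_filter {T : X →L[ℝ] X} {e : ι → X} {μ : ι → ℝ} (h : IsDiagonal T e μ)
    (he : Orthonormal ℝ e) {S : Submodule ℝ X} [FiniteDimensional ℝ S] {a : ℝ} (ha : 0 < a)
    (hS : ∀ v ∈ S, v ≠ 0 → a * ‖v‖ ^ 2 < inner ℝ (T v) v) :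
    Module.finrank ℝ S ≤ (Finset.univ.filter fun i => a < μ i).card := by
  by_contra hlt
  push Not at hlt
  let L : S →ₗ[ℝ] ({i // a < μ i} → ℝ) :=
    LinearMap.pi fun i => (innerSL ℝ (e i)).toLinearMap ∘ₗ S.subtype
  have hker : LinearMap.ker L ≠ ⊥ := by
    refine LinearMap.ker_ne_bot_of_finrank_lt ?_
    rwa [Module.finrank_fintype_fun_eq_card, Fintype.card_subtype]
  obtain ⟨v, hv, hv0⟩ := Submodule.exists_mem_ne_zero_of_ne_bot hker
  have hz : ∀ i, a < μ i → inner ℝ (e i) (v : X) = 0 := fun i hi =>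
    congrFun (LinearMap.mem_ker.1 hv) ⟨i, hi⟩
  have h1 := hS v v.2 (by simpa using hv0)
  rw [h.inner_map_self] at h1
  have h2 : ∑ i, μ i * inner ℝ (e i) (v : X) ^ 2 ≤ ∑ i, a * inner ℝ (e i) (v : X) ^ 2 := by
    refine Finset.sum_le_sum fun i _ => ?_
    by_cases hi : a < μ i
    · simp [hz i hi]
    · exact mul_le_mul_of_nonneg_right (not_lt.1 hi) (sq_nonneg _)
  -- The family `e` need not be complete, so only Bessel's inequality is available; the sign of `a`
  -- makes it go in the right direction.
  have h3 := he.sum_inner_products_le (v : X) (s := Finset.univ)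
  simp only [Real.norm_eq_abs, sq_abs] at h3
  rw [← Finset.mul_sum] at h2
  nlinarith

theorem card_filter_le_finrank {T : X →L[ℝ] X} {e : ι → X} {μ : ι → ℝ} (h : IsDiagonal T e μ)
    (he : Orthonormal ℝ e) {S : Submodule ℝ X} [FiniteDimensional ℝ S] {b : ℝ}
    (hS : ∀ v ∈ Sᗮ, v ≠ 0 → inner ℝ (T v) v < b * ‖v‖ ^ 2) :
    (Finset.univ.filter fun i => b ≤ μ i).card ≤ Module.finrank ℝ S := by
  by_contra hlt
  push Not at hlt
  let B : ({i // b ≤ μ i} → ℝ) →ₗ[ℝ] X := Fintype.linearCombination ℝ fun i => e i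
  let L : ({i // b ≤ μ i} → ℝ) →ₗ[ℝ] S := S.orthogonalProjectionOnto.toLinearMap ∘ₗ B
  have hker : LinearMap.ker L ≠ ⊥ := by
    refine LinearMap.ker_ne_bot_of_finrank_lt ?_
    rwa [Module.finrank_fintype_fun_eq_card, Fintype.card_subtype]
  obtain ⟨w, hw, hw0⟩ := Submodule.exists_mem_ne_zero_of_ne_bot hker
  have heb : Orthonormal ℝ fun i : {i // b ≤ μ i} => e i := he.comp _ Subtype.val_injective
  set v : X := B w with hvdef
  have hv : v ∈ Sᗮ := Submodule.orthogonalProjectionOnto_eq_zero_iff.1 hw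
  have hvs : v = ∑ i, w i • e i := by simp [hvdef, B, Fintype.linearCombination_apply]
  have hin : ∀ i : {i // b ≤ μ i}, inner ℝ (e i) v = w i := fun i => by
    rw [hvs]; exact heb.inner_right_fintype w i
  have hv0 : v ≠ 0 := fun h0 => hw0 (funext fun i => by rw [← hin i, h0, inner_zero_right]; rfl)
  have hz : ∀ i, ¬ b ≤ μ i → inner ℝ (e i) v = 0 := fun i hi => by
    rw [hvs, inner_sum]
    refine Finset.sum_eq_zero fun j _ => ?_
    rw [real_inner_smul_right, he.2 (fun hij : i = j => hi (by rw [hij]; exact j.2)), mul_zero]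
  have h1 := hS v hv hv0
  rw [h.inner_map_self] at h1
  have hn : ‖v‖ ^ 2 = ∑ i, inner ℝ (e i) v ^ 2 := by
    have e1 : ∑ i, inner ℝ (e i) v ^ 2 = ∑ i with b ≤ μ i, inner ℝ (e i) v ^ 2 :=
      (Finset.sum_filter_of_ne fun i _ h => by
        by_contra hi
        exact h (by rw [hz i hi]; simp)).symm
    rw [e1, Finset.sum_subtype _ (p := fun i => b ≤ μ i) (by simp), ← real_inner_self_eq_norm_sq]
    nth_rewrite 2 [hvs]
    rw [inner_sum]
    refine Finset.sum_congr rfl fun i _ => ?_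
    rw [real_inner_smul_right, real_inner_comm, hin, sq]
  have h2 : ∑ i, b * inner ℝ (e i) v ^ 2 ≤ ∑ i, μ i * inner ℝ (e i) v ^ 2 := by
    refine Finset.sum_le_sum fun i _ => ?_
    by_cases hi : b ≤ μ i
    · exact mul_le_mul_of_nonneg_right hi (sq_nonneg _)
    · simp [hz i hi]
  rw [← Finset.mul_sum, ← hn] at h2
  linarith

variable [CompleteSpace X]

/-- If the only eigenvalue of `T` in `[m - r, m + r]` is `m`, then for every `Th` of finite rank
close to `T` the numbers of eigenvalues of `Th` in `[m + r, ∞)` and in `[m - r, ∞)` are those of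
`T`, and `m ± r` are not among them. -/
theorem exists_forall_card_eq {T : X →L[ℝ] X} (hT : (T : X →ₗ[ℝ] X).IsSymmetric)
    (hc : IsCompactOperator T) {m r : ℝ} (hr : 0 < r) (hm : r < m)
    (hgap : ∀ μ, Module.End.HasEigenvalue (T : X →ₗ[ℝ] X) μ → |μ - m| ≤ r → μ = m) :
    ∃ ε > 0, ∀ {ι : Type} [Fintype ι] (e : ι → X) (μ : ι → ℝ) (Th : X →L[ℝ] X),
      Orthonormal ℝ e → IsDiagonal Th e μ → ‖Th - T‖ < ε →
      (∀ i, μ i ≠ m + r) ∧ (∀ i, μ i ≠ m - r) ∧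
      (Finset.univ.filter fun i => m + r ≤ μ i).card = Module.finrank ℝ (spectralSpan T (Ioi m)) ∧
      (Finset.univ.filter fun i => m - r ≤ μ i).card
        = Module.finrank ℝ (spectralSpan T (Ici m)) := by
  have hm0 : 0 < m := hr.trans hm
  -- Positive eigenvalues of `T` do not accumulate away from `0`, so the gap around `m` extends
  -- strictly beyond `m ± r` on both sides, down to `s` and up to `t`.
  obtain ⟨s, hs0, hs1, hs⟩ := exists_no_eigenvalue_left hT hc (t := m - r) (by linarith)
  obtain ⟨t, ht1, ht⟩ := exists_no_eigenvalue_right hT hc (t := m + r) (by linarith)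
  have hup : ∀ μ, m < μ → Module.End.HasEigenvalue (T : X →ₗ[ℝ] X) μ → t ≤ μ := fun μ h1 h2 =>
    ht μ (by
      by_contra h3
      have := hgap μ h2 (by rw [abs_le]; constructor <;> linarith)
      linarith) h2
  have hlo : ∀ μ, μ < m → Module.End.HasEigenvalue (T : X →ₗ[ℝ] X) μ → μ ≤ s := fun μ h1 h2 =>
    hs μ (by
      by_contra h3
      have := hgap μ h2 (by rw [abs_le]; constructor <;> linarith)
      linarith) h2
  have := finiteDimensional_spectralSpan hT hc (P := Ioi m) hm0 fun μ h => h.le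
  have := finiteDimensional_spectralSpan hT hc (P := Ici m) hm0 fun μ h => h
  -- Each of the four counts below compares the form of `T` at level `t`, `m` or `s` with that of
  -- `Th` at level `m + r` or `m - r`; the perturbation must stay below every such difference.
  refine ⟨min r (min (t - (m + r)) (m - r - s)), by
    refine lt_min hr (lt_min ?_ ?_) <;> linarith, ?_⟩
  intro ι _ e μ Th he hTh hε
  obtain ⟨hε1, hε2⟩ := lt_min_iff.1 hε
  obtain ⟨hε2, hε3⟩ := lt_min_iff.1 hε2
  have hdiff : ∀ v, |inner ℝ (Th v) v - inner ℝ (T v) v| ≤ ‖Th - T‖ * ‖v‖ ^ 2 := fun v => by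
    rw [← inner_sub_left, ← sub_apply]
    refine (abs_real_inner_le_norm _ _).trans ?_
    have := (Th - T).le_opNorm v
    nlinarith [norm_nonneg v]
  have hpos : ∀ v : X, v ≠ 0 → 0 < ‖v‖ ^ 2 := fun v hv => by positivity
  have u1 := finrank_le_card_filter hTh he (S := spectralSpan T (Ioi m)) (a := m + r)
    (by linarith) fun v hv h0 => by
      have h1 := le_inner_map_of_mem_spectralSpan hT (fun μ hμ h => hup μ hμ h) hv
      have h2 := (abs_le.1 (hdiff v)).1
      nlinarith [hpos v h0]
  have u2 := card_filter_le_finrank hTh he (S := spectralSpan T (Ioi m)) (b := m + r)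
    fun v hv h0 => by
      have h1 := inner_map_le_of_mem_spectralSpan_orthogonal hT hc (t := m)
        (fun μ hμ _ => not_lt.1 hμ) hv
      have h2 := (abs_le.1 (hdiff v)).2
      nlinarith [hpos v h0]
  have l1 := finrank_le_card_filter hTh he (S := spectralSpan T (Ici m)) (a := m - r)
    (by linarith) fun v hv h0 => by
      have h1 := le_inner_map_of_mem_spectralSpan hT (t := m) (fun μ hμ h => hμ) hv
      have h2 := (abs_le.1 (hdiff v)).1
      nlinarith [hpos v h0]
  have l2 := card_filter_le_finrank hTh he (S := spectralSpan T (Ici m)) (b := m - r)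
    fun v hv h0 => by
      have h1 := inner_map_le_of_mem_spectralSpan_orthogonal hT hc (t := s)
        (fun μ hμ h => hlo μ (not_le.1 hμ) h) hv
      have h2 := (abs_le.1 (hdiff v)).2
      nlinarith [hpos v h0]
  have hsub : ∀ x : ℝ, (Finset.univ.filter fun i => x < μ i) ⊆
      Finset.univ.filter fun i => x ≤ μ i := fun x =>
    Finset.monotone_filter_right _ fun i _ h => le_of_lt h
  -- The dimension lies between the count with `x ≤ μ i` and the count with `x < μ i`, so the two
  -- counts coincide and no `μ i` equals `x`.
  have hne : ∀ (x : ℝ) (i : ι), (Finset.univ.filter fun i => x ≤ μ i).card ≤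
      (Finset.univ.filter fun i => x < μ i).card → μ i ≠ x := fun x i hcard hi => by
    have heq := Finset.eq_of_subset_of_card_le (hsub x) hcard
    have : i ∈ Finset.univ.filter fun i => x < μ i := by rw [heq]; simp [hi]
    simp [hi] at this
  exact ⟨fun i => hne _ i (u2.trans u1), fun i => hne _ i (l2.trans l1),
    le_antisymm u2 (u1.trans (Finset.card_le_card (hsub _))),
    le_antisymm l2 (l1.trans (Finset.card_le_card (hsub _)))⟩

end Counting

/-- For an antitone sequence the values `≥ x` are the first ones. -/
theorem le_iff_lt_card_of_antitone {n : ℕ} {μ : Fin n → ℝ} (hμ : Antitone μ) (x : ℝ) (i : Fin n) :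
    x ≤ μ i ↔ (i : ℕ) < (Finset.univ.filter fun i => x ≤ μ i).card := by
  constructor
  · intro h
    have : Finset.Iic i ⊆ Finset.univ.filter fun i => x ≤ μ i := fun j hj => by
      simpa using h.trans (hμ (Finset.mem_Iic.1 hj))
    have := Finset.card_le_card this
    rw [Fin.card_Iic] at this
    omega
  · intro h
    by_contra hx
    have : (Finset.univ.filter fun i => x ≤ μ i) ⊆ Finset.Iio i := fun j hj => by
      rw [Finset.mem_Iio]
      by_contra hij
      exact hx ((by simpa using hj : x ≤ μ j).trans (hμ (not_lt.1 hij)))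
    have := Finset.card_le_card this
    rw [Fin.card_Iio] at this
    omega


/-! ### Resolvents of combinations of orthogonal idempotents -/

section Idempotents

variable {𝒜 : Type*} [NormedRing 𝒜] [NormedAlgebra ℂ 𝒜] {ι : Type*} [Fintype ι]
  [DecidableEq ι]

/-- Reduces the verification of an inverse to a scalar identity for each coefficient. -/
theorem mul_combination_idempotents {Q : ι → 𝒜} (hQ : ∀ i j, Q i * Q j = if i = j then Q i else 0)
    (x y : ℂ) (a b : ι → ℂ) :
    (x • (1 : 𝒜) + ∑ i, a i • Q i) * (y • (1 : 𝒜) + ∑ i, b i • Q i)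
      = (x * y) • (1 : 𝒜) + ∑ i, (x * b i + y * a i + a i * b i) • Q i := by
  have h : (∑ i, a i • Q i) * (∑ i, b i • Q i) = ∑ i, (a i * b i) • Q i := by
    rw [Finset.sum_mul_sum]
    refine Finset.sum_congr rfl fun i _ => ?_
    rw [Finset.sum_eq_single i]
    · rw [smul_mul_smul_comm, hQ, if_pos rfl]
    · intro j _ hj
      rw [smul_mul_smul_comm, hQ, if_neg (Ne.symm hj), smul_zero]
    · simp
  rw [add_mul, mul_add, mul_add, h]
  simp only [one_mul, smul_mul_assoc, mul_smul_comm, mul_one, Finset.smul_sum,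
    add_smul, Finset.sum_add_distrib, mul_smul]
  rw [smul_comm y x]
  abel

/-- The inverse of `z - ∑ μ_i Q_i`. -/
noncomputable def resolventFormula (Q : ι → 𝒜) (μ : ι → ℂ) (z : ℂ) : 𝒜 :=
  z⁻¹ • (1 : 𝒜) + ∑ i, ((z - μ i)⁻¹ - z⁻¹) • Q i

/-- The combination acts as `μ i` on the range of `Q i` and as `0` on the common kernel of the `Q
i`, so the inverse acts as `(z - μ i)⁻¹` and `z⁻¹` there. The `Q i` are not assumed to sum to the
identity, hence the condition `z ≠ 0`. -/
theorem resolvent_combination_idempotents {Q : ι → 𝒜}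
    (hQ : ∀ i j, Q i * Q j = if i = j then Q i else 0) (μ : ι → ℂ) {z : ℂ} (hz : z ≠ 0)
    (hμ : ∀ i, z ≠ μ i) :
    z ∈ resolventSet ℂ (∑ i, μ i • Q i) ∧
      resolvent (∑ i, μ i • Q i) z = resolventFormula Q μ z := by
  have e1 : algebraMap ℂ 𝒜 z - ∑ i, μ i • Q i = z • (1 : 𝒜) + ∑ i, (-μ i) • Q i := by
    rw [Algebra.algebraMap_eq_smul_one]
    simp [sub_eq_add_neg]
  have hne : ∀ i, z - μ i ≠ 0 := fun i => sub_ne_zero.2 (hμ i)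
  let u : 𝒜ˣ := ⟨z • (1 : 𝒜) + ∑ i, (-μ i) • Q i, resolventFormula Q μ z, by
      rw [resolventFormula, mul_combination_idempotents hQ, mul_inv_cancel₀ hz, one_smul,
        Finset.sum_eq_zero, add_zero]
      intro i _
      have := hne i
      have : z * ((z - μ i)⁻¹ - z⁻¹) + z⁻¹ * -μ i + -μ i * ((z - μ i)⁻¹ - z⁻¹) = 0 := by
        field_simp; ring
      rw [this, zero_smul], by
      rw [resolventFormula, mul_combination_idempotents hQ, inv_mul_cancel₀ hz, one_smul,
        Finset.sum_eq_zero, add_zero]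
      intro i _
      have := hne i
      have : z⁻¹ * -μ i + z * ((z - μ i)⁻¹ - z⁻¹) + ((z - μ i)⁻¹ - z⁻¹) * -μ i = 0 := by
        field_simp; ring
      rw [this, zero_smul]⟩
  have e2 : algebraMap ℂ 𝒜 z - ∑ i, μ i • Q i = (u : 𝒜) := e1
  constructor
  · rw [spectrum.mem_resolventSet_iff, e2]
    exact u.isUnit
  · rw [resolvent, e2, Ring.inverse_unit]
    rfl

theorem circleIntegral_sub_inv_eq_zero {c w : ℂ} {R : ℝ} (hR : 0 ≤ R)
    (hw : w ∉ Metric.closedBall c R) : (∮ z in C(c, R), (z - w)⁻¹) = 0 := by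
  refine Complex.circleIntegral_eq_zero_of_differentiable_on_off_countable hR countable_empty
    ?_ ?_
  · exact (continuousOn_id.sub continuousOn_const).inv₀ fun z hz h =>
      hw (by rwa [← (sub_eq_zero.1 h : z = w)])
  · intro z hz
    refine ((differentiableAt_id).sub_const w).inv ?_
    exact fun h => hw (by rw [← sub_eq_zero.1 h]; exact Metric.ball_subset_closedBall hz.1)

variable [CompleteSpace 𝒜]

/-- Integrated term by term, the formula for the resolvent leaves only scalar Cauchy integrals:
`z⁻¹` contributes nothing because `0` is outside the disc, and `(z - μ i)⁻¹` contributes `2πi` or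
`0` according to the position of `μ i`. -/
theorem circleIntegral_resolvent_combination {Q : ι → 𝒜}
    (hQ : ∀ i j, Q i * Q j = if i = j then Q i else 0) (μ : ι → ℂ) {c : ℂ} {R : ℝ} (hR : 0 ≤ R)
    (h0 : (0 : ℂ) ∉ Metric.closedBall c R) (hμ : ∀ i, μ i ∉ Metric.sphere c R) :
    (2 * (Real.pi : ℂ) * Complex.I)⁻¹ •
        circleIntegral (fun z => resolvent (∑ i, μ i • Q i) z) c R
      = ∑ i, open Classical in if μ i ∈ Metric.ball c R then Q i else 0 := by
  have hpi : 2 * (Real.pi : ℂ) * Complex.I ≠ 0 := Complex.two_pi_I_ne_zero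
  have hcont : ∀ w : ℂ, w ∉ Metric.sphere c R →
      CircleIntegrable (fun z => (z - w)⁻¹) c R := fun w hw =>
    ContinuousOn.circleIntegrable hR ((continuousOn_id.sub continuousOn_const).inv₀
      fun z hz h => hw (by rwa [← (sub_eq_zero.1 h : z = w)]))
  have h0s : (0 : ℂ) ∉ Metric.sphere c R := fun h => h0 (Metric.sphere_subset_closedBall h)
  have hcont0 : CircleIntegrable (fun z : ℂ => z⁻¹) c R := by simpa using hcont 0 h0s
  have hint0 : (∮ z in C(c, R), z⁻¹) = 0 := by
    simpa using circleIntegral_sub_inv_eq_zero hR h0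
  have key : circleIntegral (fun z => resolvent (∑ i, μ i • Q i) z) c R
      = ∮ z in C(c, R), resolventFormula Q μ z := by
    refine circleIntegral.integral_congr hR fun z hz => ?_
    exact (resolvent_combination_idempotents hQ μ (fun h => h0s (h ▸ hz))
      (fun i h => hμ i (h ▸ hz))).2
  have hsm : ∀ (f : ℂ → ℂ) (x : 𝒜), CircleIntegrable f c R →
      CircleIntegrable (fun z => f z • x) c R := fun f x hf => by
    exact ⟨hf.1.smul_const x, hf.2.smul_const x⟩
  have hi : ∀ i, CircleIntegrable (fun z : ℂ => (z - μ i)⁻¹ - z⁻¹) c R := fun i =>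
    (hcont _ (hμ i)).sub hcont0
  rw [key]
  simp only [resolventFormula]
  rw [circleIntegral.integral_add (hsm _ _ hcont0)
      (CircleIntegrable.fun_sum _ fun i _ => hsm _ _ (hi i)),
    circleIntegral.integral_smul_const, hint0, zero_smul, zero_add,
    circleIntegral.integral_fun_sum fun i _ => hsm _ _ (hi i), Finset.smul_sum]
  refine Finset.sum_congr rfl fun i _ => ?_
  rw [circleIntegral.integral_smul_const, circleIntegral.integral_sub (hcont _ (hμ i)) hcont0,
    hint0, sub_zero]
  by_cases hb : μ i ∈ Metric.ball c R
  · rw [if_pos hb, circleIntegral.integral_sub_inv_of_mem_ball hb, inv_smul_smul₀ hpi]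
  · rw [if_neg hb, circleIntegral_sub_inv_eq_zero hR, zero_smul, smul_zero]
    intro h
    rcases (Metric.mem_closedBall.1 h).lt_or_eq with h' | h'
    · exact hb h'
    · exact hμ i h'

end Idempotents

/-! ### Complexification -/

section Complexify

variable {d : ℕ} {Ω : Set (Pt d)}

theorem rePart_toC (f : L2 Ω) : rePart Ω (toC Ω f) = f := by
  apply Lp.ext
  filter_upwards [Complex.reCLM.coeFn_compLpL (p := 2) (toC Ω f),
    Complex.ofRealCLM.coeFn_compLpL (p := 2) f] with x h1 h2
  simp only [rePart, toC] at *
  rw [h1, h2]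
  simp

theorem imPart_toC (f : L2 Ω) : imPart Ω (toC Ω f) = 0 := by
  apply Lp.ext
  filter_upwards [Complex.imCLM.coeFn_compLpL (p := 2) (toC Ω f),
    Complex.ofRealCLM.coeFn_compLpL (p := 2) f, Lp.coeFn_zero ℝ 2 (volume.restrict Ω)]
    with x h1 h2 h3
  simp only [imPart, toC] at *
  rw [h1, h2, h3]
  simp

theorem toC_injective : Function.Injective (toC Ω) := fun f g h => by
  rw [← rePart_toC f, h, rePart_toC]

theorem toC_smul (t : ℝ) (f : L2 Ω) : toC Ω (t • f) = (t : ℂ) • toC Ω f := by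
  rw [map_smul]
  apply Lp.ext
  filter_upwards [Lp.coeFn_smul t (toC Ω f), Lp.coeFn_smul (t : ℂ) (toC Ω f)] with x h1 h2
  rw [h1, h2]
  simp

theorem complexify_apply (T : L2 Ω →L[ℝ] L2 Ω) (f : L2C Ω) :
    complexify T f = toC Ω (T (rePart Ω f)) + Complex.I • toC Ω (T (imPart Ω f)) := rfl

theorem complexify_toC (T : L2 Ω →L[ℝ] L2 Ω) (f : L2 Ω) :
    complexify T (toC Ω f) = toC Ω (T f) := by
  rw [complexify_apply, rePart_toC, imPart_toC]; simp

theorem complexify_mul (S T : L2 Ω →L[ℝ] L2 Ω) :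
    complexify S * complexify T = complexify (S * T) := by
  ext1 f
  rw [mul_apply_eq_comp, complexify_apply T, map_add, map_smul, complexify_toC,
    complexify_toC]
  rfl

theorem complexify_zero : complexify (0 : L2 Ω →L[ℝ] L2 Ω) = 0 := by
  ext1 f
  simp [complexify_apply]

theorem complexify_combination {ι : Type*} (s : Finset ι) (μ : ι → ℝ) (T : ι → L2 Ω →L[ℝ] L2 Ω) :
    complexify (∑ i ∈ s, μ i • T i) = ∑ i ∈ s, (μ i : ℂ) • complexify (T i) := by
  ext1 f
  simp only [complexify_apply, sum_apply, smul_apply,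
    map_sum, toC_smul, Finset.smul_sum, Finset.sum_add_distrib, smul_add]
  congr 1
  exact Finset.sum_congr rfl fun i _ => smul_comm _ _ _

/-- Lets the isolation assumption, which concerns complex eigenvalues, be applied to the real
operator. -/
theorem hasEigenvalue_complexify {T : L2 Ω →L[ℝ] L2 Ω} {μ : ℝ}
    (h : Module.End.HasEigenvalue (T : L2 Ω →ₗ[ℝ] L2 Ω) μ) :
    Module.End.HasEigenvalue (complexify T : L2C Ω →ₗ[ℂ] L2C Ω) (μ : ℂ) := by
  obtain ⟨f, hf⟩ := h.exists_hasEigenvector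
  refine Module.End.hasEigenvalue_of_hasEigenvector (x := toC Ω f) ⟨?_, ?_⟩
  · rw [Module.End.mem_eigenspace_iff]
    have : T f = μ • f := hf.apply_eq_smul
    exact (complexify_toC T f).trans (by rw [this, toC_smul])
  · exact fun h0 => hf.2 (toC_injective (by rw [h0, map_zero]))

/-- The orthogonal projection `f ↦ ⟨e, f⟩ e` onto the line spanned by a unit vector. -/
noncomputable def lineProj (e : L2 Ω) : L2 Ω →L[ℝ] L2 Ω := (innerSL ℝ e).smulRight e

theorem lineProj_apply (e f : L2 Ω) : lineProj e f = (inner ℝ e f : ℝ) • e := rfl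

variable {ι : Type*} [Fintype ι] [DecidableEq ι]

theorem complexify_lineProj_mul {e : ι → L2 Ω} (he : Orthonormal ℝ e) (i j : ι) :
    complexify (lineProj (e i)) * complexify (lineProj (e j))
      = if i = j then complexify (lineProj (e i)) else 0 := by
  rw [complexify_mul]
  have hij := (orthonormal_iff_ite.1 he) i j
  split_ifs at hij ⊢ with h
  · subst h
    congr 1
    ext1 f
    rw [mul_apply_eq_comp, lineProj_apply, lineProj_apply, real_inner_smul_right, hij, mul_one]
  · rw [← complexify_zero]
    congr 1
    ext1 f
    rw [mul_apply_eq_comp, lineProj_apply, lineProj_apply, real_inner_smul_right, hij]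
    simp

theorem IsDiagonal.complexify_eq {T : L2 Ω →L[ℝ] L2 Ω} {e : ι → L2 Ω} {μ : ι → ℝ}
    (h : IsDiagonal T e μ) :
    complexify T = ∑ i, (μ i : ℂ) • complexify (lineProj (e i)) := by
  rw [← complexify_combination]
  congr 1
  ext1 f
  rw [h f]
  simp [lineProj_apply, mul_smul]

theorem ofReal_mem_ball_iff {x m r : ℝ} : (x : ℂ) ∈ Metric.ball (m : ℂ) r ↔ |x - m| < r := by
  rw [Metric.mem_ball, Complex.dist_eq, ← Complex.ofReal_sub, Complex.norm_real, Real.norm_eq_abs]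

theorem ofReal_mem_sphere_iff {x m r : ℝ} : (x : ℂ) ∈ Metric.sphere (m : ℂ) r ↔ |x - m| = r := by
  rw [mem_sphere_iff_norm, ← Complex.ofReal_sub, Complex.norm_real, Real.norm_eq_abs]

theorem zero_notMem_closedBall {m r : ℝ} (hr : r < m) :
    (0 : ℂ) ∉ Metric.closedBall (m : ℂ) r := by
  rw [Metric.mem_closedBall, dist_comm, dist_zero_right, Complex.norm_real, Real.norm_eq_abs,
    not_le]
  exact hr.trans_le (le_abs_self m)

theorem IsDiagonal.sphere_subset_resolventSet {T : L2 Ω →L[ℝ] L2 Ω} {e : ι → L2 Ω} {μ : ι → ℝ}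
    (h : IsDiagonal T e μ) (he : Orthonormal ℝ e) {m r : ℝ} (hr : r < m)
    (hμ : ∀ i, |μ i - m| ≠ r) :
    ∀ z ∈ Metric.sphere (m : ℂ) r, z ∈ resolventSet ℂ (complexify T) := by
  intro z hz
  rw [h.complexify_eq]
  refine (resolvent_combination_idempotents (complexify_lineProj_mul he) (fun i => (μ i : ℂ))
    ?_ ?_).1
  · rintro rfl
    exact zero_notMem_closedBall hr (Metric.sphere_subset_closedBall hz)
  · rintro i rfl
    exact hμ i (ofReal_mem_sphere_iff.1 hz)

/-- The lines spanned by the `e i` give orthogonal idempotents after complexification, and the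
contour selects those inside the circle. On real functions the spectral projection is thus an
ordinary orthogonal projection. -/
theorem IsDiagonal.rieszProj_toC {T : L2 Ω →L[ℝ] L2 Ω} {e : ι → L2 Ω} {μ : ι → ℝ}
    (h : IsDiagonal T e μ) (he : Orthonormal ℝ e) {m r : ℝ} (hr0 : 0 ≤ r) (hr : r < m)
    (hμ : ∀ i, |μ i - m| ≠ r) (f : L2 Ω) :
    rieszProj (complexify T) (m : ℂ) r (toC Ω f)
      = toC Ω (∑ i with |μ i - m| < r, (inner ℝ (e i) f : ℝ) • e i) := by
  rw [rieszProj, h.complexify_eq,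
    circleIntegral_resolvent_combination (complexify_lineProj_mul he) (fun i => (μ i : ℂ)) hr0
      (zero_notMem_closedBall hr) fun i hi => hμ i (ofReal_mem_sphere_iff.1 hi),
    sum_apply, map_sum, Finset.sum_filter]
  refine Finset.sum_congr rfl fun i _ => ?_
  simp only [ofReal_mem_ball_iff]
  split_ifs
  · rw [complexify_toC]; rfl
  · rfl

end Complexify


/-! ### Square integrals -/

theorem enorm_sq_eq_lintegral {α E : Type*} [NormedAddCommGroup E] {m : MeasurableSpace α}
    {μ : Measure α} (f : Lp E 2 μ) {g : α → E} (h : f =ᵐ[μ] g) :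
    ‖f‖ₑ ^ 2 = ∫⁻ x, ‖g x‖ₑ ^ 2 ∂μ := by
  have := eLpNorm_nnreal_pow_eq_lintegral (f := (f : α → E)) (μ := μ) (p := 2) (by simp)
  simp only [NNReal.coe_ofNat, ENNReal.rpow_ofNat] at this
  rw [Lp.enorm_def]
  refine this.trans (lintegral_congr_ae ?_)
  filter_upwards [h] with x hx
  rw [hx]

theorem lintegral_sq_le {α : Type*} {m : MeasurableSpace α} {μ : Measure α} {g : α → ℝ≥0∞}
    (hg : AEMeasurable g μ) : (∫⁻ x, g x ∂μ) ^ 2 ≤ μ univ * ∫⁻ x, g x ^ 2 ∂μ := by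
  have h := ENNReal.lintegral_mul_le_Lp_mul_Lq μ (p := 2) (q := 2) Real.HolderConjugate.two_two hg
    (aemeasurable_const (b := (1 : ℝ≥0∞)))
  simp only [Pi.mul_apply, mul_one, ENNReal.rpow_ofNat, one_pow, lintegral_one] at h
  calc (∫⁻ x, g x ∂μ) ^ 2 ≤ ((∫⁻ x, g x ^ 2 ∂μ) ^ (1 / 2 : ℝ) * μ univ ^ (1 / 2 : ℝ)) ^ 2 := by
        gcongr
    _ = μ univ * ∫⁻ x, g x ^ 2 ∂μ := by
        rw [mul_pow, ← ENNReal.rpow_natCast, ← ENNReal.rpow_natCast, ← ENNReal.rpow_mul,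
          ← ENNReal.rpow_mul]
        norm_num [mul_comm]

/-! ### Test functions -/

section Test

variable {d : ℕ}

/-- `φ ∈ C_c^∞(Ω)`. -/
structure IsTest (Ω : Set (Pt d)) (φ : Pt d → ℝ) : Prop where
  smooth : ContDiff ℝ ∞ φ
  compact : HasCompactSupport φ
  subset : tsupport φ ⊆ Ω

theorem norm_gradient_eq (φ : Pt d → ℝ) (x : Pt d) : ‖gradient φ x‖ = ‖fderiv ℝ φ x‖ := by
  simp [gradient]

theorem continuous_gradient {φ : Pt d → ℝ} (h : ContDiff ℝ 1 φ) : Continuous (gradient φ) :=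
  (InnerProductSpace.toDual ℝ (Pt d)).symm.continuous.comp (h.continuous_fderiv one_ne_zero)

theorem tsupport_gradient_subset (φ : Pt d → ℝ) : tsupport (gradient φ) ⊆ tsupport φ := by
  refine closure_minimal (fun x hx => ?_) (isClosed_tsupport φ)
  refine support_fderiv_subset ℝ (f := φ) ?_
  rw [Function.mem_support] at hx ⊢
  intro h0
  apply hx
  simp [gradient, h0]

/-- The difference is the integral of the derivative along the segment from `x` to `x + h`. Apply
Cauchy-Schwarz in `t`, exchange the integrals and use translation invariance. Both Poincaré's
inequality and Rellich's theorem rest on this bound. -/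
theorem lintegral_translate_sub_le {φ : Pt d → ℝ} (hφ : ContDiff ℝ 1 φ) (h : Pt d) :
    ∫⁻ x, ‖φ (x + h) - φ x‖ₑ ^ 2 ≤ ‖h‖ₑ ^ 2 * ∫⁻ x, ‖gradient φ x‖ₑ ^ 2 := by
  have hG : Continuous fun x => ‖gradient φ x‖ₑ := (continuous_gradient hφ).enorm
  have hpt : ∀ x, ‖φ (x + h) - φ x‖ₑ ^ 2
      ≤ ∫⁻ t in Ioc (0 : ℝ) 1, ‖h‖ₑ ^ 2 * ‖gradient φ (x + t • h)‖ₑ ^ 2 := fun x => by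
    have hder : ∀ t : ℝ, HasDerivAt (fun t : ℝ => φ (x + t • h)) (fderiv ℝ φ (x + t • h) h) t := by
      intro t
      have h1 : HasDerivAt (fun t : ℝ => x + t • h) h t := by
        simpa using ((hasDerivAt_id t).smul_const h).const_add x
      exact ((hφ.differentiable one_ne_zero).differentiableAt.hasFDerivAt).comp_hasDerivAt t h1
    have hcont : Continuous fun t : ℝ => fderiv ℝ φ (x + t • h) h :=
      ((hφ.continuous_fderiv one_ne_zero).comp (by fun_prop)).clm_apply continuous_const
    have hftc := intervalIntegral.integral_eq_sub_of_hasDerivAt (a := 0) (b := 1)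
      (fun t _ => hder t) (hcont.intervalIntegrable _ _)
    simp only [one_smul, zero_smul, add_zero] at hftc
    rw [← hftc, intervalIntegral.integral_of_le zero_le_one]
    have hmeas : AEMeasurable (fun t : ℝ => ‖h‖ₑ * ‖gradient φ (x + t • h)‖ₑ)
        (volume.restrict (Ioc (0 : ℝ) 1)) :=
      ((hG.comp (by fun_prop : Continuous fun t : ℝ => x + t • h)).measurable.const_mul
        _).aemeasurable
    calc ‖∫ t in Ioc (0 : ℝ) 1, fderiv ℝ φ (x + t • h) h‖ₑ ^ 2
        ≤ (∫⁻ t in Ioc (0 : ℝ) 1, ‖fderiv ℝ φ (x + t • h) h‖ₑ) ^ 2 := by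
          gcongr; exact enorm_integral_le_lintegral_enorm _
      _ ≤ (∫⁻ t in Ioc (0 : ℝ) 1, ‖h‖ₑ * ‖gradient φ (x + t • h)‖ₑ) ^ 2 := by
          gcongr with t
          rw [← ofReal_norm, ← ofReal_norm, ← ofReal_norm, norm_gradient_eq, ← ENNReal.ofReal_mul (norm_nonneg _)]
          exact ENNReal.ofReal_le_ofReal ((ContinuousLinearMap.le_opNorm _ _).trans_eq (mul_comm _ _))
      _ ≤ _ := by
          refine (lintegral_sq_le hmeas).trans ?_
          simp [mul_pow]
  calc ∫⁻ x, ‖φ (x + h) - φ x‖ₑ ^ 2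
      ≤ ∫⁻ x, ∫⁻ t in Ioc (0 : ℝ) 1, ‖h‖ₑ ^ 2 * ‖gradient φ (x + t • h)‖ₑ ^ 2 :=
        lintegral_mono hpt
    _ = ∫⁻ t in Ioc (0 : ℝ) 1, ∫⁻ x, ‖h‖ₑ ^ 2 * ‖gradient φ (x + t • h)‖ₑ ^ 2 := by
        refine lintegral_lintegral_swap (Continuous.aemeasurable ?_)
        have : Continuous fun p : Pt d × ℝ => ‖gradient φ (p.1 + p.2 • h)‖ₑ :=
          hG.comp (by fun_prop)
        simp only [Function.uncurry_def]
        exact (ENNReal.continuous_const_mul (by simp)).comp ((ENNReal.continuous_pow 2).comp this)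
    _ = ∫⁻ t in Ioc (0 : ℝ) 1, ‖h‖ₑ ^ 2 * ∫⁻ x, ‖gradient φ x‖ₑ ^ 2 := by
        refine lintegral_congr fun t => ?_
        have hm : Measurable fun x => ‖gradient φ (x + t • h)‖ₑ ^ 2 :=
          (hG.comp (by fun_prop : Continuous fun x : Pt d => x + t • h)).measurable.pow_const 2
        rw [lintegral_const_mul _ hm,
          lintegral_add_right_eq_self (fun x => ‖gradient φ x‖ₑ ^ 2)]
    _ = _ := by simp

end Test


/-! ### Density of test functions in `H¹₀(Ω)` and Poincaré's inequality -/

section H10Basic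

variable {d : ℕ} {Ω : Set (Pt d)}

theorem IsTest.memLp {φ : Pt d → ℝ} (h : IsTest Ω φ) : MemLp φ 2 (volume.restrict Ω) :=
  (h.smooth.continuous.memLp_of_hasCompactSupport h.compact).restrict Ω

theorem IsTest.memLp_gradient {φ : Pt d → ℝ} (h : IsTest Ω φ) :
    MemLp (gradient φ) 2 (volume.restrict Ω) :=
  ((continuous_gradient (h.smooth.of_le (by simp))).memLp_of_hasCompactSupport
    (h.compact.of_isClosed_subset (isClosed_tsupport _) (tsupport_gradient_subset φ))).restrict Ω

theorem gradient_add_apply {φ ψ : Pt d → ℝ} {x : Pt d} (h1 : DifferentiableAt ℝ φ x)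
    (h2 : DifferentiableAt ℝ ψ x) : gradient (φ + ψ) x = gradient φ x + gradient ψ x := by
  simp [gradient, fderiv_add h1 h2]

theorem gradient_const_smul_apply {φ : Pt d → ℝ} {x : Pt d} (t : ℝ)
    (h1 : DifferentiableAt ℝ φ x) : gradient (t • φ) x = t • gradient φ x := by
  simp [gradient, fderiv_const_smul h1]

/-- The test pairs as a linear subspace. -/
def testSubmodule (Ω : Set (Pt d)) : Submodule ℝ (L2Pair Ω) where
  carrier := testPairs Ω
  zero_mem' := by
    refine ⟨0, contDiff_const, HasCompactSupport.zero, by simp [tsupport], Lp.coeFn_zero _ _ _, ?_⟩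
    have : gradient (0 : Pt d → ℝ) = 0 := by ext1 x; simp [gradient]
    rw [this]
    exact Lp.coeFn_zero _ _ _
  add_mem' := by
    rintro p q ⟨φ, h1, h2, h3, h4, h5⟩ ⟨ψ, k1, k2, k3, k4, k5⟩
    refine ⟨φ + ψ, h1.add k1, h2.add k2, (tsupport_add φ ψ).trans (union_subset h3 k3), ?_, ?_⟩
    · exact (Lp.coeFn_add p.fst q.fst).trans (h4.add k4)
    · refine (Lp.coeFn_add p.snd q.snd).trans ((h5.add k5).trans (Filter.Eventually.of_forall ?_))
      intro x
      exact (gradient_add_apply (h1.differentiable (by simp) x)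
        (k1.differentiable (by simp) x)).symm
  smul_mem' := by
    rintro t p ⟨φ, h1, h2, h3, h4, h5⟩
    refine ⟨t • φ, h1.const_smul t, h2.smul_left (f := fun _ => t),
      (tsupport_smul_subset_right (fun _ => t) φ).trans h3, ?_, ?_⟩
    · exact (Lp.coeFn_smul t p.fst).trans (h4.const_smul t)
    · refine (Lp.coeFn_smul t p.snd).trans ((h5.const_smul t).trans
        (Filter.Eventually.of_forall fun x => ?_))
      exact (gradient_const_smul_apply t (h1.differentiable (by simp) x)).symm

theorem H10_eq_closure : (H10 Ω : Set (L2Pair Ω)) = closure (testPairs Ω) := by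
  have : Submodule.span ℝ (testPairs Ω) = testSubmodule Ω := Submodule.span_eq (testSubmodule Ω)
  rw [H10, this, Submodule.topologicalClosure_coe]
  rfl

theorem H10_induction {p : L2Pair Ω → Prop} (hp : IsClosed {u | p u})
    (h : ∀ u : L2Pair Ω, ∀ φ, IsTest Ω φ → u.fst =ᵐ[volume.restrict Ω] φ →
      u.snd =ᵐ[volume.restrict Ω] gradient φ → p u) (u : H10 Ω) : p u := by
  have hu : (u : L2Pair Ω) ∈ closure (testPairs Ω) := by rw [← H10_eq_closure]; exact u.2
  refine closure_minimal ?_ hp hu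
  rintro v ⟨φ, h1, h2, h3, h4, h5⟩
  exact h v φ ⟨h1, h2, h3⟩ h4 h5

theorem norm_sq_eq (u : H10 Ω) : ‖u‖ ^ 2 = ‖toL2 u‖ ^ 2 + ‖grad u‖ ^ 2 := by
  rw [Submodule.coe_norm, WithLp.prod_norm_sq_eq_of_L2]
  rfl

theorem norm_grad_le (u : H10 Ω) : ‖grad u‖ ≤ ‖u‖ :=
  le_of_sq_le_sq (by rw [norm_sq_eq]; nlinarith [sq_nonneg ‖toL2 u‖]) (norm_nonneg _)

/-- The weak gradient `H¹₀(Ω) → L²(Ω; ℝ^d)` as a bounded operator. -/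
noncomputable def gradL (Ω : Set (Pt d)) : H10 Ω →L[ℝ] Lp (Pt d) 2 (volume.restrict Ω) :=
  LinearMap.mkContinuous { toFun := grad, map_add' := fun _ _ => rfl, map_smul' := fun _ _ => rfl }
    1 fun u => by rw [one_mul]; exact norm_grad_le u

instance : CompleteSpace (H10 Ω) :=
  (Submodule.isClosed_topologicalClosure _).completeSpace_coe

theorem continuous_fst_L2Pair : Continuous fun u : L2Pair Ω => u.fst :=
  continuous_fst.comp (WithLp.prod_continuous_ofLp 2 _ _)

theorem continuous_snd_L2Pair : Continuous fun u : L2Pair Ω => u.snd :=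
  continuous_snd.comp (WithLp.prod_continuous_ofLp 2 _ _)

theorem IsTest.eq_zero {φ : Pt d → ℝ} (h : IsTest Ω φ) {x : Pt d} (hx : x ∉ Ω) : φ x = 0 :=
  image_eq_zero_of_notMem_tsupport fun h' => hx (h.subset h')

theorem IsTest.gradient_eq_zero {φ : Pt d → ℝ} (h : IsTest Ω φ) {x : Pt d} (hx : x ∉ Ω) :
    gradient φ x = 0 :=
  image_eq_zero_of_notMem_tsupport fun h' => hx (h.subset (tsupport_gradient_subset φ h'))

theorem IsTest.lintegral_gradient {φ : Pt d → ℝ} (h : IsTest Ω φ) :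
    ∫⁻ x in Ω, ‖gradient φ x‖ₑ ^ 2 = ∫⁻ x, ‖gradient φ x‖ₑ ^ 2 := by
  refine setLIntegral_eq_of_support_subset fun x hx => ?_
  by_contra hxΩ
  exact hx (by simp [h.gradient_eq_zero hxΩ])

/-- Poincaré's inequality. -/
theorem exists_poincare (hd : 1 ≤ d) (hΩ : IsOpen Ω) (hb : Bornology.IsBounded Ω) :
    ∃ C > 0, ∀ u : H10 Ω, ‖toL2 u‖ ≤ C * ‖grad u‖ := by
  obtain ⟨R, hR0, hR⟩ := hb.exists_pos_norm_le
  -- As `Ω` lies in the ball of radius `R`, a shift by `3 * R` moves it off itself. Then `φ (x + h)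
  -- = 0` for `x ∈ Ω`, and the translation estimate bounds `φ` itself.
  let h : Pt d := EuclideanSpace.single ⟨0, hd⟩ (3 * R)
  have hh : ‖h‖ = 3 * R := by
    rw [PiLp.norm_single, Real.norm_eq_abs, abs_of_pos (by linarith)]
  refine ⟨3 * R, by linarith, H10_induction (isClosed_le continuous_fst_L2Pair.norm
    (continuous_snd_L2Pair.norm.const_mul (3 * R))) ?_⟩
  intro u φ hφ h1 h2
  have key : ‖u.fst‖ₑ ^ 2 ≤ ‖h‖ₑ ^ 2 * ‖u.snd‖ₑ ^ 2 := by
    rw [enorm_sq_eq_lintegral _ h1, enorm_sq_eq_lintegral _ h2, hφ.lintegral_gradient]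
    refine le_trans ?_ (lintegral_translate_sub_le (hφ.smooth.of_le (by simp)) h)
    refine le_trans (lintegral_mono_ae ?_) (setLIntegral_le_lintegral Ω _)
    filter_upwards [ae_restrict_mem hΩ.measurableSet] with x hx
    have hxh : x + h ∉ Ω := fun hxh => by
      have h3 := hR _ hxh
      have h4 := norm_sub_le (x + h) x
      rw [add_sub_cancel_left, hh] at h4
      linarith [hR x hx]
    rw [hφ.eq_zero hxh, zero_sub, enorm_neg]
  rw [← mul_pow] at key
  have key2 := (ENNReal.pow_le_pow_left_iff two_ne_zero).1 key
  rw [← hh]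
  refine (ENNReal.ofReal_le_ofReal_iff (by positivity)).1 ?_
  simpa [← ofReal_norm, ← ENNReal.ofReal_mul] using key2

end H10Basic


/-! ### Compactness of the embedding of `H¹₀(Ω)` into `L²(Ω)` -/

section Rellich

variable {d : ℕ} {Ω : Set (Pt d)}

/-- The index of the cube of the grid of mesh width `ε` that contains `x`. -/
noncomputable def cubeIndex (ε : ℝ) (x : Pt d) : Fin d → ℤ := fun i => ⌊x i / ε⌋

/-- A cube of the grid of mesh width `ε`. -/
def gridCube (ε : ℝ) (k : Fin d → ℤ) : Set (Pt d) := cubeIndex ε ⁻¹' {k}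

theorem gridCube_eq {ε : ℝ} (hε : 0 < ε) (k : Fin d → ℤ) :
    gridCube ε k = (MeasurableEquiv.toLp 2 (Fin d → ℝ)).symm ⁻¹'
      (univ.pi fun i => Ico (ε * k i) (ε * k i + ε)) := by
  ext x
  simp only [gridCube, cubeIndex, mem_preimage, mem_singleton_iff, mem_univ_pi, mem_Ico, funext_iff,
    Int.floor_eq_iff]
  refine forall_congr' fun i => ?_
  rw [le_div_iff₀ hε, div_lt_iff₀ hε]
  simp only [MeasurableEquiv.coe_toLp_symm]
  constructor <;> rintro ⟨h1, h2⟩ <;> constructor <;> linarith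

theorem measurableSet_gridCube {ε : ℝ} (hε : 0 < ε) (k : Fin d → ℤ) :
    MeasurableSet (gridCube ε k) := by
  rw [gridCube_eq hε]
  exact (MeasurableEquiv.measurable _) (MeasurableSet.univ_pi fun i => measurableSet_Ico)

theorem volume_gridCube {ε : ℝ} (hε : 0 < ε) (k : Fin d → ℤ) :
    volume (gridCube ε k) = ENNReal.ofReal (ε ^ d) := by
  rw [gridCube_eq hε, (EuclideanSpace.volume_preserving_symm_measurableEquiv_toLp
    (Fin d)).measure_preimage (MeasurableSet.univ_pi fun i => measurableSet_Ico).nullMeasurableSet,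
    Real.volume_pi_Ico]
  simp [ENNReal.ofReal_pow hε.le]

theorem norm_sub_le_of_mem_gridCube {ε : ℝ} (hε : 0 < ε) {k : Fin d → ℤ} {x y : Pt d}
    (hx : x ∈ gridCube ε k) (hy : y ∈ gridCube ε k) : ‖y - x‖ ≤ √d * ε := by
  rw [gridCube_eq hε] at hx hy
  rw [EuclideanSpace.norm_eq]
  have : √d * ε = √(∑ _i : Fin d, ε ^ 2) := by
    rw [Finset.sum_const, Finset.card_univ, Fintype.card_fin, nsmul_eq_mul,
      Real.sqrt_mul (Nat.cast_nonneg d), Real.sqrt_sq hε.le]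
  rw [this]
  refine Real.sqrt_le_sqrt (Finset.sum_le_sum fun i _ => ?_)
  have h1 := hx i (mem_univ i)
  have h2 := hy i (mem_univ i)
  simp only [MeasurableEquiv.coe_toLp_symm, mem_Ico] at h1 h2
  rw [Real.norm_eq_abs, sq_abs, PiLp.sub_apply]
  exact sq_le_sq' (by linarith) (by linarith)

/-- The integral mean of `φ` over the cube containing `x`. -/
noncomputable def cubeMean (ε : ℝ) (φ : Pt d → ℝ) (x : Pt d) : ℝ :=
  (ε ^ d)⁻¹ * ∫ y in gridCube ε (cubeIndex ε x), φ y

/-- The left side involves the mean over the cube of `φ x - φ y`, to which Cauchy-Schwarz applies.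
Enlarging the cube to a ball around `x` makes the set of increments `h = y - x` independent of `x`,
which prepares the exchange of integrals. -/
theorem enorm_sub_cubeMean_sq_le {ε : ℝ} (hε : 0 < ε) {φ : Pt d → ℝ} (hφ : Continuous φ)
    (hc : HasCompactSupport φ) (x : Pt d) :
    ‖φ x - cubeMean ε φ x‖ₑ ^ 2 ≤ (ENNReal.ofReal (ε ^ d))⁻¹ *
      ∫⁻ h in Metric.closedBall (0 : Pt d) (√d * ε), ‖φ (x + h) - φ x‖ₑ ^ 2 := by
  set Q := gridCube ε (cubeIndex ε x)
  have hQ : volume Q = ENNReal.ofReal (ε ^ d) := volume_gridCube hε _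
  have hεd : 0 < ε ^ d := pow_pos hε d
  have hne : ENNReal.ofReal (ε ^ d) ≠ 0 := by simpa using hεd
  have hfin : IsFiniteMeasure (volume.restrict Q) := ⟨by simp [hQ]⟩
  have hint : Integrable φ (volume.restrict Q) := (hφ.integrable_of_hasCompactSupport hc).restrict
  have hmean : φ x - cubeMean ε φ x = (ε ^ d)⁻¹ * ∫ y in Q, (φ x - φ y) := by
    rw [integral_sub (integrable_const _) hint, integral_const, cubeMean]
    simp only [measureReal_def, Measure.restrict_apply_univ, hQ, smul_eq_mul,
      ENNReal.toReal_ofReal hεd.le]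
    change _ = _ * (_ - ∫ y in gridCube ε (cubeIndex ε x), φ y)
    field_simp
  have hmeas : Measurable fun y => ‖φ x - φ y‖ₑ := (continuous_const.sub hφ).enorm.measurable
  have hinv : ‖(ε ^ d)⁻¹‖ₑ = (ENNReal.ofReal (ε ^ d))⁻¹ := by
    rw [← ofReal_norm, Real.norm_of_nonneg (inv_nonneg.2 hεd.le), ENNReal.ofReal_inv_of_pos hεd]
  have hsub : (fun y => y - x) '' Q ⊆ Metric.closedBall (0 : Pt d) (√d * ε) := by
    rintro _ ⟨y, hy, rfl⟩
    rw [mem_closedBall_zero_iff]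
    exact norm_sub_le_of_mem_gridCube hε (k := cubeIndex ε x) rfl hy
  calc ‖φ x - cubeMean ε φ x‖ₑ ^ 2
      ≤ ((ENNReal.ofReal (ε ^ d))⁻¹ * ∫⁻ y in Q, ‖φ x - φ y‖ₑ) ^ 2 := by
        rw [hmean, enorm_mul, hinv]
        gcongr
        exact enorm_integral_le_lintegral_enorm _
    _ ≤ (ENNReal.ofReal (ε ^ d))⁻¹ ^ 2 *
          (ENNReal.ofReal (ε ^ d) * ∫⁻ y in Q, ‖φ x - φ y‖ₑ ^ 2) := by
        rw [mul_pow]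
        gcongr
        refine (lintegral_sq_le hmeas.aemeasurable).trans_eq ?_
        rw [Measure.restrict_apply_univ, hQ]
    _ = (ENNReal.ofReal (ε ^ d))⁻¹ * ∫⁻ y in Q, ‖φ x - φ y‖ₑ ^ 2 := by
        rw [← mul_assoc, sq, mul_assoc _ _ (ENNReal.ofReal _),
          ENNReal.inv_mul_cancel hne ENNReal.ofReal_ne_top, mul_one]
    _ ≤ _ := by
        refine mul_le_mul' le_rfl ?_
        rw [← lintegral_indicator (measurableSet_gridCube hε _),
          ← lintegral_indicator Metric.isClosed_closedBall.measurableSet,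
          ← lintegral_add_right_eq_self _ x]
        refine lintegral_mono fun h => ?_
        by_cases hh : h + x ∈ Q
        · have h2 : h ∈ Metric.closedBall (0 : Pt d) (√d * ε) :=
            hsub ⟨h + x, hh, add_sub_cancel_right h x⟩
          rw [indicator_of_mem h2]
          refine (indicator_le_self _ _ _).trans ?_
          rw [add_comm x h, enorm_sub_rev]
        · exact (indicator_of_notMem (s := Q) hh _).trans_le zero_le

/-- Integrate the pointwise bound in `x`, exchange the integrals and use the translation estimate
for each increment. The volume of the ball cancels that of the cube up to a constant, so a factor of
order `ε ^ 2` survives. -/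
theorem lintegral_sub_cubeMean_le {ε : ℝ} (hε : 0 < ε) {φ : Pt d → ℝ} (hφ : ContDiff ℝ 1 φ)
    (hc : HasCompactSupport φ) :
    ∫⁻ x, ‖φ x - cubeMean ε φ x‖ₑ ^ 2
      ≤ ENNReal.ofReal (√d ^ d) * volume (Metric.ball (0 : Pt d) 1) * ENNReal.ofReal (√d * ε) ^ 2
        * ∫⁻ x, ‖gradient φ x‖ₑ ^ 2 := by
  set B := Metric.closedBall (0 : Pt d) (√d * ε)
  have hcontφ := hφ.continuous
  have hδ : 0 ≤ √d * ε := by positivity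
  have hεd : 0 < ε ^ d := pow_pos hε d
  have hne : ENNReal.ofReal (ε ^ d) ≠ 0 := by simpa using hεd
  calc ∫⁻ x, ‖φ x - cubeMean ε φ x‖ₑ ^ 2
      ≤ ∫⁻ x, (ENNReal.ofReal (ε ^ d))⁻¹ * ∫⁻ h in B, ‖φ (x + h) - φ x‖ₑ ^ 2 :=
        lintegral_mono fun x => enorm_sub_cubeMean_sq_le hε hφ.continuous hc x
    _ = (ENNReal.ofReal (ε ^ d))⁻¹ * ∫⁻ x, ∫⁻ h in B, ‖φ (x + h) - φ x‖ₑ ^ 2 :=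
        lintegral_const_mul' _ _ (ENNReal.inv_ne_top.2 hne)
    _ = (ENNReal.ofReal (ε ^ d))⁻¹ * ∫⁻ h in B, ∫⁻ x, ‖φ (x + h) - φ x‖ₑ ^ 2 := by
        congr 1
        refine lintegral_lintegral_swap (Measurable.aemeasurable ?_)
        simp only [Function.uncurry_def]
        have : Continuous fun p : Pt d × Pt d => φ (p.1 + p.2) - φ p.1 := by fun_prop
        exact this.enorm.measurable.pow_const 2
    _ ≤ (ENNReal.ofReal (ε ^ d))⁻¹ * ∫⁻ _h in B, ENNReal.ofReal (√d * ε) ^ 2 *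
          ∫⁻ x, ‖gradient φ x‖ₑ ^ 2 := by
        refine mul_le_mul' le_rfl (setLIntegral_mono' measurableSet_closedBall fun h hh => ?_)
        refine (lintegral_translate_sub_le hφ h).trans ?_
        gcongr
        rw [← ofReal_norm]
        exact ENNReal.ofReal_le_ofReal (mem_closedBall_zero_iff.1 hh)
    _ = _ := by
        rw [setLIntegral_const, Measure.addHaar_closedBall _ _ hδ, finrank_euclideanSpace_fin,
          mul_pow (√(d : ℝ)) ε d, ENNReal.ofReal_mul (p := √d ^ d) (by positivity)]
        have : (ENNReal.ofReal (ε ^ d))⁻¹ * ENNReal.ofReal (ε ^ d) = 1 :=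
          ENNReal.inv_mul_cancel hne ENNReal.ofReal_ne_top
        generalize (ENNReal.ofReal (ε ^ d))⁻¹ = a at *
        generalize ENNReal.ofReal (ε ^ d) = b at *
        generalize ∫⁻ x, ‖gradient φ x‖ₑ ^ 2 = D
        generalize ENNReal.ofReal (√d * ε) ^ 2 = e
        generalize ENNReal.ofReal (√d ^ d) = p
        generalize volume (Metric.ball (0 : Pt d) 1) = w
        calc a * (e * D * (p * b * w)) = (a * b) * (p * w * e * D) := by ring
          _ = _ := by rw [this, one_mul]

/-- The operator that replaces a function by its integral means over the cubes with indices in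
`F`. -/
noncomputable def cubeMeanOp (Ω : Set (Pt d)) {ε : ℝ} (hε : 0 < ε) (F : Finset (Fin d → ℤ)) :
    L2 Ω →L[ℝ] L2 Ω :=
  ∑ k ∈ F, (ε ^ d)⁻¹ • (innerSL ℝ (indicatorConstLp (μ := volume.restrict Ω) 2
    (measurableSet_gridCube hε k) ((Measure.restrict_apply_le _ _).trans_lt
      (by rw [volume_gridCube hε k]; exact ENNReal.ofReal_lt_top)).ne (1 : ℝ))).smulRight
    (indicatorConstLp (μ := volume.restrict Ω) 2
    (measurableSet_gridCube hε k) ((Measure.restrict_apply_le _ _).trans_lt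
      (by rw [volume_gridCube hε k]; exact ENNReal.ofReal_lt_top)).ne (1 : ℝ))

theorem isCompactOperator_smulRight {X : Type*} [NormedAddCommGroup X] [NormedSpace ℝ X]
    (l : X →L[ℝ] ℝ) (x : X) : IsCompactOperator (l.smulRight x) :=
  (isCompactOperator_of_locallyCompactSpace_dom l).clm_comp
    ((ContinuousLinearMap.id ℝ ℝ).smulRight x)

theorem isCompactOperator_cubeMeanOp {ε : ℝ} (hε : 0 < ε) (F : Finset (Fin d → ℤ)) :
    IsCompactOperator (cubeMeanOp Ω hε F) := by
  have : cubeMeanOp Ω hε F ∈ compactOperator (RingHom.id ℝ) (L2 Ω) (L2 Ω) :=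
    Submodule.sum_mem _ fun k _ => Submodule.smul_mem _ _ (isCompactOperator_smulRight _ _)
  exact this

theorem coeFn_finsetSum {α ι E : Type*} [NormedAddCommGroup E] {m : MeasurableSpace α}
    {μ : Measure α} {p : ℝ≥0∞} (s : Finset ι) (f : ι → Lp E p μ) :
    ⇑(∑ i ∈ s, f i) =ᵐ[μ] fun x => ∑ i ∈ s, f i x := by
  classical
  induction s using Finset.induction_on with
  | empty => simp only [Finset.sum_empty]; exact Lp.coeFn_zero E p μ
  | insert a s ha ih =>
    rw [Finset.sum_insert ha]
    filter_upwards [Lp.coeFn_add (f a) (∑ i ∈ s, f i), ih] with x h1 h2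
    rw [h1, Finset.sum_insert ha, Pi.add_apply, h2]

theorem cubeMeanOp_ae_eq (hΩ : IsOpen Ω) {ε : ℝ} (hε : 0 < ε) {F : Finset (Fin d → ℤ)}
    (hF : ∀ x ∈ Ω, cubeIndex ε x ∈ F) {f : L2 Ω} {φ : Pt d → ℝ} (hφ : IsTest Ω φ)
    (hf : f =ᵐ[volume.restrict Ω] φ) :
    cubeMeanOp Ω hε F f =ᵐ[volume.restrict Ω] cubeMean ε φ := by
  -- Cubes that cross the boundary do no harm, since `φ` vanishes outside `Ω`.
  have h1 : ∀ k, ∫ y in gridCube ε k, f y ∂(volume.restrict Ω) = ∫ y in gridCube ε k, φ y := by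
    intro k
    rw [integral_congr_ae (ae_restrict_of_ae hf)]
    rw [Measure.restrict_restrict (measurableSet_gridCube hε k), inter_comm,
      ← Measure.restrict_restrict hΩ.measurableSet]
    refine setIntegral_eq_integral_of_forall_compl_eq_zero fun x hx => hφ.eq_zero hx
  have h2 := fun k : Fin d → ℤ => indicatorConstLp_coeFn (p := 2) (μ := volume.restrict Ω)
    (hs := measurableSet_gridCube hε k) (hμs := ((Measure.restrict_apply_le _ _).trans_lt
      (by rw [volume_gridCube hε k]; exact ENNReal.ofReal_lt_top)).ne) (c := (1 : ℝ))
  have h3 := ae_all_iff.2 h2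
  simp only [cubeMeanOp, sum_apply, smul_apply, ContinuousLinearMap.smulRight_apply,
    innerSL_apply_apply, L2.inner_indicatorConstLp_one, h1]
  simp only [smul_smul]
  refine (coeFn_finsetSum _ _).trans ?_
  filter_upwards [h3, ae_all_iff.2 fun k : Fin d → ℤ => Lp.coeFn_smul
    ((ε ^ d)⁻¹ * ∫ y in gridCube ε k, φ y) (indicatorConstLp (μ := volume.restrict Ω) 2
    (measurableSet_gridCube hε k) ((Measure.restrict_apply_le _ _).trans_lt
      (by rw [volume_gridCube hε k]; exact ENNReal.ofReal_lt_top)).ne (1 : ℝ)),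
    ae_restrict_mem hΩ.measurableSet] with x h3 h4 hx
  -- The cubes partition space, so at `x` only the indicator of its own cube is nonzero.
  rw [Finset.sum_eq_single (cubeIndex ε x)]
  · rw [h4, Pi.smul_apply, h3, indicator_of_mem (by rfl), cubeMean, smul_eq_mul, mul_one]
  · intro k _ hk
    rw [h4, Pi.smul_apply, h3, indicator_of_notMem (s := gridCube ε k) (fun h => hk (Eq.symm h)), smul_zero]
  · exact fun h => absurd (hF x hx) h

theorem exists_forall_cubeIndex_mem (hb : Bornology.IsBounded Ω) (ε : ℝ) :
    ∃ F : Finset (Fin d → ℤ), ∀ x ∈ Ω, cubeIndex ε x ∈ F := by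
  obtain ⟨R, hR0, hR⟩ := hb.exists_pos_norm_le
  refine ⟨Fintype.piFinset fun _ => Finset.Icc ⌊-(R / |ε|)⌋ ⌊R / |ε|⌋, fun x hx => ?_⟩
  rw [Fintype.mem_piFinset]
  intro i
  have h1 : |x i / ε| ≤ R / |ε| := by
    rw [abs_div]
    exact div_le_div_of_nonneg_right ((PiLp.norm_apply_le x i).trans (hR x hx)) (abs_nonneg _)
  rw [Finset.mem_Icc]
  exact ⟨Int.floor_mono (abs_le.1 h1).1, Int.floor_mono (abs_le.1 h1).2⟩

theorem norm_sub_cubeMeanOp_le (hΩ : IsOpen Ω) {ε : ℝ} (hε : 0 < ε) {F : Finset (Fin d → ℤ)}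
    (hF : ∀ x ∈ Ω, cubeIndex ε x ∈ F) (u : H10 Ω) :
    ‖toL2 u - cubeMeanOp Ω hε F (toL2 u)‖ ≤
      √(√d ^ d * (volume (Metric.ball (0 : Pt d) 1)).toReal) * √d * ε * ‖grad u‖ := by
  set ν := volume (Metric.ball (0 : Pt d) 1)
  have hν : ν ≠ ⊤ := measure_ball_lt_top.ne
  refine H10_induction (p := fun u => ‖u.fst - cubeMeanOp Ω hε F u.fst‖ ≤
    √(√d ^ d * ν.toReal) * √d * ε * ‖u.snd‖) (isClosed_le
      (continuous_fst_L2Pair.sub ((cubeMeanOp Ω hε F).continuous.comp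
        continuous_fst_L2Pair)).norm
      (continuous_snd_L2Pair.norm.const_mul _)) ?_ u
  intro u φ hφ h1 h2
  have hae : ⇑(u.fst - cubeMeanOp Ω hε F u.fst) =ᵐ[volume.restrict Ω]
      fun x => φ x - cubeMean ε φ x :=
    (Lp.coeFn_sub _ _).trans (h1.sub (cubeMeanOp_ae_eq hΩ hε hF hφ h1))
  have key : ‖u.fst - cubeMeanOp Ω hε F u.fst‖ₑ ^ 2 ≤
      ENNReal.ofReal (√d ^ d) * ν * ENNReal.ofReal (√d * ε) ^ 2 * ‖u.snd‖ₑ ^ 2 := by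
    rw [enorm_sq_eq_lintegral _ hae, enorm_sq_eq_lintegral _ h2, hφ.lintegral_gradient]
    exact (setLIntegral_le_lintegral Ω _).trans
      (lintegral_sub_cubeMean_le hε (hφ.smooth.of_le (by simp)) hφ.compact)
  have h0 : 0 ≤ √d ^ d * ν.toReal := by positivity
  refine le_of_sq_le_sq ?_ (by positivity)
  refine (ENNReal.ofReal_le_ofReal_iff (by positivity)).1 ?_
  rw [ENNReal.ofReal_pow (norm_nonneg _), ofReal_norm, mul_pow, mul_assoc (√(√d ^ d * ν.toReal)),
    mul_pow, Real.sq_sqrt h0, ENNReal.ofReal_mul (by positivity), ENNReal.ofReal_mul (by positivity),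
    ENNReal.ofReal_mul (by positivity), ENNReal.ofReal_toReal hν, ENNReal.ofReal_pow (p := √d * ε) (by positivity),
    ENNReal.ofReal_pow (norm_nonneg _), ofReal_norm]
  exact key

/-- Rellich's theorem: the embedding `H¹₀(Ω) → L²(Ω)` is compact for bounded `Ω`. -/
theorem isCompactOperator_toL2L (hΩ : IsOpen Ω) (hb : Bornology.IsBounded Ω) :
    IsCompactOperator (toL2L Ω) := by
  choose F hF using exists_forall_cubeIndex_mem (d := d) hb
  set C := √(√d ^ d * (volume (Metric.ball (0 : Pt d) 1)).toReal) * √d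
  have hpos : ∀ n : ℕ, (0 : ℝ) < 1 / ((n : ℝ) + 1) := fun n => Nat.one_div_pos_of_nat
  -- The embedding is the limit in operator norm of its compositions with the finite-rank averaging
  -- operators of mesh width `1 / (n + 1)`, the error being at most `C / (n + 1)`.
  refine isCompactOperator_of_tendsto (l := Filter.atTop)
    (F := fun n : ℕ => cubeMeanOp Ω (hpos n) (F (1 / ((n : ℝ) + 1))) ∘L toL2L Ω) ?_
    (Filter.Eventually.of_forall fun n => (isCompactOperator_cubeMeanOp _ _).comp_clm (toL2L Ω))
  refine (tendsto_iff_norm_sub_tendsto_zero (E := H10 Ω →L[ℝ] L2 Ω)).2 ?_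
  have hlim : Filter.Tendsto (fun n : ℕ => C * (1 / ((n : ℝ) + 1))) Filter.atTop (nhds 0) := by
    simpa using tendsto_one_div_add_atTop_nhds_zero_nat.const_mul C
  refine squeeze_zero (fun n => ContinuousLinearMap.opNorm_nonneg _) (fun n => ?_) hlim
  refine ContinuousLinearMap.opNorm_le_bound _ (by have := hpos n; positivity) fun u => ?_
  change ‖cubeMeanOp Ω (hpos n) (F (1 / ((n : ℝ) + 1))) (toL2 u) - toL2 u‖ ≤ _
  rw [norm_sub_rev]
  refine (norm_sub_cubeMeanOp_le hΩ (hpos n) (hF _) u).trans ?_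
  have := hpos n
  gcongr
  exact norm_grad_le u

end Rellich


/-! ### Uniqueness of the weak gradient -/

section Injective

variable {d : ℕ} {Ω : Set (Pt d)}

theorem IsTest.memLp_fderiv_apply {ψ : Pt d → ℝ} (h : IsTest Ω ψ) (v : Pt d) :
    MemLp (fun x => fderiv ℝ ψ x v) 2 (volume.restrict Ω) := by
  have : (fun x => fderiv ℝ ψ x v) = fun x => inner ℝ (gradient ψ x) v := by
    ext1 x; rw [inner_gradient_left]
  rw [this]
  exact h.memLp_gradient.inner_const v

theorem IsTest.memLp_smul_const {ψ : Pt d → ℝ} (h : IsTest Ω ψ) (v : Pt d) :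
    MemLp (fun x => ψ x • v) 2 (volume.restrict Ω) :=
  ((h.smooth.continuous.smul continuous_const).memLp_of_hasCompactSupport
    h.compact.smul_right).restrict Ω

theorem inner_real_eq_mul (a b : ℝ) : (inner ℝ a b : ℝ) = a * b := by
  simp [mul_comm]

/-- Integration by parts for a pair of test functions; both sides are continuous in the first one,
so the identity extends to `H¹₀(Ω)`. -/
theorem inner_toLp_add_inner_toLp_eq_zero {ψ : Pt d → ℝ} (hψ : IsTest Ω ψ) (v : Pt d)
    (u : H10 Ω) :
    (inner ℝ (toL2 u) ((hψ.memLp_fderiv_apply v).toLp _) : ℝ)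
      + inner ℝ (grad u) ((hψ.memLp_smul_const v).toLp _) = 0 := by
  refine H10_induction (p := fun u => (inner ℝ u.fst ((hψ.memLp_fderiv_apply v).toLp _) : ℝ)
      + inner ℝ u.snd ((hψ.memLp_smul_const v).toLp _) = 0) (isClosed_eq
        ((continuous_fst_L2Pair.inner continuous_const).add
          (continuous_snd_L2Pair.inner continuous_const)) continuous_const) ?_ u
  intro u φ hφ h1 h2
  have e1 : (inner ℝ u.fst ((hψ.memLp_fderiv_apply v).toLp _) : ℝ)
      = ∫ x, φ x * fderiv ℝ ψ x v := by
    rw [L2.inner_def, ← setIntegral_eq_integral_of_forall_compl_eq_zero (s := Ω)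
      (f := fun x => φ x * fderiv ℝ ψ x v) (fun x hx => by rw [hφ.eq_zero hx, zero_mul])]
    refine integral_congr_ae ?_
    filter_upwards [h1, (hψ.memLp_fderiv_apply v).coeFn_toLp] with x hx1 hx2
    rw [hx1, hx2, inner_real_eq_mul]
  have e2 : (inner ℝ u.snd ((hψ.memLp_smul_const v).toLp _) : ℝ)
      = ∫ x, fderiv ℝ φ x v * ψ x := by
    rw [L2.inner_def, ← setIntegral_eq_integral_of_forall_compl_eq_zero (s := Ω)
      (f := fun x => fderiv ℝ φ x v * ψ x) (fun x hx => by rw [hψ.eq_zero hx, mul_zero])]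
    refine integral_congr_ae ?_
    filter_upwards [h2, (hψ.memLp_smul_const v).coeFn_toLp] with x hx1 hx2
    rw [hx1, hx2, real_inner_smul_right, inner_gradient_left, mul_comm]
  have c1 : Continuous fun x => fderiv ℝ φ x v :=
    (hφ.smooth.continuous_fderiv (by simp)).clm_apply continuous_const
  have c2 : Continuous fun x => fderiv ℝ ψ x v :=
    (hψ.smooth.continuous_fderiv (by simp)).clm_apply continuous_const
  rw [e1, e2, integral_mul_fderiv_eq_neg_fderiv_mul_of_integrable, neg_add_cancel]
  · exact (c1.mul hψ.smooth.continuous).integrable_of_hasCompactSupport hψ.compact.mul_left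
  · exact (hφ.smooth.continuous.mul c2).integrable_of_hasCompactSupport hφ.compact.mul_right
  · exact (hφ.smooth.continuous.mul hψ.smooth.continuous).integrable_of_hasCompactSupport
      hφ.compact.mul_right
  · exact fun x _ => hφ.smooth.differentiable (by simp) x
  · exact fun x _ => hψ.smooth.differentiable (by simp) x

/-- If the function component vanishes, integration by parts makes the gradient component orthogonal
to all test fields, hence zero. Elements of `H10 Ω` being pairs, this is what makes multiplicities
in `H¹₀(Ω)` and in `L²(Ω)` agree. -/
theorem toL2_injective (hΩ : IsOpen Ω) (hb : Bornology.IsBounded Ω) :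
    Function.Injective (toL2L Ω) := by
  refine (injective_iff_map_eq_zero _).2 fun u hu => ?_
  have hu : toL2 u = 0 := hu
  have hfin : IsFiniteMeasure (volume.restrict Ω) := ⟨by
    rw [Measure.restrict_apply_univ]; exact hb.measure_lt_top⟩
  have hint : Integrable (grad u) (volume.restrict Ω) :=
    (Lp.memLp (grad u)).integrable one_le_two
  have hz : grad u = 0 := by
    have h0 := IsOpen.ae_eq_zero_of_integral_contDiff_smul_eq_zero (μ := volume.restrict Ω) hΩ
      (hint.locallyIntegrable.locallyIntegrableOn _) fun ψ k1 k2 k3 => by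
        have hψ : IsTest Ω ψ := ⟨k1, k2, k3⟩
        have hint2 : Integrable (fun x => ψ x • grad u x) (volume.restrict Ω) :=
          memLp_one_iff_integrable.1 ((Lp.memLp (grad u)).smul hψ.memLp)
        refine ext_inner_left ℝ fun v => ?_
        rw [← integral_inner hint2, inner_zero_right]
        have h1 := inner_toLp_add_inner_toLp_eq_zero hψ v u
        rw [hu, inner_zero_left, zero_add, L2.inner_def] at h1
        rw [← h1]
        refine integral_congr_ae ?_
        filter_upwards [(hψ.memLp_smul_const v).coeFn_toLp] with x hx
        rw [hx, real_inner_smul_right, real_inner_smul_right, real_inner_comm]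
    apply Lp.ext
    filter_upwards [h0, ae_restrict_mem hΩ.measurableSet,
      Lp.coeFn_zero (Pt d) 2 (volume.restrict Ω)] with x h1 h2 h3
    rw [h1 h2, h3]; rfl
  have := norm_sq_eq u
  rw [hu, hz] at this
  simpa using this

/-- An infinite Hausdorff space contains infinitely many disjoint nonempty open sets, and their
indicators are orthogonal and nonzero. Needed to keep `0` outside the contour. -/
theorem not_finiteDimensional_L2 (hd : 1 ≤ d) (hΩ : IsOpen Ω) (hb : Bornology.IsBounded Ω)
    (hne : Ω.Nonempty) : ¬ FiniteDimensional ℝ (L2 Ω) := by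
  intro hfd
  have : Nonempty (Fin d) := ⟨⟨0, hd⟩⟩
  have : Nontrivial (Pt d) := inferInstance
  obtain ⟨x, hx⟩ := hne
  have : Infinite Ω := (infinite_of_mem_nhds x (hΩ.mem_nhds hx)).to_subtype
  obtain ⟨V, hV1, hV2, hV3⟩ := exists_seq_infinite_isOpen_pairwise_disjoint Ω
  let W : ℕ → Set (Pt d) := fun n => Subtype.val '' V n
  have hWo : ∀ n, IsOpen (W n) := fun n => hΩ.isOpenMap_subtype_val _ (hV2 n)
  have hWs : ∀ n, W n ⊆ Ω := fun n => by rintro _ ⟨y, _, rfl⟩; exact y.2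
  have hWd : ∀ m n, m ≠ n → Disjoint (W m) (W n) := fun m n h =>
    (disjoint_image_iff Subtype.val_injective).2 (hV3 h)
  have hWfin : ∀ n, volume.restrict Ω (W n) ≠ ⊤ := fun n =>
    ((Measure.restrict_apply_le _ _).trans_lt (hb.subset (hWs n)).measure_lt_top).ne
  let f : ℕ → L2 Ω := fun n => indicatorConstLp 2 (hWo n).measurableSet (hWfin n) 1
  have hli : LinearIndependent ℝ f := by
    refine linearIndependent_of_ne_zero_of_inner_eq_zero (fun n h0 => ?_) fun m n hmn => ?_
    · have h1 : (volume.restrict Ω).real (W n) = 0 := by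
        have := norm_indicatorConstLp (p := 2) (hs := (hWo n).measurableSet) (hμs := hWfin n)
          (c := (1 : ℝ)) two_ne_zero (by simp)
        rw [show indicatorConstLp 2 (hWo n).measurableSet (hWfin n) (1 : ℝ) = 0 from h0,
          norm_zero, norm_one, one_mul] at this
        exact ((Real.rpow_eq_zero_iff_of_nonneg measureReal_nonneg).1 this.symm).1
      rw [measureReal_def, ENNReal.toReal_eq_zero_iff, or_iff_left (hWfin n),
        Measure.restrict_apply (hWo n).measurableSet, inter_eq_self_of_subset_left (hWs n)] at h1
      exact ((hWo n).measure_pos volume ((hV1 n).nonempty.image _)).ne' h1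
    · change inner ℝ (indicatorConstLp 2 (hWo m).measurableSet (hWfin m) (1 : ℝ)) (f n) = 0
      rw [L2.inner_indicatorConstLp_one]
      refine (setIntegral_congr_ae (g := fun _ => 0) (hWo m).measurableSet ?_).trans (by simp)
      filter_upwards [indicatorConstLp_coeFn (p := 2) (hs := (hWo n).measurableSet)
        (hμs := hWfin n) (c := (1 : ℝ))] with y hy hym
      rw [hy, indicator_of_notMem (disjoint_left.1 (hWd m n hmn) hym)]
  exact not_finite_iff_infinite.2 (inferInstance : Infinite ℕ) hli.finite

end Injective

/-! ### Elements of a mesh -/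

section MeshBasic

variable {d : ℕ} {Ω : Set (Pt d)}

theorem Mesh.finite_elements (𝒯 : Mesh Ω) : 𝒯.elements.Finite :=
  𝒯.finite_faces.subset fun _ h => h.1

theorem Mesh.iUnion_cell (𝒯 : Mesh Ω) : (⋃ T ∈ 𝒯.elements, cell T) = closure Ω := by
  rw [← 𝒯.space_eq]
  refine subset_antisymm (iUnion₂_mono' fun T hT => ⟨T, hT.1, subset_rfl⟩) ?_
  refine iUnion₂_subset fun s hs => ?_
  obtain ⟨T, hT, hsT, hc⟩ := 𝒯.pure_dim s hs
  exact (convexHull_mono (by exact_mod_cast hsT)).trans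
    (subset_biUnion_of_mem (u := cell) (⟨hT, hc⟩ : T ∈ 𝒯.elements))

theorem isCompact_cell (T : Finset (Pt d)) : IsCompact (cell T) :=
  T.finite_toSet.isCompact_convexHull ℝ

theorem Mesh.isBounded (𝒯 : Mesh Ω) : Bornology.IsBounded Ω := by
  refine Bornology.IsBounded.subset ?_ subset_closure
  rw [← 𝒯.iUnion_cell]
  exact (𝒯.finite_elements.isCompact_biUnion fun T _ => isCompact_cell T).isBounded

/-- The cells are finitely many convex sets and convex sets have null frontier. -/
theorem Mesh.ae_mem_interior (𝒯 : Mesh Ω) (hΩ : IsOpen Ω) :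
    ∀ᵐ x ∂(volume.restrict Ω), ∃ T ∈ 𝒯.elements, x ∈ interior (cell T) ∩ Ω := by
  have h0 : ∀ᵐ x ∂(volume.restrict Ω), ∀ T ∈ 𝒯.elements, x ∉ frontier (cell T) :=
    (ae_ball_iff 𝒯.finite_elements.countable).2 fun T _ => by
      refine ae_restrict_of_ae (measure_eq_zero_iff_ae_notMem.1 ?_)
      exact (convex_convexHull ℝ _).addHaar_frontier volume
  filter_upwards [h0, ae_restrict_mem hΩ.measurableSet] with x h1 hx
  have hx' : x ∈ ⋃ T ∈ 𝒯.elements, cell T := by rw [𝒯.iUnion_cell]; exact subset_closure hx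
  obtain ⟨T, hT, hxT⟩ := mem_iUnion₂.1 hx'
  refine ⟨T, hT, ?_, hx⟩
  by_contra hint
  exact h1 T hT ⟨subset_closure hxT, hint⟩

end MeshBasic

/-! ### The energy form -/

section Form

variable {d : ℕ} {Ω : Set (Pt d)} {A : Pt d → Matrix (Fin d) (Fin d) ℝ} {c : Pt d → ℝ}

/-- On each of the finitely many cell interiors the Lipschitz bound gives measurability and, the
cell being bounded, a uniform bound. These interiors fill `Ω` up to a null set. -/
theorem IsDiffusion.memLp_top {𝒯₀ : Mesh Ω} (hA : IsDiffusion Ω 𝒯₀ A) (hΩ : IsOpen Ω)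
    (i j : Fin d) : MemLp (fun x => A x i j) ∞ (volume.restrict Ω) := by
  have hcount := 𝒯₀.finite_elements.countable
  have hfin := 𝒯₀.finite_elements
  set S := ⋃ T ∈ 𝒯₀.elements, (interior (cell T) ∩ Ω) with hS
  have hSeq : S =ᵐ[volume] Ω := by
    have hsub : S ⊆ Ω := iUnion₂_subset fun T _ => inter_subset_right
    have := (ae_restrict_iff' hΩ.measurableSet).1 (𝒯₀.ae_mem_interior hΩ)
    filter_upwards [this] with x hx
    refine propext ⟨fun h => hsub h, fun h => ?_⟩
    obtain ⟨T, hT, hxT⟩ := hx h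
    exact mem_biUnion hT hxT
  have hms : ∀ T, MeasurableSet (interior (cell T) ∩ Ω) := fun T =>
    (isOpen_interior.inter hΩ).measurableSet
  have hmeas : AEStronglyMeasurable (fun x => A x i j) (volume.restrict Ω) := by
    rw [← Measure.restrict_congr_set hSeq, hS]
    have := hcount.to_subtype
    rw [biUnion_eq_iUnion, aestronglyMeasurable_iUnion_iff]
    rintro ⟨T, hT⟩
    obtain ⟨L, hL⟩ := hA.lipschitz T hT
    exact (hL i j).continuousOn.aestronglyMeasurable (hms T)
  have hbd : ∀ T ∈ 𝒯₀.elements, ∃ C : ℝ, ∀ x ∈ interior (cell T) ∩ Ω, ‖A x i j‖ ≤ C := by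
    intro T hT
    obtain ⟨L, hL⟩ := hA.lipschitz T hT
    have hb : Bornology.IsBounded (interior (cell T) ∩ Ω) :=
      (isCompact_cell T).isBounded.subset (inter_subset_left.trans interior_subset)
    rcases (interior (cell T) ∩ Ω).eq_empty_or_nonempty with h0 | ⟨y, hy⟩
    · exact ⟨0, fun x hx => by rw [h0] at hx; exact hx.elim⟩
    · refine ⟨‖A y i j‖ + L * Metric.diam (interior (cell T) ∩ Ω), fun x hx => ?_⟩
      have h1 := (hL i j).dist_le_mul x hx y hy
      have h2 := Metric.dist_le_diam_of_mem hb hx hy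
      have h3 : (L : ℝ) * dist x y ≤ L * Metric.diam (interior (cell T) ∩ Ω) := by gcongr
      have h4 := norm_le_insert' (A x i j) (A y i j)
      rw [dist_eq_norm] at h1
      linarith
  choose! C hC using hbd
  obtain ⟨M, hM⟩ := (hfin.image C).bddAbove
  refine memLp_top_of_bound hmeas M ?_
  filter_upwards [𝒯₀.ae_mem_interior hΩ] with x ⟨T, hT, hx⟩
  exact (hC T hT x hx).trans (hM (mem_image_of_mem C hT))

/-- The form `(f, g) ↦ ∫ m f g` on `L²` for bounded `m`. -/
noncomputable def mulForm {m : Pt d → ℝ} (hm : MemLp m ∞ (volume.restrict Ω)) :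
    L2 Ω →L[ℝ] L2 Ω →L[ℝ] ℝ :=
  (innerSL ℝ).comp ((ContinuousLinearMap.mul ℝ ℝ).holderL (volume.restrict Ω) ∞ 2 2 (hm.toLp m))

theorem mulForm_apply {m : Pt d → ℝ} (hm : MemLp m ∞ (volume.restrict Ω)) (f g : L2 Ω) :
    Integrable (fun x => m x * f x * g x) (volume.restrict Ω) ∧
      mulForm hm f g = ∫ x in Ω, m x * f x * g x := by
  set p : L2 Ω := (ContinuousLinearMap.mul ℝ ℝ).holder 2 (hm.toLp m) f
  have hae : (fun x => (inner ℝ (p x) (g x) : ℝ)) =ᵐ[volume.restrict Ω]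
      fun x => m x * f x * g x := by
    filter_upwards [(ContinuousLinearMap.mul ℝ ℝ).coeFn_holder (r := 2) (hm.toLp m) f,
      hm.coeFn_toLp] with x h1 h2
    rw [h1, h2, inner_real_eq_mul]
    simp
  exact ⟨(L2.integrable_inner p g).congr hae, (L2.inner_def p g).trans (integral_congr_ae hae)⟩

/-- The partial derivative `∂_i` on `H¹₀(Ω)`. -/
noncomputable def partialL (Ω : Set (Pt d)) (i : Fin d) : H10 Ω →L[ℝ] L2 Ω :=
  (EuclideanSpace.proj (𝕜 := ℝ) i).compLpL 2 (volume.restrict Ω) ∘L gradL Ω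

theorem partialL_ae_eq (i : Fin d) (u : H10 Ω) :
    partialL Ω i u =ᵐ[volume.restrict Ω] fun x => grad u x i :=
  (EuclideanSpace.proj (𝕜 := ℝ) i).coeFn_compLpL (grad u)

/-- The energy form as a bounded bilinear form. -/
noncomputable def energyForm (hA : ∀ i j, MemLp (fun x => A x i j) ∞ (volume.restrict Ω))
    (hc : MemLp c ∞ (volume.restrict Ω)) : H10 Ω →L[ℝ] H10 Ω →L[ℝ] ℝ :=
  (∑ i, ∑ j, (mulForm (hA i j)).bilinearComp (partialL Ω j) (partialL Ω i))
    + (mulForm hc).bilinearComp (toL2L Ω) (toL2L Ω)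

theorem energyForm_apply (hA : ∀ i j, MemLp (fun x => A x i j) ∞ (volume.restrict Ω))
    (hc : MemLp c ∞ (volume.restrict Ω)) (u v : H10 Ω) :
    Integrable (fun x => (∑ i, ∑ j, A x i j * grad u x j * grad v x i) + c x * toL2 u x * toL2 v x)
      (volume.restrict Ω) ∧ energyForm hA hc u v = aForm A c u v := by
  have hae : ∀ i j, (fun x => A x i j * partialL Ω j u x * partialL Ω i v x)
      =ᵐ[volume.restrict Ω] fun x => A x i j * grad u x j * grad v x i := fun i j => by
    filter_upwards [partialL_ae_eq j u, partialL_ae_eq i v] with x h1 h2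
    rw [h1, h2]
  have hI : ∀ i j, Integrable (fun x => A x i j * grad u x j * grad v x i)
      (volume.restrict Ω) := fun i j =>
    (mulForm_apply (hA i j) _ _).1.congr (hae i j)
  have hc' := mulForm_apply hc (toL2 u) (toL2 v)
  refine ⟨(integrable_finsetSum _ fun i _ => integrable_finsetSum _ fun j _ => hI i j).add hc'.1,
    ?_⟩
  rw [aForm, integral_add (integrable_finsetSum _ fun i _ => integrable_finsetSum _
    fun j _ => hI i j) hc'.1, integral_finsetSum _ fun i _ => integrable_finsetSum _
    fun j _ => hI i j, ← hc'.2]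
  simp only [energyForm, add_apply, sum_apply, ContinuousLinearMap.bilinearComp_apply]
  congr 1
  refine Finset.sum_congr rfl fun i _ => ?_
  rw [integral_finsetSum _ fun j _ => hI i j]
  refine Finset.sum_congr rfl fun j _ => ?_
  rw [(mulForm_apply (hA i j) _ _).2, integral_congr_ae (hae i j)]

theorem aForm_comm {𝒯₀ : Mesh Ω} (hA : IsDiffusion Ω 𝒯₀ A) (u v : H10 Ω) :
    aForm A c u v = aForm A c v u := by
  refine integral_congr_ae ?_
  filter_upwards [hA.symm] with x hx
  rw [Finset.sum_comm]
  congr 1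
  · refine Finset.sum_congr rfl fun i _ => Finset.sum_congr rfl fun j _ => ?_
    rw [hx.apply i j]; ring
  · ring

/-- Ellipticity and `0 ≤ c` control the gradient; Poincaré's inequality turns this into control of
the full norm, at the price of the factor `C ^ 2 + 1`. -/
theorem exists_coercive {𝒯₀ : Mesh Ω} (hd : 1 ≤ d) (hΩ : IsOpen Ω) (hA : IsDiffusion Ω 𝒯₀ A)
    (hc : IsPotential Ω c) : ∃ α > 0, ∀ u : H10 Ω, α * ‖u‖ ^ 2 ≤ aForm A c u u := by
  obtain ⟨α, hα, hell⟩ := hA.elliptic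
  obtain ⟨C, hC, hP⟩ := exists_poincare hd hΩ 𝒯₀.isBounded
  refine ⟨α / (C ^ 2 + 1), by positivity, fun u => ?_⟩
  have h1 : α * ‖grad u‖ ^ 2 ≤ aForm A c u u := by
    have hg : ‖grad u‖ ^ 2 = ∫ x in Ω, inner ℝ (grad u x) (grad u x) := by
      rw [← real_inner_self_eq_norm_sq, L2.inner_def]
    rw [hg, ← integral_const_mul]
    refine integral_mono_ae ((L2.integrable_inner (𝕜 := ℝ) (grad u) (grad u)).const_mul α)
      (energyForm_apply (fun i j => hA.memLp_top hΩ i j) hc.bounded u u).1 ?_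
    filter_upwards [hell, hc.nonneg] with x hx hcx
    rw [real_inner_self_eq_norm_sq]
    have := hx (grad u x)
    nlinarith [mul_nonneg hcx (mul_self_nonneg (toL2 u x))]
  have h2 : ‖u‖ ^ 2 ≤ (C ^ 2 + 1) * ‖grad u‖ ^ 2 := by
    rw [norm_sq_eq]
    have := pow_le_pow_left₀ (norm_nonneg _) (hP u) 2
    nlinarith
  calc α / (C ^ 2 + 1) * ‖u‖ ^ 2 ≤ α / (C ^ 2 + 1) * ((C ^ 2 + 1) * ‖grad u‖ ^ 2) := by gcongr
    _ = α * ‖grad u‖ ^ 2 := by field_simp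
    _ ≤ _ := h1

end Form


/-! ### Mollification -/

section Mollify

variable {d : ℕ}

/-- The convolution with a normalised bump function. -/
noncomputable def mollify {E : Type*} [NormedAddCommGroup E] [NormedSpace ℝ E]
    (η : ContDiffBump (0 : Pt d)) (w : Pt d → E) : Pt d → E :=
  convolution (η.normed volume) w (ContinuousLinearMap.lsmul ℝ ℝ) volume

theorem mollify_apply {E : Type*} [NormedAddCommGroup E] [NormedSpace ℝ E]
    (η : ContDiffBump (0 : Pt d)) (w : Pt d → E) (x : Pt d) :
    mollify η w x = ∫ t, η.normed volume t • w (x - t) := rfl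

theorem norm_mollify_le {E : Type*} [NormedAddCommGroup E] [NormedSpace ℝ E]
    (η : ContDiffBump (0 : Pt d)) {w : Pt d → E} {C : ℝ} (hw : ∀ x, ‖w x‖ ≤ C) (x : Pt d) :
    ‖mollify η w x‖ ≤ C := by
  rw [mollify_apply]
  refine (norm_integral_le_of_norm_le (η.integrable_normed.mul_const C)
    (Filter.Eventually.of_forall fun t => ?_)).trans_eq ?_
  · rw [norm_smul, Real.norm_of_nonneg (η.nonneg_normed t)]
    exact mul_le_mul_of_nonneg_left (hw _) (η.nonneg_normed t)
  · rw [integral_mul_const, η.integral_normed, one_mul]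

theorem contDiff_mollify (η : ContDiffBump (0 : Pt d)) {w : Pt d → ℝ} (hw : Continuous w) :
    ContDiff ℝ ∞ (mollify η w) :=
  η.hasCompactSupport_normed.contDiff_convolution_left (n := ⊤) _ η.contDiff_normed
    hw.locallyIntegrable

theorem tsupport_mollify_subset (η : ContDiffBump (0 : Pt d)) (w : Pt d → ℝ) :
    tsupport (mollify η w) ⊆ Metric.cthickening η.rOut (tsupport w) := by
  refine closure_minimal (fun x hx => ?_) Metric.isClosed_cthickening
  by_contra hx'
  refine hx ?_
  rw [mollify_apply]
  refine integral_eq_zero_of_ae (Filter.Eventually.of_forall fun t => ?_)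
  by_cases ht : t ∈ Metric.ball (0 : Pt d) η.rOut
  · have : w (x - t) = 0 := by
      refine image_eq_zero_of_notMem_tsupport fun h => hx' ?_
      refine Metric.mem_cthickening_of_dist_le x (x - t) _ _ h ?_
      rw [dist_eq_norm, sub_sub_cancel]
      exact (mem_ball_zero_iff.1 ht).le
    simp [this]
  · have : η.normed volume t = 0 := by
      rw [← η.support_normed_eq (μ := volume), Function.notMem_support] at ht
      exact ht
    simp [this]

/-- Differentiation under the integral: by Rademacher's theorem `w` is differentiable almost
everywhere, and its Lipschitz constant provides the dominating function. -/
theorem hasFDerivAt_mollify (η : ContDiffBump (0 : Pt d)) {w : Pt d → ℝ} {L : NNReal}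
    (hw : LipschitzWith L w) (x : Pt d) :
    HasFDerivAt (mollify η w) (mollify η (fderiv ℝ w) x) x := by
  have hηc : Continuous (η.normed volume) := (η.contDiff_normed (n := 0)).continuous
  refine (hasFDerivAt_integral_of_dominated_loc_of_lip
    (F := fun (y t : Pt d) => η.normed volume t • w (y - t))
    (F' := fun t => η.normed volume t • fderiv ℝ w (x - t))
    (bound := fun t => η.normed volume t * L) (s := univ) Filter.univ_mem
    (Filter.Eventually.of_forall fun y => ?_) ?_ ?_ (Filter.Eventually.of_forall fun t => ?_) ?_
    ?_).2
  · exact (hηc.smul (hw.continuous.comp (continuous_const.sub continuous_id))).aestronglyMeasurable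
  · exact (hηc.smul (hw.continuous.comp (continuous_const.sub
      continuous_id))).integrable_of_hasCompactSupport η.hasCompactSupport_normed.smul_right
  · refine hηc.aestronglyMeasurable.smul (Measurable.aestronglyMeasurable ?_)
    exact (measurable_fderiv ℝ w).comp (measurable_const.sub measurable_id)
  · refine LipschitzOnWith.of_dist_le_mul fun y _ z _ => ?_
    rw [dist_eq_norm, ← smul_sub, norm_smul, Real.norm_of_nonneg (η.nonneg_normed t),
      Real.coe_nnabs, abs_of_nonneg (mul_nonneg (η.nonneg_normed t) L.coe_nonneg), mul_assoc]
    refine mul_le_mul_of_nonneg_left ?_ (η.nonneg_normed t)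
    have := hw.dist_le_mul (y - t) (z - t)
    rwa [dist_sub_right, dist_eq_norm] at this
  · exact η.integrable_normed.mul_const _
  · have hae := hw.ae_differentiableAt (μ := volume)
    have hq : Measure.QuasiMeasurePreserving (fun t : Pt d => x - t) volume volume :=
      quasiMeasurePreserving_sub_left volume x
    filter_upwards [hq.ae hae] with t ht
    have h1 : HasFDerivAt (fun y : Pt d => w (y - t)) (fderiv ℝ w (x - t)) x := by
      have := (DifferentiableAt.hasFDerivAt ht).comp x ((hasFDerivAt_id x).sub_const t)
      rwa [ContinuousLinearMap.comp_id] at this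
    exact h1.const_smul (η.normed volume t)

/-- A sequence of bump functions shrinking to the origin. -/
noncomputable def bumpSeq (d : ℕ) (n : ℕ) : ContDiffBump (0 : Pt d) where
  rIn := 1 / ((n : ℝ) + 1) / 2
  rOut := 1 / ((n : ℝ) + 1)
  rIn_pos := half_pos Nat.one_div_pos_of_nat
  rIn_lt_rOut := half_lt_self Nat.one_div_pos_of_nat

theorem tendsto_bumpSeq_rOut :
    Filter.Tendsto (fun n => (bumpSeq d n).rOut) Filter.atTop (nhds 0) :=
  tendsto_one_div_add_atTop_nhds_zero_nat

theorem ae_tendsto_mollify {E : Type*} [NormedAddCommGroup E] [NormedSpace ℝ E] [CompleteSpace E]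
    {w : Pt d → E} (hw : LocallyIntegrable w) :
    ∀ᵐ x, Filter.Tendsto (fun n => mollify (bumpSeq d n) w x) Filter.atTop (nhds (w x)) :=
  ContDiffBump.ae_convolution_tendsto_right_of_locallyIntegrable (K := 2) tendsto_bumpSeq_rOut
    (Filter.Eventually.of_forall fun n => by simp only [bumpSeq]; linarith) hw

end Mollify

/-- Dominated convergence for the squared differences, whose constant bound is integrable because
the measure is finite. -/
theorem tendsto_toLp_of_ae_tendsto {α E : Type*} [NormedAddCommGroup E] {m : MeasurableSpace α}
    {μ : Measure α} [IsFiniteMeasure μ] {f : ℕ → α → E} {g : α → E} {C : ℝ}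
    (hf : ∀ n, MemLp (f n) 2 μ) (hg : MemLp g 2 μ) (hfC : ∀ n x, ‖f n x‖ ≤ C)
    (hgC : ∀ x, ‖g x‖ ≤ C)
    (hlim : ∀ᵐ x ∂μ, Filter.Tendsto (fun n => f n x) Filter.atTop (nhds (g x))) :
    Filter.Tendsto (fun n => (hf n).toLp (f n)) Filter.atTop (nhds (hg.toLp g)) := by
  rw [tendsto_iff_edist_tendsto_0]
  have hsq : Filter.Tendsto (fun n => edist ((hf n).toLp (f n)) (hg.toLp g) ^ 2) Filter.atTop
      (nhds 0) := by
    have e : ∀ n, edist ((hf n).toLp (f n)) (hg.toLp g) ^ 2 = ∫⁻ x, ‖f n x - g x‖ₑ ^ 2 ∂μ :=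
      fun n => by
      rw [edist_eq_enorm_sub]
      exact enorm_sq_eq_lintegral _ ((Lp.coeFn_sub _ _).trans
        ((hf n).coeFn_toLp.sub hg.coeFn_toLp))
    simp only [e]
    have := tendsto_lintegral_of_dominated_convergence' (μ := μ)
      (F := fun n x => ‖f n x - g x‖ₑ ^ 2) (f := fun _ => 0)
      (fun _ => ENNReal.ofReal (C + C) ^ 2) (fun n =>
        ((hf n).1.sub hg.1).enorm.pow_const 2) (fun n => Filter.Eventually.of_forall fun x => ?_) ?_
        ?_
    · simpa using this
    · dsimp only
      gcongr
      rw [← ofReal_norm]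
      exact ENNReal.ofReal_le_ofReal ((norm_sub_le _ _).trans (add_le_add (hfC n x) (hgC x)))
    · rw [lintegral_const]
      exact ENNReal.mul_ne_top (by simp) (measure_ne_top μ univ)
    · filter_upwards [hlim] with x hx
      have h1 : Filter.Tendsto (fun n => ‖f n x - g x‖ₑ) Filter.atTop (nhds 0) := by
        simpa [edist_eq_enorm_sub] using tendsto_iff_edist_tendsto_0.1 hx
      have h2 := ((ENNReal.continuous_pow 2).tendsto 0).comp h1
      rwa [zero_pow two_ne_zero] at h2
  have h2 := ((ENNReal.continuous_rpow_const (y := (1 / 2 : ℝ))).tendsto 0).comp hsq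
  rw [ENNReal.zero_rpow_of_pos (by norm_num)] at h2
  refine h2.congr fun n => ?_
  simp only [Function.comp_apply]
  rw [← ENNReal.rpow_natCast, ← ENNReal.rpow_mul]
  norm_num

/-! ### Compactly supported Lipschitz functions in `H¹₀(Ω)` -/

section Lipschitz

variable {d : ℕ} {Ω : Set (Pt d)}

/-- A Lipschitz function with compact support in `Ω` belongs to `H¹₀(Ω)`. -/
theorem exists_mem_H10_of_lipschitz (hΩ : IsOpen Ω) (hb : Bornology.IsBounded Ω) {w : Pt d → ℝ}
    {L : NNReal} (hw : LipschitzWith L w) (hc : HasCompactSupport w) (hs : tsupport w ⊆ Ω) :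
    ∃ u : H10 Ω, toL2 u =ᵐ[volume.restrict Ω] w ∧ grad u =ᵐ[volume.restrict Ω] gradient w := by
  have hfin : IsFiniteMeasure (volume.restrict Ω) := ⟨by
    rw [Measure.restrict_apply_univ]; exact hb.measure_lt_top⟩
  obtain ⟨C, hC⟩ := hc.exists_bound_of_continuous hw.continuous
  have hLf : ∀ x, ‖fderiv ℝ w x‖ ≤ L := fun x => norm_fderiv_le_of_lipschitz ℝ hw
  have hgm : Measurable (gradient w) :=
    (InnerProductSpace.toDual ℝ (Pt d)).symm.continuous.measurable.comp (measurable_fderiv ℝ w)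
  have hmw : MemLp w 2 (volume.restrict Ω) :=
    (hw.continuous.memLp_of_hasCompactSupport hc).restrict Ω
  have hmg : MemLp (gradient w) 2 (volume.restrict Ω) :=
    MemLp.of_bound hgm.aestronglyMeasurable L (Filter.Eventually.of_forall fun x => by
      rw [norm_gradient_eq]; exact hLf x)
  let p : L2Pair Ω := WithLp.toLp 2 (hmw.toLp w, hmg.toLp (gradient w))
  obtain ⟨δ, hδ, hδs⟩ := hc.isCompact.exists_cthickening_subset_open hΩ hs
  obtain ⟨N, hN⟩ := (tendsto_bumpSeq_rOut (d := d)).eventually_lt_const hδ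
    |> Filter.eventually_atTop.1
  -- Starting the sequence at `N` keeps the support of every mollification inside `Ω`.
  let η : ℕ → ContDiffBump (0 : Pt d) := fun n => bumpSeq d (n + N)
  have htest : ∀ n, IsTest Ω (mollify (η n) w) := fun n => by
    have h1 : tsupport (mollify (η n) w) ⊆ Metric.cthickening δ (tsupport w) :=
      (tsupport_mollify_subset _ w).trans
        (Metric.cthickening_mono (hN _ (Nat.le_add_left N n)).le _)
    exact ⟨contDiff_mollify _ hw.continuous,
      hc.isCompact.cthickening.of_isClosed_subset (isClosed_tsupport _) h1, h1.trans hδs⟩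
  let pn : ℕ → L2Pair Ω := fun n => WithLp.toLp 2 ((htest n).memLp.toLp _,
    (htest n).memLp_gradient.toLp _)
  have hpn : ∀ n, pn n ∈ testPairs Ω := fun n =>
    ⟨_, (htest n).smooth, (htest n).compact, (htest n).subset, (htest n).memLp.coeFn_toLp,
      (htest n).memLp_gradient.coeFn_toLp⟩
  -- Mollification commutes with the derivative, so both components converge almost everywhere under
  -- a uniform bound.
  have hgr : ∀ n x, fderiv ℝ (mollify (η n) w) x = mollify (η n) (fderiv ℝ w) x := fun n x =>
    (hasFDerivAt_mollify (η n) hw x).fderiv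
  have hlim : Filter.Tendsto pn Filter.atTop (nhds p) := by
    refine ((WithLp.prod_continuous_toLp 2 _ _).tendsto _).comp (Filter.Tendsto.prodMk_nhds ?_ ?_)
    · refine tendsto_toLp_of_ae_tendsto (C := C) _ _ (fun n x => norm_mollify_le _ hC x) hC ?_
      have h := ae_restrict_of_ae (s := Ω) (ae_tendsto_mollify hw.continuous.locallyIntegrable)
      filter_upwards [h] with x hx
      exact hx.comp (Filter.tendsto_add_atTop_nat N)
    · refine tendsto_toLp_of_ae_tendsto (C := L) _ _ (fun n x => ?_) (fun x => ?_) ?_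
      · rw [norm_gradient_eq, hgr]
        exact norm_mollify_le _ hLf x
      · rw [norm_gradient_eq]; exact hLf x
      · have hli : LocallyIntegrable (fderiv ℝ w) := by
          refine (locallyIntegrable_const (L : ℝ)).mono
            (measurable_fderiv ℝ w).aestronglyMeasurable (Filter.Eventually.of_forall fun x => ?_)
          simpa using hLf x
        have h := ae_restrict_of_ae (s := Ω) (ae_tendsto_mollify hli)
        filter_upwards [h] with x hx
        have h2 := hx.comp (Filter.tendsto_add_atTop_nat N)
        simp only [gradient, hgr]
        exact ((InnerProductSpace.toDual ℝ (Pt d)).symm.continuous.tendsto _).comp h2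
  have hp : p ∈ H10 Ω := by
    have : p ∈ closure (testPairs Ω) :=
      mem_closure_of_tendsto hlim (Filter.Eventually.of_forall hpn)
    rwa [← H10_eq_closure] at this
  exact ⟨⟨p, hp⟩, hmw.coeFn_toLp, hmg.coeFn_toLp⟩

end Lipschitz


/-! ### Finite dimension of the finite element space -/

section FiniteDim

variable {d : ℕ} {Ω : Set (Pt d)}

theorem memLp_eval (p : MvPolynomial (Fin d) ℝ) (T : Finset (Pt d)) (ν : Measure (Pt d))
    [IsFiniteMeasure ν] :
    MemLp (fun x : Pt d => MvPolynomial.eval (fun i => x i) p) 2 (ν.restrict (cell T)) := by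
  have hcont : Continuous fun x : Pt d => MvPolynomial.eval (fun i => x i) p :=
    (MvPolynomial.continuous_eval p).comp (by fun_prop)
  obtain ⟨C, hC⟩ := (isCompact_cell T).exists_bound_of_continuousOn hcont.continuousOn
  refine MemLp.of_bound hcont.aestronglyMeasurable C ?_
  exact (ae_restrict_iff' (isCompact_cell T).measurableSet).2 (Filter.Eventually.of_forall hC)

/-- The polynomials of degree at most `k` as functions on a simplex. -/
noncomputable def polyToLp (k : ℕ) (T : Finset (Pt d)) (ν : Measure (Pt d)) [IsFiniteMeasure ν] :
    MvPolynomial.restrictTotalDegree (Fin d) ℝ k →ₗ[ℝ] Lp ℝ 2 (ν.restrict (cell T)) where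
  toFun p := (memLp_eval p.1 T ν).toLp _
  map_add' p q := by
    rw [← MemLp.toLp_add]
    exact MemLp.toLp_congr _ _ (Filter.Eventually.of_forall fun x => by simp)
  map_smul' t p := by
    rw [RingHom.id_apply, ← MemLp.toLp_const_smul]
    exact MemLp.toLp_congr _ _ (Filter.Eventually.of_forall fun x => by simp)

/-- The restriction to each cell lies in the finite-dimensional image of the polynomials of degree
at most `k`. The restrictions determine the function, as the cells cover `Ω` up to a null set, and
the function determines the pair by `toL2_injective`. -/
theorem finiteDimensional_feSpace (hΩ : IsOpen Ω) (𝒯 : Mesh Ω) (k : ℕ) :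
    FiniteDimensional ℝ (feSpace 𝒯 k) := by
  have hb := 𝒯.isBounded
  have hfin : IsFiniteMeasure (volume.restrict Ω) := ⟨by
    rw [Measure.restrict_apply_univ]; exact hb.measure_lt_top⟩
  have := 𝒯.finite_elements.to_subtype
  let ν := volume.restrict Ω
  let R : ∀ T : 𝒯.elements, feSpace 𝒯 k →ₗ[ℝ] Lp ℝ 2 (ν.restrict (cell T.1)) := fun T =>
    (LpToLpRestrictCLM (Pt d) ℝ ℝ ν 2 (cell T.1)).toLinearMap ∘ₗ toL2ₗ Ω ∘ₗ (feSpace 𝒯 k).subtype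
  have hR : ∀ T u, R T u ∈ LinearMap.range (polyToLp k T.1 ν) := by
    rintro ⟨T, hT⟩ ⟨u, v, ⟨-, hp⟩, hu⟩
    obtain ⟨p, hp1, hp2⟩ := hp T hT
    refine ⟨⟨p, (MvPolynomial.mem_restrictTotalDegree _ _ _).2 hp1⟩, ?_⟩
    apply Lp.ext
    have h1 : R ⟨T, hT⟩ ⟨u, v, ⟨‹_›, hp⟩, hu⟩ =ᵐ[ν.restrict (cell T)] toL2 u :=
      LpToLpRestrictCLM_coeFn ℝ (cell T) (toL2 u)
    filter_upwards [h1, ae_restrict_of_ae hu, (memLp_eval p T ν).coeFn_toLp,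
      ae_restrict_mem (isCompact_cell T).measurableSet] with x e1 e2 e3 hx
    rw [e1, e2, hp2 x hx]
    exact e3
  let Φ : feSpace 𝒯 k →ₗ[ℝ] (∀ T : 𝒯.elements, LinearMap.range (polyToLp k T.1 ν)) :=
    LinearMap.pi fun T => (R T).codRestrict _ (hR T)
  refine Module.Finite.of_injective Φ ((injective_iff_map_eq_zero Φ).2 fun u hu => ?_)
  have hz : ∀ T (hT : T ∈ 𝒯.elements), ∀ᵐ x ∂ν, x ∈ cell T → toL2 (u : H10 Ω) x = 0 := by
    intro T hT
    have h0 : R ⟨T, hT⟩ u = 0 := congrArg Subtype.val (congrFun hu ⟨T, hT⟩)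
    have h1 : R ⟨T, hT⟩ u =ᵐ[ν.restrict (cell T)] toL2 (u : H10 Ω) :=
      LpToLpRestrictCLM_coeFn ℝ (cell T) (toL2 (u : H10 Ω))
    rw [h0] at h1
    refine (ae_restrict_iff' (isCompact_cell T).measurableSet).1 ?_
    filter_upwards [h1, Lp.coeFn_zero ℝ 2 (ν.restrict (cell T))] with x e1 e2
    rw [← e1, e2]; rfl
  have h0 : toL2 (u : H10 Ω) = 0 := by
    apply Lp.ext
    filter_upwards [(ae_ball_iff 𝒯.finite_elements.countable).2 hz, 𝒯.ae_mem_interior hΩ,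
      Lp.coeFn_zero ℝ 2 ν] with x h1 h2 h3
    obtain ⟨T, hT, hx⟩ := h2
    rw [h1 T hT (interior_subset hx.1), h3]; rfl
  exact Subtype.ext (toL2_injective hΩ hb (h0.trans (map_zero (toL2L Ω)).symm))

end FiniteDim

/-! ### Nodal interpolation -/

section Interpolation

variable {d : ℕ} {Ω : Set (Pt d)}

theorem Mesh.affineIndependent (𝒯 : Mesh Ω) {T : Finset (Pt d)} (hT : T ∈ 𝒯.elements) :
    AffineIndependent ℝ ((↑) : T → Pt d) := 𝒯.indep hT.1

theorem Mesh.affineSpan_eq_top (𝒯 : Mesh Ω) {T : Finset (Pt d)} (hT : T ∈ 𝒯.elements) :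
    affineSpan ℝ (range ((↑) : T → Pt d)) = ⊤ := by
  rw [(𝒯.affineIndependent hT).affineSpan_eq_top_iff_card_eq_finrank_add_one,
    finrank_euclideanSpace_fin, Fintype.card_coe]
  exact hT.2

theorem Mesh.interior_cell_nonempty (𝒯 : Mesh Ω) {T : Finset (Pt d)} (hT : T ∈ 𝒯.elements) :
    (interior (cell T)).Nonempty := by
  rw [cell, interior_convexHull_nonempty_iff_affineSpan_eq_top]
  have := 𝒯.affineSpan_eq_top hT
  rwa [Subtype.range_coe] at this

theorem Mesh.exists_affine (𝒯 : Mesh Ω) {T : Finset (Pt d)} (hT : T ∈ 𝒯.elements)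
    (φ : Pt d → ℝ) : ∃ (a : Pt d →L[ℝ] ℝ) (b : ℝ), ∀ v ∈ T, a v + b = φ v := by
  classical
  let B : AffineBasis T ℝ (Pt d) := ⟨_, 𝒯.affineIndependent hT, 𝒯.affineSpan_eq_top hT⟩
  let g : Pt d →ᵃ[ℝ] ℝ := ∑ v : T, φ v • B.coord v
  refine ⟨LinearMap.toContinuousLinearMap g.linear, g 0, fun v hv => ?_⟩
  have h1 : g v = g.linear v + g 0 := by
    have := g.map_vadd 0 v
    simpa using this
  have h2 : g v = φ v := by
    have h3 : ∀ w : T, B.coord w v = if w = ⟨v, hv⟩ then 1 else 0 := fun w =>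
      B.coord_apply w ⟨v, hv⟩
    have h4 : g v = ∑ w : T, φ w * B.coord w v := by
      have : ∀ s : Finset T, (∑ w ∈ s, φ w • B.coord w) v = ∑ w ∈ s, φ w * B.coord w v := by
        intro s
        induction s using Finset.induction_on with
        | empty => rfl
        | insert a s ha ih => rw [Finset.sum_insert ha, Finset.sum_insert ha, ← ih]; rfl
      exact this _
    rw [h4]
    simp [h3]
  rw [← h2, h1]
  rfl

/-- The set where an affine function is at most `m` in modulus is convex. With `m = 0` this says
that an affine function vanishing on `s` vanishes on its hull. -/
theorem convexHull_subset_of_affine_le {s : Set (Pt d)} {a : Pt d →L[ℝ] ℝ} {b m : ℝ}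
    (h : ∀ v ∈ s, |a v + b| ≤ m) : ∀ x ∈ convexHull ℝ s, |a x + b| ≤ m := by
  refine fun x hx => convexHull_min (t := {x | |a x + b| ≤ m}) h ?_ hx
  intro x hx y hy p q hp hq hpq
  simp only [mem_ofPred_eq, map_add, map_smul, smul_eq_mul] at hx hy ⊢
  have e : p * a x + q * a y + b = p * (a x + b) + q * (a y + b) := by
    linear_combination (-b) * hpq
  rw [e]
  refine (abs_add_le _ _).trans ?_
  rw [abs_mul, abs_mul, abs_of_nonneg hp, abs_of_nonneg hq]
  calc p * |a x + b| + q * |a y + b| ≤ p * m + q * m := by gcongr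
    _ = m := by rw [← add_mul, hpq, one_mul]

/-- The continuous piecewise linear interpolant, extended by zero. -/
theorem Mesh.exists_interpolant (𝒯 : Mesh Ω) (φ : Pt d → ℝ) :
    ∃ (w : Pt d → ℝ) (a : Finset (Pt d) → Pt d →L[ℝ] ℝ) (b : Finset (Pt d) → ℝ),
      (∀ T ∈ 𝒯.elements, ∀ x ∈ cell T, w x = a T x + b T) ∧
      (∀ T ∈ 𝒯.elements, ∀ v ∈ T, a T v + b T = φ v) ∧ ∀ x ∉ closure Ω, w x = 0 := by
  classical
  choose! a b hab using fun T (hT : T ∈ 𝒯.elements) => 𝒯.exists_affine hT φ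
  have hcons : ∀ T ∈ 𝒯.elements, ∀ T' ∈ 𝒯.elements, ∀ x ∈ cell T, x ∈ cell T' →
      a T x + b T = a T' x + b T' := by
    intro T hT T' hT' x hx hx'
    -- Conformity of the mesh: two cells meet only in the hull of their common vertices, where both
    -- affine pieces take the values of `φ`.
    have hmem := 𝒯.inter_subset_convexHull hT.1 hT'.1 ⟨hx, hx'⟩
    have h := convexHull_subset_of_affine_le (a := a T - a T') (b := b T - b T') (m := 0)
      (fun v hv => by
        have h1 := hab T hT v hv.1
        have h2 := hab T' hT' v hv.2
        rw [sub_apply, show a T v - a T' v + (b T - b T') = 0 by linarith, abs_zero]) x hmem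
    have := abs_nonpos_iff.1 h
    rw [sub_apply] at this
    linarith
  refine ⟨fun x => if h : ∃ T ∈ 𝒯.elements, x ∈ cell T then a h.choose x + b h.choose else 0,
    a, b, ?_, hab, ?_⟩
  · intro T hT x hx
    have h : ∃ T ∈ 𝒯.elements, x ∈ cell T := ⟨T, hT, hx⟩
    simp only [dif_pos h]
    exact hcons _ h.choose_spec.1 _ hT x h.choose_spec.2 hx
  · intro x hx
    refine dif_neg fun ⟨T, hT, hxT⟩ => hx ?_
    rw [← 𝒯.iUnion_cell]
    exact mem_biUnion hT hxT

/-- A mean value inequality along segments, for which it suffices to bound difference quotients at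
times arbitrarily close to each `t` from the right. Either the segment meets some piece at such
times, and this closed piece contains the point at time `t` too, or it stays outside all pieces just
after `t`, where `w` is zero. The pieces need not be convex together or fill the space. -/
theorem lipschitzWith_of_finite_closed_pieces {ι : Type*} [Finite ι] {S : ι → Set (Pt d)}
    (hS : ∀ i, IsClosed (S i)) {w : Pt d → ℝ} (hw : Continuous w) {L : NNReal}
    (hL : ∀ i, LipschitzOnWith L w (S i)) (h0 : ∀ x, (∀ i, x ∉ S i) → w x = 0) :
    LipschitzWith L w := by
  have key : ∀ x y, w y ≤ w x + L * dist y x := by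
    intro x y
    let p : ℝ → Pt d := fun t => x + t • (y - x)
    have hp : Continuous p := by fun_prop
    have hdist : ∀ s t, dist (p s) (p t) = |s - t| * dist y x := fun s t => by
      simp only [p, dist_eq_norm]
      rw [add_sub_add_left_eq_sub, ← sub_smul, norm_smul, Real.norm_eq_abs]
    have hfreq : ∀ t : ℝ, ∃ᶠ s in nhdsWithin t (Ioi t), |w (p s) - w (p t)| ≤ L * dist (p s) (p t) := by
      intro t hcon
      have hout : ∀ i, ∀ᶠ s in nhdsWithin t (Ioi t), p s ∉ S i := by
        intro i
        by_contra hi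
        have hi' : ∃ᶠ s in nhdsWithin t (Ioi t), p s ∈ S i := hi ∘ fun h => by simpa using h
        have ht : p t ∈ S i := by
          refine (hS i).mem_of_frequently_of_tendsto hi' ?_
          exact (hp.tendsto t).mono_left nhdsWithin_le_nhds
        obtain ⟨s, hs1, hs2⟩ := (hi'.and_eventually hcon).exists
        exact hs2 ((hL i).dist_le_mul _ hs1 _ ht)
      have hzero : ∀ᶠ s in nhdsWithin t (Ioi t), w (p s) = 0 :=
        (Filter.eventually_all.2 hout).mono fun s hs => h0 _ hs
      have hlim : Filter.Tendsto (fun s => w (p s)) (nhdsWithin t (Ioi t)) (nhds (w (p t))) :=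
        ((hw.comp hp).tendsto t).mono_left nhdsWithin_le_nhds
      have ht0 : w (p t) = 0 :=
        tendsto_nhds_unique hlim ((tendsto_const_nhds).congr' (hzero.mono fun s hs => hs.symm))
      obtain ⟨s, hs1, hs2⟩ := (hzero.and hcon).exists
      refine hs2 ?_
      change |w (p s) - w (p t)| ≤ L * dist (p s) (p t)
      rw [hs1, ht0, sub_zero, abs_zero]
      positivity
    have := image_le_of_liminf_slope_right_le_deriv_boundary (f := fun t => w (p t)) (a := 0)
      (b := 1) (B := fun t => w x + L * dist y x * t) (B' := fun _ => L * dist y x)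
      (hw.comp hp).continuousOn (by simp [p]) (by fun_prop) (fun t _ => by
        have h1 := ((hasDerivAt_id t).const_mul (L * dist y x)).const_add (w x)
        simpa using h1.hasDerivWithinAt) (fun t _ r hr => by
        refine ((hfreq t).and_eventually self_mem_nhdsWithin).mono ?_
        rintro s ⟨hs, hts⟩
        have hts : 0 < s - t := sub_pos.2 hts
        rw [slope_def_field, div_lt_iff₀ hts]
        rw [hdist, abs_of_pos hts] at hs
        have h2 := (le_abs_self _).trans hs
        nlinarith)
    have h1 := this (right_mem_Icc.2 zero_le_one)
    simpa [p] using h1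
  refine LipschitzWith.of_dist_le_mul fun x y => ?_
  rw [Real.dist_eq, abs_le]
  constructor
  · have := key x y
    rw [dist_comm] at this
    linarith
  · have := key y x
    linarith

theorem exists_mvPolynomial_affine (a : Pt d →L[ℝ] ℝ) (b : ℝ) :
    ∃ p : MvPolynomial (Fin d) ℝ, p.totalDegree ≤ 1 ∧
      ∀ x : Pt d, a x + b = MvPolynomial.eval (fun i => x i) p := by
  refine ⟨(∑ i, MvPolynomial.C (a (EuclideanSpace.single i 1)) * MvPolynomial.X i)
    + MvPolynomial.C b, ?_, fun x => ?_⟩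
  · refine (MvPolynomial.totalDegree_add _ _).trans (max_le ?_ (by simp))
    refine MvPolynomial.totalDegree_finsetSum_le fun i _ => ?_
    refine (MvPolynomial.totalDegree_mul _ _).trans ?_
    simp
  · have hx : x = ∑ i, x i • EuclideanSpace.single i (1 : ℝ) := by
      ext j
      simp [Finset.sum_apply, Pi.single_apply]
    conv_lhs => rw [hx, map_sum]
    simp [mul_comm]

end Interpolation


/-! ### Approximation by finite elements -/

section Approximation

variable {d : ℕ} {Ω : Set (Pt d)}

theorem Mesh.diam_le_size (𝒯 : Mesh Ω) {T : Finset (Pt d)} (hT : T ∈ 𝒯.elements) :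
    Metric.diam (cell T) ≤ 𝒯.size :=
  le_csSup (𝒯.finite_elements.image _).bddAbove (mem_image_of_mem _ hT)

/-- Rather than showing that the supremum defining `inDiam` is attained, take a ball whose diameter
`2 * s` exceeds half of it. Then `inDiam T < 4 * s`, which gives the constant `4 * γ`. -/
theorem Mesh.exists_closedBall_subset_cell (hd : 1 ≤ d) (𝒯 : Mesh Ω) {γ : ℝ}
    (hγ : 𝒯.ShapeRegular γ) {T : Finset (Pt d)} (hT : T ∈ 𝒯.elements) :
    ∃ (z : Pt d) (s : ℝ), 0 < s ∧ Metric.closedBall z s ⊆ cell T ∧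
      Metric.diam (cell T) ≤ 4 * γ * s := by
  have : Nonempty (Fin d) := ⟨⟨0, hd⟩⟩
  set S := {δ : ℝ | ∃ (x : Pt d) (r : ℝ), 0 ≤ r ∧ δ = 2 * r ∧ Metric.closedBall x r ⊆ cell T}
    with hS
  have hbdd : BddAbove S := by
    refine ⟨Metric.diam (cell T), ?_⟩
    rintro _ ⟨x, r, hr, rfl, hx⟩
    rw [← Metric.diam_closedBall_eq x hr]
    exact Metric.diam_mono hx (isCompact_cell T).isBounded
  obtain ⟨x, hx⟩ := 𝒯.interior_cell_nonempty hT
  obtain ⟨t, ht, hxt⟩ := Metric.nhds_basis_closedBall.mem_iff.1 (mem_interior_iff_mem_nhds.1 hx)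
  have hmem : 2 * t ∈ S := ⟨x, t, ht.le, rfl, hxt⟩
  have hin : 0 < inDiam T := lt_of_lt_of_le (by positivity) (le_csSup hbdd hmem)
  obtain ⟨_, ⟨z, s, hs, rfl, hz⟩, hlt⟩ := exists_lt_of_lt_csSup ⟨_, hmem⟩
    (show inDiam T / 2 < sSup S from half_lt_self hin)
  have h1 := (div_le_iff₀ hin).1 (hγ T hT)
  have hγ0 : 0 ≤ γ := (div_nonneg Metric.diam_nonneg hin.le).trans (hγ T hT)
  refine ⟨z, s, by linarith, hz, h1.trans ?_⟩
  nlinarith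

/-- Compare the interpolant with the Taylor polynomial of `φ` at `x`. Their difference is affine and
at each vertex is a Taylor remainder, at most `ε * diam` by the mean value inequality, hence so
bounded on the whole simplex. Its value at `x` is the first error. Its slope is at most twice this
bound divided by the radius of an inscribed ball, and shape regularity makes that `8 * γ * ε`. -/
theorem Mesh.interpolation_error (hd : 1 ≤ d) (𝒯 : Mesh Ω) {γ : ℝ} (hγ : 𝒯.ShapeRegular γ)
    {T : Finset (Pt d)} (hT : T ∈ 𝒯.elements) {φ : Pt d → ℝ} (hφ : Differentiable ℝ φ)
    {a : Pt d →L[ℝ] ℝ} {b : ℝ} (hab : ∀ v ∈ T, a v + b = φ v) {x : Pt d} (hx : x ∈ cell T)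
    {ε : ℝ} (hε : ∀ y ∈ cell T, ‖fderiv ℝ φ y - fderiv ℝ φ x‖ ≤ ε) :
    |φ x - (a x + b)| ≤ ε * Metric.diam (cell T) ∧ ‖fderiv ℝ φ x - a‖ ≤ 8 * γ * ε := by
  set l := fderiv ℝ φ x
  have hε0 : 0 ≤ ε := (norm_nonneg _).trans (hε x hx)
  have hq : ∀ y ∈ cell T, |(a - l) y + (b - φ x + l x)| ≤ ε * Metric.diam (cell T) := by
    refine convexHull_subset_of_affine_le fun v hv => ?_
    have hv' : v ∈ cell T := subset_convexHull ℝ _ hv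
    have h1 := Convex.norm_image_sub_le_of_norm_fderiv_le' (fun y _ => hφ y) hε
      (convex_convexHull ℝ _) hx hv'
    have h2 : ‖v - x‖ ≤ Metric.diam (cell T) := by
      rw [← dist_eq_norm]
      exact Metric.dist_le_diam_of_mem (isCompact_cell T).isBounded hv' hx
    have h3 : (a - l) v + (b - φ x + l x) = φ v - φ x - l (v - x) := by
      rw [sub_apply, map_sub, ← hab v hv]; ring
    rw [h3]
    exact h1.trans (by gcongr)
  refine ⟨?_, ?_⟩
  · have := hq x hx
    rw [abs_sub_comm]
    convert this using 2
    rw [sub_apply]; ring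
  obtain ⟨z, s, hs, hz, hdiam⟩ := 𝒯.exists_closedBall_subset_cell hd hγ hT
  have hγ0 : 0 ≤ γ := by
    have := Metric.diam_nonneg.trans hdiam
    by_contra hneg
    nlinarith
  rw [norm_sub_rev]
  refine ContinuousLinearMap.opNorm_le_of_unit_norm (by positivity) fun e he => ?_
  have h1 := hq z (hz (Metric.mem_closedBall_self hs.le))
  have h2 := hq (z + s • e) (hz (by
    rw [Metric.mem_closedBall, dist_self_add_left, norm_smul, he, mul_one, Real.norm_eq_abs,
      abs_of_pos hs]))
  have h3 : s * ‖(a - l) e‖ ≤ 2 * (ε * Metric.diam (cell T)) := by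
    have : s * ‖(a - l) e‖ = |((a - l) (z + s • e) + (b - φ x + l x))
        - ((a - l) z + (b - φ x + l x))| := by
      rw [map_add, map_smul, smul_eq_mul, show (a - l) z + s * (a - l) e + (b - φ x + l x)
        - ((a - l) z + (b - φ x + l x)) = s * (a - l) e by ring, abs_mul, abs_of_pos hs,
        Real.norm_eq_abs]
    rw [this, two_mul]
    exact (abs_sub _ _).trans (add_le_add h2 h1)
  have h4 : ε * Metric.diam (cell T) ≤ ε * (4 * γ * s) := by gcongr
  refine le_of_mul_le_mul_left ?_ hs
  linarith

/-- The approximant is the piecewise linear nodal interpolant. The derivative of `φ` is uniformly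
continuous, so value and gradient errors are uniformly small. Once the mesh resolves the distance
from the support to the boundary, the interpolant has compact support in `Ω`; being Lipschitz, it
belongs to `H¹₀(Ω)`. -/
theorem IsTest.exists_feSpace_approx (hd : 1 ≤ d) (hΩ : IsOpen Ω) (hb : Bornology.IsBounded Ω)
    {k : ℕ} (hk : 1 ≤ k) (γ : ℝ) {φ : Pt d → ℝ} (hφ : IsTest Ω φ) {g : H10 Ω}
    (h1 : toL2 g =ᵐ[volume.restrict Ω] φ) (h2 : grad g =ᵐ[volume.restrict Ω] gradient φ)
    {ε : ℝ} (hε : 0 < ε) :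
    ∃ h₀ > 0, ∀ 𝒯 : Mesh Ω, 𝒯.ShapeRegular γ → 𝒯.size < h₀ → ∃ v ∈ feSpace 𝒯 k, ‖g - v‖ < ε := by
  have hfin : IsFiniteMeasure (volume.restrict Ω) := ⟨by
    rw [Measure.restrict_apply_univ]; exact hb.measure_lt_top⟩
  set M : ℝ := ((measureUnivNNReal (volume.restrict Ω) : ℝ)) ^ (2 : ℝ≥0∞).toReal⁻¹ with hM
  have hM0 : 0 ≤ M := by positivity
  -- `M` converts uniform bounds on `Ω` into `L²` bounds, so the total error is at most `M * (1 + 8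
  -- * |γ|) * η`; the final `+ 1` keeps the denominator positive.
  set η := ε / (M * (2 + 8 * |γ|) + 1) with hη
  have hη0 : 0 < η := by positivity
  have huc : UniformContinuous (fderiv ℝ φ) :=
    (hφ.compact.fderiv (𝕜 := ℝ)).uniformContinuous_of_continuous
      (hφ.smooth.continuous_fderiv (by simp))
  obtain ⟨δ₁, hδ₁, hδ⟩ := Metric.uniformContinuous_iff.1 huc η hη0
  obtain ⟨δ₂, hδ₂, hsub⟩ := hφ.compact.isCompact.exists_cthickening_subset_open hΩ hφ.subset
  have hKc : IsCompact (Metric.cthickening δ₂ (tsupport φ)) := hφ.compact.isCompact.cthickening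
  have hφd : Differentiable ℝ φ := hφ.smooth.differentiable (by simp)
  -- `δ₁` controls the oscillation of the derivative on a cell, `δ₂` the growth of the support under
  -- interpolation, and `1` lets the factor `diam` in the value error be dropped.
  refine ⟨min δ₁ (min δ₂ 1), by positivity, fun 𝒯 hγ hsize => ?_⟩
  obtain ⟨hs1, hs2, hs3⟩ := by simpa only [lt_min_iff] using hsize
  obtain ⟨w, a, b, hw, hab, hw0⟩ := 𝒯.exists_interpolant φ
  have hdist : ∀ T ∈ 𝒯.elements, ∀ x ∈ cell T, ∀ y ∈ cell T, dist x y ≤ 𝒯.size :=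
    fun T hT x hx y hy => (Metric.dist_le_diam_of_mem (isCompact_cell T).isBounded hx hy).trans
      (𝒯.diam_le_size hT)
  have hmem : ∀ x ∈ closure Ω, ∃ T ∈ 𝒯.elements, x ∈ cell T := fun x hx => by
    rw [← 𝒯.iUnion_cell] at hx
    simpa using hx
  have hwK : ∀ x ∉ Metric.cthickening δ₂ (tsupport φ), w x = 0 := by
    intro x hx
    by_cases hxΩ : x ∈ closure Ω
    · obtain ⟨T, hT, hxT⟩ := hmem x hxΩ
      rw [hw T hT x hxT]
      -- Far from the support of `φ` every vertex of the cell lies where `φ` vanishes, so the affine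
      -- piece is zero.
      refine abs_nonpos_iff.1 (convexHull_subset_of_affine_le (fun v hv => ?_) x hxT)
      rw [hab T hT v hv, abs_nonpos_iff]
      by_contra hne
      exact hx (Metric.mem_cthickening_of_dist_le x v δ₂ _ (subset_tsupport _ hne)
        ((hdist T hT x hxT v (subset_convexHull ℝ _ hv)).trans hs2.le))
    · exact hw0 x hxΩ
  have hts : tsupport w ⊆ Metric.cthickening δ₂ (tsupport φ) :=
    closure_minimal (fun x hx => by_contra fun h => hx (hwK x h)) hKc.isClosed
  have hcl : ContinuousOn w (closure Ω) := by
    have := 𝒯.finite_elements.to_subtype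
    rw [← 𝒯.iUnion_cell, biUnion_eq_iUnion]
    refine (locallyFinite_of_finite _).continuousOn_iUnion
      (fun T => (isCompact_cell T.1).isClosed) fun T => ?_
    exact ((a T.1).continuous.add continuous_const).continuousOn.congr (hw T.1 T.2)
  have hwc : Continuous w := by
    refine continuous_iff_continuousAt.2 fun x => ?_
    by_cases hx : x ∈ Ω
    · exact hcl.continuousAt (Filter.mem_of_superset (hΩ.mem_nhds hx) subset_closure)
    · have : w =ᶠ[nhds x] fun _ => 0 := by
        filter_upwards [hKc.isClosed.isOpen_compl.mem_nhds fun h => hx (hsub h)] with y hy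
        exact hwK y hy
      exact continuousAt_const.congr this.symm
  have hfe := 𝒯.finite_elements.to_subtype
  -- A crude constant that dominates every piece suffices: it serves only for membership in `H¹₀(Ω)`
  -- and enters no estimate.
  have hwl : LipschitzWith (∑ T ∈ 𝒯.finite_elements.toFinset, ‖a T‖₊) w := by
    refine lipschitzWith_of_finite_closed_pieces (S := fun T : 𝒯.elements => cell T.1)
      (fun T => (isCompact_cell T.1).isClosed) hwc (fun T => ?_) fun x hx => hw0 x fun hxΩ => ?_
    · refine LipschitzOnWith.of_dist_le_mul fun x hx y hy => ?_
      rw [hw T.1 T.2 x hx, hw T.1 T.2 y hy, dist_add_right]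
      refine ((a T.1).lipschitz.dist_le_mul x y).trans ?_
      gcongr
      exact Finset.single_le_sum (f := fun T => ‖a T‖₊) (fun _ _ => zero_le)
        (𝒯.finite_elements.mem_toFinset.2 T.2)
    · obtain ⟨T, hT, hxT⟩ := hmem x hxΩ
      exact hx ⟨T, hT⟩ hxT
  obtain ⟨v, hv1, hv2⟩ := exists_mem_H10_of_lipschitz hΩ hb hwl
    (hKc.of_isClosed_subset (isClosed_tsupport w) hts) (hts.trans hsub)
  refine ⟨v, ⟨w, ⟨hcl, fun T hT => ?_⟩, hv1⟩, ?_⟩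
  · obtain ⟨p, hp1, hp2⟩ := exists_mvPolynomial_affine (a T) (b T)
    exact ⟨p, hp1.trans hk, fun x hx => by rw [hw T hT x hx, hp2]⟩
  have herr : ∀ T ∈ 𝒯.elements, ∀ x ∈ cell T,
      |φ x - (a T x + b T)| ≤ η ∧ ‖fderiv ℝ φ x - a T‖ ≤ 8 * |γ| * η := by
    intro T hT x hx
    obtain ⟨e1, e2⟩ := 𝒯.interpolation_error hd hγ hT hφd (hab T hT) hx (ε := η) fun y hy => by
      rw [← dist_eq_norm]
      exact (hδ ((hdist T hT y hy x hx).trans_lt hs1)).le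
    refine ⟨e1.trans ?_, e2.trans ?_⟩
    · have := (𝒯.diam_le_size hT).trans hs3.le
      nlinarith
    · gcongr
      exact le_abs_self γ
  have hn1 : ‖toL2 (g - v)‖ ≤ M * η := by
    refine Lp.norm_le_of_ae_bound hη0.le ?_
    filter_upwards [Lp.coeFn_sub (toL2 g) (toL2 v), h1, hv1, 𝒯.ae_mem_interior hΩ]
      with x e1 e2 e3 ⟨T, hT, hx⟩
    have hxT := interior_subset hx.1
    rw [show toL2 (g - v) = toL2 g - toL2 v from rfl, e1, Pi.sub_apply, e2, e3, hw T hT x hxT]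
    exact (herr T hT x hxT).1
  have hn2 : ‖grad (g - v)‖ ≤ M * (8 * |γ| * η) := by
    refine Lp.norm_le_of_ae_bound (by positivity) ?_
    filter_upwards [Lp.coeFn_sub (grad g) (grad v), h2, hv2, 𝒯.ae_mem_interior hΩ]
      with x e1 e2 e3 ⟨T, hT, hx⟩
    have hxT := interior_subset hx.1
    have hder : fderiv ℝ w x = a T := by
      have : w =ᶠ[nhds x] fun y => a T y + b T := by
        filter_upwards [mem_interior_iff_mem_nhds.1 hx.1] with y hy
        exact hw T hT y hy
      rw [this.fderiv_eq, fderiv_add_const, ContinuousLinearMap.fderiv]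
    rw [show grad (g - v) = grad g - grad v from rfl, e1, Pi.sub_apply, e2, e3, gradient,
      gradient, ← map_sub, LinearIsometryEquiv.norm_map, hder]
    exact (herr T hT x hxT).2
  have hn3 : ‖g - v‖ ≤ ‖toL2 (g - v)‖ + ‖grad (g - v)‖ := by
    refine le_of_sq_le_sq ?_ (by positivity)
    rw [norm_sq_eq]
    nlinarith [norm_nonneg (toL2 (g - v)), norm_nonneg (grad (g - v))]
  have hlt : M * (2 + 8 * |γ|) * η < ε := by
    rw [hη, mul_div_assoc', div_lt_iff₀ (by positivity)]
    nlinarith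
  nlinarith [mul_nonneg hM0 hη0.le]

theorem exists_feSpace_approx (hd : 1 ≤ d) (hΩ : IsOpen Ω) (hb : Bornology.IsBounded Ω)
    {k : ℕ} (hk : 1 ≤ k) (γ : ℝ) (g : H10 Ω) {ε : ℝ} (hε : 0 < ε) :
    ∃ h₀ > 0, ∀ 𝒯 : Mesh Ω, 𝒯.ShapeRegular γ → 𝒯.size < h₀ → ∃ v ∈ feSpace 𝒯 k, ‖g - v‖ < ε := by
  have hg : (g : L2Pair Ω) ∈ closure (testPairs Ω) := by rw [← H10_eq_closure]; exact g.2
  obtain ⟨p, hp, hgp⟩ := Metric.mem_closure_iff.1 hg (ε / 2) (by positivity)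
  have hpH : p ∈ H10 Ω := by
    rw [← SetLike.mem_coe, H10_eq_closure]; exact subset_closure hp
  obtain ⟨φ, k1, k2, k3, k4, k5⟩ := hp
  obtain ⟨h₀, hh, H⟩ := IsTest.exists_feSpace_approx hd hΩ hb hk γ ⟨k1, k2, k3⟩
    (g := ⟨p, hpH⟩) k4 k5 (half_pos hε)
  refine ⟨h₀, hh, fun 𝒯 hγ hs => ?_⟩
  obtain ⟨v, hv, hpv⟩ := H 𝒯 hγ hs
  refine ⟨v, hv, ?_⟩
  have h1 : ‖g - ⟨p, hpH⟩‖ < ε / 2 := by rw [← dist_eq_norm]; exact hgp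
  have h2 := norm_sub_le_norm_sub_add_norm_sub g ⟨p, hpH⟩ v
  linarith

end Approximation


/-! ### Galerkin approximation in Hilbert spaces -/

section Galerkin

variable {H X : Type*} [NormedAddCommGroup H] [InnerProductSpace ℝ H]
  [NormedAddCommGroup X] [InnerProductSpace ℝ X]

/-- A symmetric and coercive bounded bilinear form. -/
structure IsEnergyForm (a : H →L[ℝ] H →L[ℝ] ℝ) (α : ℝ) : Prop where
  pos : 0 < α
  symm : ∀ u v, a u v = a v u
  coercive : ∀ u, α * ‖u‖ ^ 2 ≤ a u u

variable {a : H →L[ℝ] H →L[ℝ] ℝ} {α : ℝ}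

theorem IsEnergyForm.nonneg (h : IsEnergyForm a α) (u : H) : 0 ≤ a u u :=
  (mul_nonneg h.pos.le (sq_nonneg _)).trans (h.coercive u)

theorem IsEnergyForm.eq_zero (h : IsEnergyForm a α) {u : H} (hu : a u u ≤ 0) : u = 0 := by
  have h1 := (h.coercive u).trans hu
  have h2 : ‖u‖ ^ 2 ≤ 0 := by
    by_contra hlt
    push Not at hlt
    exact absurd h1 (not_le.2 (mul_pos h.pos hlt))
  exact norm_eq_zero.1 (pow_eq_zero_iff two_ne_zero |>.1 (le_antisymm h2 (sq_nonneg _)))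

theorem IsEnergyForm.apply_le_sqrt (h : IsEnergyForm a α) (u v : H) :
    a u v ≤ √(a u u) * √(a v v) := by
  rw [← Real.sqrt_mul (h.nonneg u)]
  refine Real.le_sqrt_of_sq_le ?_
  have hp : ∀ t : ℝ, 0 ≤ a v v * (t * t) + (2 * a u v) * t + a u u := fun t => by
    have := h.nonneg (u + t • v)
    simp only [map_add, map_smul, add_apply, smul_apply, smul_eq_mul, h.symm v u] at this
    linarith
  have := discrim_le_zero hp
  rw [discrim] at this
  linarith

theorem IsEnergyForm.sqrt_add_le (h : IsEnergyForm a α) (u v : H) :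
    √(a (u + v) (u + v)) ≤ √(a u u) + √(a v v) := by
  refine Real.sqrt_le_iff.2 ⟨by positivity, ?_⟩
  have h1 := h.apply_le_sqrt u v
  have h2 := Real.sq_sqrt (h.nonneg u)
  have h3 := Real.sq_sqrt (h.nonneg v)
  have h4 : a (u + v) (u + v) = a u u + 2 * a u v + a v v := by
    simp only [map_add, add_apply, h.symm v u]
    ring
  rw [h4]
  nlinarith

theorem IsEnergyForm.abs_sqrt_sub_sqrt_le (h : IsEnergyForm a α) (u v : H) :
    |√(a u u) - √(a v v)| ≤ √(a (u - v) (u - v)) := by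
  have h1 := h.sqrt_add_le (u - v) v
  have h2 := h.sqrt_add_le (v - u) u
  have h3 : a (v - u) (v - u) = a (u - v) (u - v) := by
    simp only [map_sub, sub_apply]; ring
  rw [sub_add_cancel] at h1 h2
  rw [h3] at h2
  rw [abs_le]
  constructor <;> linarith

theorem sqrt_apply_self_le (a : H →L[ℝ] H →L[ℝ] ℝ) (u : H) : √(a u u) ≤ √‖a‖ * ‖u‖ := by
  rw [← Real.sqrt_sq (norm_nonneg u), ← Real.sqrt_mul (norm_nonneg a)]
  refine Real.sqrt_le_sqrt ?_
  have := (le_abs_self _).trans (a.le_opNorm₂ u u)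
  rw [sq, ← mul_assoc]
  exact this

theorem IsEnergyForm.eq_of_forall (h : IsEnergyForm a α) {V : Submodule ℝ H} {u v : H}
    (hu : u ∈ V) (hv : v ∈ V) (huv : ∀ w ∈ V, a u w = a v w) : u = v := by
  refine sub_eq_zero.1 (h.eq_zero ?_)
  rw [map_sub a, sub_apply, huv _ (V.sub_mem hu hv), sub_self]

/-- The Lax-Milgram theorem on a complete subspace, with a parameter. -/
theorem IsEnergyForm.exists_solution (h : IsEnergyForm a α) (V : Submodule ℝ H) [CompleteSpace V]
    {E : Type*} [NormedAddCommGroup E] [NormedSpace ℝ E] (l : E →L[ℝ] H →L[ℝ] ℝ) :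
    ∃ S : E →L[ℝ] H, ∀ x, S x ∈ V ∧ ∀ v ∈ V, a (S x) v = l x v := by
  let B : V →L[ℝ] V →L[ℝ] ℝ := a.bilinearComp V.subtypeL V.subtypeL
  have hB : IsCoercive B := ⟨α, h.pos, fun u => by
    rw [mul_assoc, ← sq]
    exact h.coercive u⟩
  let e := hB.continuousLinearEquivOfBilin
  let D : (V →L[ℝ] ℝ) →L[ℝ] V := LinearMap.mkContinuous
    { toFun := fun f => (InnerProductSpace.toDual ℝ V).symm f
      map_add' := fun f g => map_add _ f g
      map_smul' := fun t f => by simp } 1 fun f => by simp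
  have hD : ∀ f v, (inner ℝ (D f) v : ℝ) = f v := fun f v =>
    InnerProductSpace.toDual_symm_apply
  let P : E →L[ℝ] V →L[ℝ] ℝ := ((ContinuousLinearMap.compL ℝ V H ℝ).flip V.subtypeL) ∘L l
  let S : E →L[ℝ] V := (e.symm : V →L[ℝ] V) ∘L D ∘L P
  refine ⟨V.subtypeL ∘L S, fun x => ⟨(S x).2, fun v hv => ?_⟩⟩
  have h1 : B (S x) ⟨v, hv⟩ = inner ℝ (e (S x)) (⟨v, hv⟩ : V) :=
    (hB.continuousLinearEquivOfBilin_apply (S x) ⟨v, hv⟩).symm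
  have h2 : e (S x) = D (P x) := e.apply_symm_apply _
  rw [h2, hD] at h1
  exact h1

variable {V : Submodule ℝ H} {R : H →L[ℝ] H}

/-- Pythagoras for the energy product: `u - R u` is orthogonal to `R u - v`. -/
theorem IsEnergyForm.sqrt_galerkin_le (h : IsEnergyForm a α)
    (hR : ∀ u, R u ∈ V ∧ ∀ v ∈ V, a (u - R u) v = 0) (u : H) {v : H} (hv : v ∈ V) :
    √(a (u - R u) (u - R u)) ≤ √(a (u - v) (u - v)) := by
  refine Real.sqrt_le_sqrt ?_
  have h1 := (hR u).2 (R u - v) (V.sub_mem (hR u).1 hv)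
  have h2 := h.nonneg (R u - v)
  have h3 : a (u - v) (u - v)
      = a (u - R u) (u - R u) + 2 * a (u - R u) (R u - v) + a (R u - v) (R u - v) := by
    conv_lhs => rw [← sub_add_sub_cancel u (R u) v]
    simp only [map_add, add_apply, h.symm (R u - v) (u - R u)]
    ring
  rw [h3, h1]
  linarith

/-- Céa's lemma. -/
theorem IsEnergyForm.norm_galerkin_le (h : IsEnergyForm a α)
    (hR : ∀ u, R u ∈ V ∧ ∀ v ∈ V, a (u - R u) v = 0) (u : H) {v : H} (hv : v ∈ V) :
    ‖u - R u‖ ≤ ‖a‖ / α * ‖u - v‖ := by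
  have h1 := (hR u).2 (R u - v) (V.sub_mem (hR u).1 hv)
  have h2 : a (u - R u) (u - R u) = a (u - R u) (u - v) := by
    rw [← sub_add_sub_cancel u (R u) v, map_add, h1, add_zero]
  have h3 := (h.coercive (u - R u)).trans (h2.le.trans ((le_abs_self _).trans
    (a.le_opNorm₂ (u - R u) (u - v))))
  rw [div_mul_eq_mul_div, le_div_iff₀ h.pos]
  rcases (norm_nonneg (u - R u)).eq_or_lt with h0 | h0
  · rw [← h0, zero_mul]; positivity
  · refine le_of_mul_le_mul_left ?_ h0
    calc ‖u - R u‖ * (‖u - R u‖ * α) = α * ‖u - R u‖ ^ 2 := by ring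
      _ ≤ _ := h3
      _ = _ := by ring

variable {J : H →L[ℝ] X} {K : X →L[ℝ] H}

/-- This makes `J K` symmetric and positive, and lets an `L²` quantity control the energy norm of `K
f`. -/
theorem IsEnergyForm.inner_map (h : IsEnergyForm a α)
    (hK : ∀ f v, a (K f) v = inner ℝ f (J v)) (f g : X) :
    inner ℝ (J (K f)) g = a (K f) (K g) := by
  rw [h.symm, hK, real_inner_comm]

theorem IsEnergyForm.isSymmetric (h : IsEnergyForm a α)
    (hK : ∀ f v, a (K f) v = inner ℝ f (J v)) : ((J ∘L K : X →L[ℝ] X) : X →ₗ[ℝ] X).IsSymmetric := by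
  intro f g
  change inner ℝ (J (K f)) g = inner ℝ f (J (K g))
  rw [h.inner_map hK, hK]

/-- Convergence of Galerkin solution operators in the operator norm: it suffices to approximate
the members of a finite set. -/
theorem IsEnergyForm.exists_finite_norm_sub_lt (h : IsEnergyForm a α)
    (hK : ∀ f v, a (K f) v = inner ℝ f (J v)) (hc : IsCompactOperator J) {ε : ℝ} (hε : 0 < ε) :
    ∃ F : Set H, F.Finite ∧ ∃ η > 0, ∀ (V : Submodule ℝ H) (R : H →L[ℝ] H),
      (∀ u, R u ∈ V ∧ ∀ v ∈ V, a (u - R u) v = 0) → (∀ g ∈ F, ∃ v ∈ V, ‖g - v‖ < η) →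
      ‖J ∘L (R ∘L K) - J ∘L K‖ < ε := by
  set M := ‖J‖ * (‖a‖ / α) with hM
  have hM0 : 0 ≤ M := mul_nonneg (norm_nonneg _) (div_nonneg (norm_nonneg a) h.pos.le)
  set η := ε / (4 * (M + 1)) with hη
  have hη0 : 0 < η := by positivity
  have hα := h.pos
  set B := Metric.closedBall (0 : X) 1
  have hTB : TotallyBounded ((J ∘L K) '' B) := by
    have h1 : IsCompactOperator (J ∘L K) := hc.comp_clm K
    exact ((isCompactOperator_iff_isCompact_closure_image_closedBall (𝕜₁ := ℝ)
      ((J ∘L K : X →L[ℝ] X) : X →ₗ[ℝ] X) one_pos).1 h1).totallyBounded.subset subset_closure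
  -- A finite net for the image of the unit ball in `X`. Its radius is quadratic in `η` because the
  -- passage to the norm of `H` below takes a square root.
  obtain ⟨t, ht, htf, hcov⟩ := hTB.exists_subset
    (Metric.dist_mem_uniformity (show (0 : ℝ) < α * η ^ 2 / 2 by positivity))
  have ht' : ∀ y ∈ t, ∃ f ∈ B, J (K f) = y := fun y hy => ht hy
  choose! p hpB hp using ht'
  refine ⟨(fun y => K (p y)) '' t, htf.image _, η, hη0, fun V R hR hF => ?_⟩
  have key : ∀ f ∈ B, ‖J (R (K f)) - J (K f)‖ ≤ M * (2 * η) := by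
    intro f hf
    obtain ⟨y, hy, hfy⟩ := mem_iUnion₂.1 (hcov (mem_image_of_mem _ hf))
    have hfy : dist (J (K f)) y < α * η ^ 2 / 2 := hfy
    obtain ⟨v, hv, hgv⟩ := hF _ (mem_image_of_mem _ hy)
    set g := p y
    have hgy : J (K g) = y := hp y hy
    have hfg : ‖f - g‖ ≤ 2 := by
      have h1 : ‖f‖ ≤ 1 := by simpa [B] using hf
      have h2 : ‖g‖ ≤ 1 := by simpa [B] using hpB y hy
      exact (norm_sub_le f g).trans (by linarith)
    -- Closeness in `X` is upgraded to `H`: by coercivity `α ‖K (f - g)‖ ^ 2` is at most `⟨J K (f -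
    -- g), f - g⟩`, and `‖f - g‖ ≤ 2`.
    have h1 : ‖K f - K g‖ ≤ η := by
      have e1 : a (K (f - g)) (K (f - g)) ≤ 2 * (α * η ^ 2 / 2) := by
        rw [← h.inner_map hK, map_sub, map_sub, hgy]
        refine (real_inner_le_norm _ _).trans ?_
        rw [dist_eq_norm] at hfy
        rw [mul_comm]
        gcongr
      have e2 := (h.coercive (K (f - g))).trans e1
      rw [map_sub] at e2
      refine le_of_sq_le_sq ?_ hη0.le
      refine le_of_mul_le_mul_left ?_ hα
      linarith
    have h2 : ‖K f - v‖ ≤ 2 * η := by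
      have := norm_sub_le_norm_sub_add_norm_sub (K f) (K g) v
      linarith
    rw [← map_sub, hM, mul_assoc]
    refine (J.le_opNorm _).trans ?_
    rw [norm_sub_rev]
    refine mul_le_mul_of_nonneg_left ((h.norm_galerkin_le hR (K f) hv).trans ?_) (norm_nonneg _)
    exact mul_le_mul_of_nonneg_left h2 (div_nonneg (norm_nonneg a) hα.le)
  have hle : ‖J ∘L (R ∘L K) - J ∘L K‖ ≤ M * (2 * η) :=
    ContinuousLinearMap.opNorm_le_of_unit_norm (by positivity) fun f hf =>
      key f (by simp [B, hf])
  refine hle.trans_lt ?_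
  rw [hη, show M * (2 * (ε / (4 * (M + 1)))) = 2 * M * ε / (4 * (M + 1)) by ring,
    div_lt_iff₀ (by positivity)]
  nlinarith

end Galerkin


/-! ### The eigenvalue problem in Hilbert spaces -/

section Eigenvalues

variable {H X : Type*} [NormedAddCommGroup H] [InnerProductSpace ℝ H]
  [NormedAddCommGroup X] [InnerProductSpace ℝ X]
  {a : H →L[ℝ] H →L[ℝ] ℝ} {α : ℝ} {J : H →L[ℝ] X} {K : X →L[ℝ] H}

/-- The solutions `u` of `a(u, v) = ν ⟨J u, J v⟩` for all `v`. -/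
def relEigenspace (a : H →L[ℝ] H →L[ℝ] ℝ) (J : H →L[ℝ] X) (ν : ℝ) : Submodule ℝ H where
  carrier := {u | ∀ v, a u v = ν * inner ℝ (J u) (J v)}
  zero_mem' v := by simp
  add_mem' {u w} hu hw v := by
    rw [map_add, add_apply, hu v, hw v, map_add, inner_add_left, mul_add]
  smul_mem' t u hu v := by
    rw [map_smul, smul_apply, hu v, map_smul, real_inner_smul_left, smul_eq_mul]; ring

theorem IsEnergyForm.mem_relEigenspace_iff (h : IsEnergyForm a α)
    (hK : ∀ f v, a (K f) v = inner ℝ f (J v)) {ν : ℝ} {u : H} :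
    u ∈ relEigenspace a J ν ↔ u = ν • K (J u) := by
  have e : ∀ v, a (ν • K (J u)) v = ν * inner ℝ (J u) (J v) := fun v => by
    rw [map_smul, smul_apply, hK, smul_eq_mul]
  refine ⟨fun hu => h.eq_of_forall (V := ⊤) trivial trivial fun v _ => ?_, fun hu v => ?_⟩
  · rw [e, hu v]
  · rw [← e v, ← hu]

theorem IsEnergyForm.relEigenspace_eq_bot (h : IsEnergyForm a α) {ν : ℝ} (hν : ν ≤ 0) :
    relEigenspace a J ν = ⊥ := by
  refine (Submodule.eq_bot_iff _).2 fun u hu => h.eq_zero ?_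
  rw [hu u]
  exact mul_nonpos_of_nonpos_of_nonneg hν real_inner_self_nonneg

/-- A solution satisfies `u = ν • K (J u)`, so `J u` is an eigenvector for `ν⁻¹`; conversely `f ↦ ν
• K f` recovers `u`. -/
theorem IsEnergyForm.map_relEigenspace (h : IsEnergyForm a α)
    (hK : ∀ f v, a (K f) v = inner ℝ f (J v)) {ν : ℝ} (hν : ν ≠ 0) :
    (relEigenspace a J ν).map (J : H →ₗ[ℝ] X)
      = Module.End.eigenspace ((J ∘L K : X →L[ℝ] X) : X →ₗ[ℝ] X) ν⁻¹ := by
  ext f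
  rw [Submodule.mem_map, Module.End.mem_eigenspace_iff]
  change _ ↔ J (K f) = ν⁻¹ • f
  constructor
  · rintro ⟨u, hu, rfl⟩
    have h1 := (h.mem_relEigenspace_iff hK).1 hu
    change J (K (J u)) = ν⁻¹ • J u
    conv_rhs => rw [h1]
    rw [map_smul, inv_smul_smul₀ hν]
  · intro hf
    have h1 : J (ν • K f) = f := by rw [map_smul, hf, smul_inv_smul₀ hν]
    exact ⟨ν • K f, (h.mem_relEigenspace_iff hK).2 (by rw [h1]), h1⟩

theorem finrank_map_eq_of_injective (hJ : Function.Injective J) (W : Submodule ℝ H) :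
    Module.finrank ℝ (W.map (J : H →ₗ[ℝ] X)) = Module.finrank ℝ W :=
  (Submodule.equivMapOfInjective (J : H →ₗ[ℝ] X) hJ W).finrank_eq.symm

/-- Inversion exchanges `(0, ν)` and `(ν⁻¹, ∞)`, while `κ ≤ 0` contributes nothing by coercivity.
Injectivity of `J` preserves the dimension. -/
theorem IsEnergyForm.finrank_iSup_relEigenspace (h : IsEnergyForm a α)
    (hK : ∀ f v, a (K f) v = inner ℝ f (J v)) (hJ : Function.Injective J) {ν : ℝ} (hν : 0 < ν) :
    Module.finrank ℝ (⨆ κ : Iio ν, relEigenspace a J κ : Submodule ℝ H)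
      = Module.finrank ℝ (spectralSpan (J ∘L K) (Ioi ν⁻¹)) := by
  rw [← finrank_map_eq_of_injective hJ, Submodule.map_iSup]
  suffices h0 : (⨆ κ : Iio ν, (relEigenspace a J κ.1).map (J : H →ₗ[ℝ] X))
      = spectralSpan (J ∘L K) (Ioi ν⁻¹) by rw [h0]
  refine le_antisymm (iSup_le fun κ => ?_) (iSup_le fun μ => ?_)
  · rcases le_or_gt κ.1 0 with h0 | h0
    · rw [h.relEigenspace_eq_bot h0, Submodule.map_bot]
      exact bot_le
    · rw [h.map_relEigenspace hK h0.ne']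
      exact eigenspace_le_spectralSpan _ ((inv_lt_inv₀ hν h0).2 κ.2)
  · have h0 : 0 < μ.1 := (inv_pos.2 hν).trans μ.2
    have h1 : μ.1⁻¹ < ν := (inv_lt_comm₀ h0 hν).2 μ.2
    have h2 := h.map_relEigenspace hK (J := J) (inv_pos.2 h0).ne'
    rw [inv_inv] at h2
    rw [← h2]
    exact le_iSup (fun κ : Iio ν => (relEigenspace a J κ.1).map (J : H →ₗ[ℝ] X)) ⟨μ.1⁻¹, h1⟩

theorem IsEnergyForm.finrank_add_finrank_relEigenspace [CompleteSpace X] (h : IsEnergyForm a α)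
    (hK : ∀ f v, a (K f) v = inner ℝ f (J v)) (hJ : Function.Injective J)
    (hc : IsCompactOperator J) {ν : ℝ} (hν : 0 < ν) :
    Module.finrank ℝ (⨆ κ : Iio ν, relEigenspace a J κ : Submodule ℝ H)
      + Module.finrank ℝ (relEigenspace a J ν)
      = Module.finrank ℝ (spectralSpan (J ∘L K) (Ici ν⁻¹)) := by
  have hT := h.isSymmetric hK
  have hcT : IsCompactOperator (J ∘L K) := hc.comp_clm K
  have hm : 0 < ν⁻¹ := inv_pos.2 hν
  have hs : spectralSpan (J ∘L K) {ν⁻¹} = (relEigenspace a J ν).map (J : H →ₗ[ℝ] X) := by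
    rw [h.map_relEigenspace hK hν.ne']
    simp [spectralSpan]
  have hu : Ici ν⁻¹ = Ioi ν⁻¹ ∪ {ν⁻¹} := Ioi_union_left.symm
  have f1 := finiteDimensional_spectralSpan hT hcT (P := Ioi ν⁻¹) hm fun μ h => h.le
  have f2 := finiteDimensional_spectralSpan hT hcT (P := {ν⁻¹}) hm fun μ h => h.ge
  have hd : Disjoint (spectralSpan (J ∘L K) (Ioi ν⁻¹)) (spectralSpan (J ∘L K) {ν⁻¹}) :=
    (spectralSpan_isOrtho hT (by simp)).disjoint
  have h1 := Submodule.finrank_sup_add_finrank_inf_eq (spectralSpan (J ∘L K) (Ioi ν⁻¹))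
    (spectralSpan (J ∘L K) {ν⁻¹})
  rw [hd.eq_bot, finrank_bot, add_zero, ← spectralSpan_union, ← hu] at h1
  rw [h1, h.finrank_iSup_relEigenspace hK hJ hν, hs, finrank_map_eq_of_injective hJ]

/-- If every point of `[0, m)` fails to be an eigenvalue of the compact positive operator `J K`,
then the space is finite-dimensional. -/
theorem IsEnergyForm.finiteDimensional_of_no_eigenvalue [CompleteSpace X] (h : IsEnergyForm a α)
    (hK : ∀ f v, a (K f) v = inner ℝ f (J v)) (hc : IsCompactOperator J) {m : ℝ} (hm : 0 < m)
    (hev : ∀ μ, 0 ≤ μ → μ < m →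
      ¬ Module.End.HasEigenvalue ((J ∘L K : X →L[ℝ] X) : X →ₗ[ℝ] X) μ) :
    FiniteDimensional ℝ X := by
  have hT := h.isSymmetric hK
  have hcT : IsCompactOperator (J ∘L K) := hc.comp_clm K
  have hneg : ∀ μ, Module.End.HasEigenvalue ((J ∘L K : X →L[ℝ] X) : X →ₗ[ℝ] X) μ → 0 ≤ μ := by
    intro μ hμ
    obtain ⟨f, hf⟩ := hμ.exists_hasEigenvector
    have h1 : J (K f) = μ • f := hf.apply_eq_smul
    have h2 := h.inner_map hK f f
    rw [h1, real_inner_smul_left] at h2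
    by_contra hlt
    push Not at hlt
    have := h.nonneg (K f)
    have := real_inner_self_pos.2 hf.2
    nlinarith
  have hfd := finiteDimensional_spectralSpan hT hcT (P := Ici m) hm fun μ h => h
  have htop : spectralSpan (J ∘L K) (Ici m) = ⊤ := by
    rw [← Submodule.orthogonal_eq_bot_iff, Submodule.eq_bot_iff]
    intro f hf
    -- No eigenvalue is left outside `Ici m`, so any level is admissible here; a negative one
    -- contradicts positivity unless `f = 0`.
    have hle : inner ℝ ((J ∘L K) f) f ≤ (-1 : ℝ) * ‖f‖ ^ 2 :=
      inner_map_le_of_mem_spectralSpan_orthogonal hT hcT (fun μ hμ he =>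
        absurd he (hev μ (hneg μ he) (not_le.1 hμ))) hf
    have h2 : 0 ≤ inner ℝ ((J ∘L K) f) f := by
      change 0 ≤ inner ℝ (J (K f)) f
      rw [h.inner_map hK]
      exact h.nonneg _
    have h3 : ‖f‖ ^ 2 ≤ 0 := by linarith
    exact norm_eq_zero.1 (pow_eq_zero_iff two_ne_zero |>.1 (le_antisymm h3 (sq_nonneg _)))
  rw [htop] at hfd
  exact Module.Finite.equiv (Submodule.topEquiv (R := ℝ) (M := X))

end Eigenvalues

/-! ### Diagonalisation of discrete operators -/

section Diagonal

variable {H X : Type*} [NormedAddCommGroup H] [InnerProductSpace ℝ H]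
  [NormedAddCommGroup X] [InnerProductSpace ℝ X]

/-- Diagonalise the restriction of `T` to `W`. Since `T f ∈ W` for every `f`, symmetry extends the
expansion to all of `X`, with `T` vanishing on the complement of `W`. -/
theorem exists_isDiagonal {T : X →L[ℝ] X} (hT : (T : X →ₗ[ℝ] X).IsSymmetric) (W : Submodule ℝ X)
    [FiniteDimensional ℝ W] (hW : ∀ f, T f ∈ W) :
    ∃ (e : Fin (Module.finrank ℝ W) → X) (μ : Fin (Module.finrank ℝ W) → ℝ),
      Orthonormal ℝ e ∧ IsDiagonal T e μ := by
  have hS := hT.restrict_invariant (V := W) fun v _ => hW v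
  let b := hS.eigenvectorBasis rfl
  refine ⟨fun i => b i, hS.eigenvalues rfl, b.orthonormal.comp_linearIsometry W.subtypeₗᵢ,
    fun f => ?_⟩
  have h1 : (⟨T f, hW f⟩ : W) = ∑ i, (inner ℝ (b i) (⟨T f, hW f⟩ : W) : ℝ) • b i :=
    (b.sum_repr' _).symm
  have h2 : ∀ i, (inner ℝ (b i) (⟨T f, hW f⟩ : W) : ℝ)
      = hS.eigenvalues rfl i * inner ℝ (b i : X) f := by
    intro i
    have h3 : T (b i : X) = hS.eigenvalues rfl i • (b i : X) :=
      congrArg Subtype.val (hS.apply_eigenvectorBasis rfl i)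
    have h4 : inner ℝ (T (b i : X)) f = inner ℝ (b i : X) (T f) := hT _ _
    rw [h3, real_inner_smul_left] at h4
    exact h4.symm
  have h5 := congrArg Subtype.val h1
  simp only [h2] at h5
  simpa using h5

/-- The `U i` are linearly independent and as many as `dim V`, so they span `V`. Testing the
equation for `S f` with `U i` yields the coefficients. -/
theorem isDiagonal_of_discrete_eigensystem {a : H →L[ℝ] H →L[ℝ] ℝ} {α : ℝ} {J : H →L[ℝ] X}
    (h : IsEnergyForm a α) {V : Submodule ℝ H} [FiniteDimensional ℝ V] {S : X →L[ℝ] H}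
    (hS : ∀ f, S f ∈ V ∧ ∀ v ∈ V, a (S f) v = inner ℝ f (J v)) {n : ℕ}
    (hn : n = Module.finrank ℝ V) {U : Fin n → H} (hU : ∀ i, U i ∈ V)
    (he : Orthonormal ℝ fun i => J (U i)) {Λ : Fin n → ℝ}
    (hΛ : ∀ i, ∀ v ∈ V, a (U i) v = Λ i * inner ℝ (J (U i)) (J v)) :
    (∀ i, 0 < Λ i) ∧ IsDiagonal (J ∘L S) (fun i => J (U i)) fun i => (Λ i)⁻¹ := by
  have hpos : ∀ i, 0 < Λ i := fun i => by
    have h1 := hΛ i (U i) (hU i)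
    rw [real_inner_self_eq_norm_sq, he.1 i, one_pow, mul_one] at h1
    rw [← h1]
    refine lt_of_not_ge fun hle => ?_
    have h2 := he.1 i
    simp [h.eq_zero hle] at h2
  refine ⟨hpos, fun f => ?_⟩
  let W : Fin n → V := fun i => ⟨U i, hU i⟩
  have hli : LinearIndependent ℝ W := by
    refine LinearIndependent.of_comp ((J : H →ₗ[ℝ] X) ∘ₗ V.subtype) ?_
    exact he.linearIndependent
  have hspan : Submodule.span ℝ (range W) = ⊤ :=
    hli.span_eq_top_of_card_eq_finrank' (by rw [Fintype.card_fin, hn])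
  obtain ⟨x, hx⟩ := (Submodule.mem_span_range_iff_exists_fun ℝ).1
    (show (⟨S f, (hS f).1⟩ : V) ∈ Submodule.span ℝ (range W) by rw [hspan]; trivial)
  have hSf : S f = ∑ i, x i • U i := by
    have := congrArg Subtype.val hx
    simpa [W] using this.symm
  have hJ : J (S f) = ∑ i, x i • J (U i) := by rw [hSf, map_sum]; simp
  have hxi : ∀ i, x i = (Λ i)⁻¹ * inner ℝ (J (U i)) f := fun i => by
    have h1 := hΛ i (S f) (hS f).1
    rw [h.symm, (hS f).2 _ (hU i), hJ, he.inner_right_fintype] at h1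
    rw [real_inner_comm, h1, inv_mul_cancel_left₀ (hpos i).ne']
  change J (S f) = _
  rw [hJ]
  exact Finset.sum_congr rfl fun i _ => by rw [hxi]

theorem norm_sum_inner_smul_le {ι : Type*} [Fintype ι] {e : ι → X} (he : Orthonormal ℝ e)
    {β : ι → ℝ} {M : ℝ} (hM : 0 ≤ M) (hβ : ∀ i, |β i| ≤ M) (x : X) :
    ‖∑ i, (β i * inner ℝ (e i) x) • e i‖ ≤ M * ‖x‖ := by
  refine le_of_sq_le_sq ?_ (by positivity)
  rw [← real_inner_self_eq_norm_sq, he.inner_sum]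
  have h1 := he.sum_inner_products_le (s := Finset.univ) x
  calc ∑ i, (starRingEnd ℝ) (β i * inner ℝ (e i) x) * (β i * inner ℝ (e i) x)
      ≤ ∑ i, M ^ 2 * ‖(inner ℝ (e i) x : ℝ)‖ ^ 2 := by
        refine Finset.sum_le_sum fun i _ => ?_
        have h2 : β i ^ 2 ≤ M ^ 2 := sq_le_sq' (abs_le.1 (hβ i)).1 (abs_le.1 (hβ i)).2
        rw [Real.norm_eq_abs, sq_abs, conj_trivial]
        nlinarith [sq_nonneg (inner ℝ (e i) x : ℝ)]
    _ ≤ (M * ‖x‖) ^ 2 := by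
        rw [← Finset.mul_sum, mul_pow]
        gcongr

/-- The residual bounds the distance to the scaled cluster projection. -/
theorem IsDiagonal.norm_sub_cluster_le {ι : Type*} [Fintype ι] {T : X →L[ℝ] X} {e : ι → X}
    {μ : ι → ℝ} (h : IsDiagonal T e μ) (he : Orthonormal ℝ e) {m r : ℝ} (hr : 0 < r) (hm : r < m)
    (f : X) :
    ‖m⁻¹ • f - ∑ i with |μ i - m| < r, ((μ i)⁻¹ * inner ℝ (e i) f) • e i‖
      ≤ (2 * (m⁻¹) ^ 2 + (m⁻¹ * (m - r)⁻¹ + m⁻¹ * r⁻¹)) * ‖T f - m • f‖ := by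
  classical
  have hm0 : 0 < m := hr.trans hm
  have hmr : 0 < m - r := sub_pos.2 hm
  set g := T f - m • f with hg
  have hgi : ∀ i, (inner ℝ (e i) g : ℝ) = (μ i - m) * inner ℝ (e i) f := fun i => by
    rw [hg, inner_sub_right, h f, he.inner_right_fintype, real_inner_smul_right]
    ring
  -- With `(e i, g) = (μ i - m) (e i, f)`, the coefficient to be recovered is `m⁻¹ - (μ i)⁻¹ = (μ i
  -- - m) / (m μ i)` inside the cluster and `m⁻¹` outside. Division by `μ i - m` gives these
  -- multipliers, bounded because `μ i > m - r` inside and `|μ i - m| ≥ r` outside.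
  let β : ι → ℝ := fun i => if |μ i - m| < r then m⁻¹ * (μ i)⁻¹ else m⁻¹ * (μ i - m)⁻¹
  have hβ : ∀ i, |β i| ≤ m⁻¹ * (m - r)⁻¹ + m⁻¹ * r⁻¹ := fun i => by
    have p1 : 0 ≤ m⁻¹ * r⁻¹ := by positivity
    have p2 : 0 ≤ m⁻¹ * (m - r)⁻¹ := by positivity
    by_cases hi : |μ i - m| < r
    · have h1 : m - r ≤ μ i := by have := (abs_lt.1 hi).1; linarith
      simp only [β, if_pos hi]
      rw [abs_mul, abs_of_pos (inv_pos.2 hm0), abs_of_pos (inv_pos.2 (hmr.trans_le h1))]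
      have : m⁻¹ * (μ i)⁻¹ ≤ m⁻¹ * (m - r)⁻¹ := by gcongr
      linarith
    · have h1 : r ≤ |μ i - m| := not_lt.1 hi
      simp only [β, if_neg hi]
      rw [abs_mul, abs_of_pos (inv_pos.2 hm0), abs_inv]
      have : m⁻¹ * |μ i - m|⁻¹ ≤ m⁻¹ * r⁻¹ := by gcongr
      linarith
  set p : X := ∑ i, (1 * inner ℝ (e i) g : ℝ) • e i with hp
  have hPg : ‖p‖ ≤ ‖g‖ := by
    have := norm_sum_inner_smul_le he (β := fun _ => 1) zero_le_one (by simp) g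
    rwa [one_mul] at this
  -- On the complement of the `e i` the operator vanishes and `g = -m f`, so `m⁻¹ f = -m⁻² g` there;
  -- `g - p` is this component of `g`.
  have key : m⁻¹ • f - ∑ i with |μ i - m| < r, ((μ i)⁻¹ * inner ℝ (e i) f) • e i
      = (-(m⁻¹) ^ 2) • (g - p) + ∑ i, (β i * inner ℝ (e i) g) • e i := by
    have e1 : g - p = -(m • f) + ∑ i, (m * inner ℝ (e i) f) • e i := by
      have e2 : p = ∑ i, ((μ i - m) * inner ℝ (e i) f) • e i := by
        simp only [hp, hgi, one_mul]
      rw [e2, hg, h f, sub_right_comm, ← Finset.sum_sub_distrib, sub_eq_neg_add]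
      congr 1
      refine Finset.sum_congr rfl fun i _ => ?_
      rw [← sub_smul]
      congr 1
      ring
    rw [e1, Finset.sum_filter, smul_add, Finset.smul_sum, add_assoc, ← Finset.sum_add_distrib,
      sub_eq_add_neg, ← Finset.sum_neg_distrib]
    congr 1
    · rw [smul_neg, smul_smul, ← neg_smul]
      congr 1
      field_simp
    · refine Finset.sum_congr rfl fun i _ => ?_
      rw [hgi]
      by_cases hi : |μ i - m| < r
      · have h1 : 0 < μ i := by have := (abs_lt.1 hi).1; linarith
        simp only [β, if_pos hi]
        rw [smul_smul, ← add_smul, ← neg_smul]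
        congr 1
        field_simp
        ring
      · have h1 : μ i - m ≠ 0 := fun h0 => hi (by rw [h0, abs_zero]; exact hr)
        simp only [β, if_neg hi]
        rw [smul_smul, ← add_smul, neg_zero]
        symm
        convert zero_smul ℝ (e i) using 2
        field_simp
        ring
  rw [key]
  have hg2 : ‖g - p‖ ≤ 2 * ‖g‖ := (norm_sub_le _ _).trans (by linarith)
  refine (norm_add_le _ _).trans ?_
  rw [add_mul]
  refine add_le_add ?_ (norm_sum_inner_smul_le he (by positivity) hβ g)
  rw [norm_smul, norm_neg, Real.norm_of_nonneg (by positivity)]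
  nlinarith [sq_nonneg m⁻¹]

end Diagonal


/-! ### The energy estimate for an eigenvalue cluster -/

section Superclose

variable {H X : Type*} [NormedAddCommGroup H] [InnerProductSpace ℝ H]
  [NormedAddCommGroup X] [InnerProductSpace ℝ X]
  {a : H →L[ℝ] H →L[ℝ] ℝ} {α : ℝ} {J : H →L[ℝ] X} {K : X →L[ℝ] H}
  {V : Submodule ℝ H} {R : H →L[ℝ] H}

theorem apply_eq_of_apply_sub_eq_zero {u w v : H} (h : a (u - w) v = 0) : a u v = a w v := by
  rwa [map_sub a, sub_apply, sub_eq_zero] at h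

/-- The Aubin-Nitsche estimate. -/
theorem IsEnergyForm.norm_map_galerkin_le (h : IsEnergyForm a α)
    (hK : ∀ f v, a (K f) v = inner ℝ f (J v))
    (hR : ∀ u, R u ∈ V ∧ ∀ v ∈ V, a (u - R u) v = 0) {ρ : ℝ} (hρ0 : 0 ≤ ρ)
    (hρ : ∀ f : X, ‖f‖ = 1 → ⨅ v : V, ‖K f - v‖ ≤ ρ) (u : H) :
    ‖J (u - R u)‖ ≤ √‖a‖ * ρ * √(a (u - R u) (u - R u)) := by
  set e := u - R u with he
  rcases (norm_nonneg (J e)).eq_or_lt with h0 | h0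
  · rw [← h0]; positivity
  -- Duality: `K f` solves the problem with normalised data `J e`, so `‖J e‖ = a e (K f)`, and
  -- Galerkin orthogonality permits subtracting any `v ∈ V` from `K f`.
  set f := ‖J e‖⁻¹ • J e with hf
  have hf1 : ‖f‖ = 1 := by rw [hf, norm_smul, norm_inv, norm_norm, inv_mul_cancel₀ h0.ne']
  have h1 : ‖J e‖ = a e (K f) := by
    rw [h.symm, hK, hf, real_inner_smul_left, real_inner_self_eq_norm_sq]
    field_simp
  have h2 : ∀ v : V, ‖J e‖ ≤ √‖a‖ * √(a e e) * ‖K f - v‖ := fun v => by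
    have h3 : ‖J e‖ = a e (K f - v) := by
      rw [map_sub (a e), show a e v = 0 from (hR u).2 v v.2, sub_zero, h1]
    rw [h3]
    refine (h.apply_le_sqrt _ _).trans ?_
    calc √(a e e) * √(a (K f - v) (K f - v)) ≤ √(a e e) * (√‖a‖ * ‖K f - v‖) := by
          gcongr
          exact sqrt_apply_self_le a _
      _ = _ := by ring
  calc ‖J e‖ ≤ ⨅ v : V, √‖a‖ * √(a e e) * ‖K f - v‖ := le_ciInf h2
    _ = √‖a‖ * √(a e e) * ⨅ v : V, ‖K f - v‖ := (Real.mul_iInf_of_nonneg (by positivity) _).symm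
    _ ≤ √‖a‖ * √(a e e) * ρ := by
        gcongr
        exact hρ f hf1
    _ = _ := by ring

/-- The lifted cluster projection is superclose to the eigenfunction in the energy norm. -/
theorem IsEnergyForm.exists_superclose (h : IsEnergyForm a α)
    (hK : ∀ f v, a (K f) v = inner ℝ f (J v)) {m r : ℝ} (hr : 0 < r) (hm : r < m) :
    ∃ C > 0, ∀ (V : Submodule ℝ H) (R : H →L[ℝ] H),
      (∀ u, R u ∈ V ∧ ∀ v ∈ V, a (u - R u) v = 0) → ∀ ρ : ℝ, 0 ≤ ρ →
      (∀ f : X, ‖f‖ = 1 → ⨅ v : V, ‖K f - v‖ ≤ ρ) →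
      ∀ {ι : Type} [Fintype ι] (U : ι → H) (μ : ι → ℝ), Orthonormal ℝ (fun i => J (U i)) →
      IsDiagonal (J ∘L (R ∘L K)) (fun i => J (U i)) μ → ∀ u : H, u = m⁻¹ • K (J u) →
      ∀ w : H, w = ∑ i with |μ i - m| < r, ((μ i)⁻¹ * inner ℝ (J (U i)) (J u)) • K (J (U i)) →
      ∀ v ∈ V, √(a (u - w) (u - w)) ≤ C * ρ * √(a (u - v) (u - v)) := by
  have hm0 : 0 < m := hr.trans hm
  have hmr : 0 < m - r := sub_pos.2 hm
  set D := 2 * (m⁻¹) ^ 2 + (m⁻¹ * (m - r)⁻¹ + m⁻¹ * r⁻¹) with hD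
  have hD0 : 0 ≤ D := by positivity
  refine ⟨√‖a‖ * ‖K‖ * D * m * √‖a‖ + 1, by positivity, ?_⟩
  intro V R hR ρ hρ0 hρ ι _ U μ he hdiag u hu w hw v hv
  -- Both `u` and `w` are in the range of `K`, so an `L²` bound on the argument gives an energy
  -- bound on the difference.
  have h1 : u - w = K (m⁻¹ • J u
      - ∑ i with |μ i - m| < r, ((μ i)⁻¹ * inner ℝ (J (U i)) (J u)) • J (U i)) := by
    rw [map_sub, map_smul, ← hu, hw, map_sum]
    simp only [map_smul]
  have hKu : K (J u) = m • u := by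
    conv_rhs => rw [hu]
    rw [smul_inv_smul₀ hm0.ne']
  -- The residual of the exact eigenfunction in the discrete operator is a multiple of its Galerkin
  -- error.
  have h2 : (J ∘L (R ∘L K)) (J u) - m • J u = -(m • J (u - R u)) := by
    change J (R (K (J u))) - m • J u = _
    rw [hKu, map_smul, map_smul, map_sub, smul_sub, neg_sub]
  have h3 := hdiag.norm_sub_cluster_le he hr hm (J u)
  rw [h2, norm_neg, norm_smul, Real.norm_of_nonneg hm0.le] at h3
  have h4 := h.norm_map_galerkin_le hK hR hρ0 hρ u
  have h5 := h.sqrt_galerkin_le hR u hv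
  calc √(a (u - w) (u - w)) ≤ √‖a‖ * ‖u - w‖ := sqrt_apply_self_le a _
    _ ≤ √‖a‖ * (‖K‖ * (D * (m * (√‖a‖ * ρ * √(a (u - v) (u - v)))))) := by
        gcongr
        rw [h1]
        refine (K.le_opNorm _).trans ?_
        gcongr
        refine h3.trans ?_
        gcongr
        refine h4.trans ?_
        gcongr
    _ = √‖a‖ * ‖K‖ * D * m * √‖a‖ * ρ * √(a (u - v) (u - v)) := by ring
    _ ≤ _ := by
        gcongr
        linarith

end Superclose

/-! ### Solution operators and Galerkin projections on `H¹₀(Ω)` -/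

section Concrete

variable {d : ℕ} {Ω : Set (Pt d)} {A : Pt d → Matrix (Fin d) (Fin d) ℝ} {c : Pt d → ℝ}
  {a : H10 Ω →L[ℝ] H10 Ω →L[ℝ] ℝ} {α : ℝ}

theorem exists_energyForm (hd : 1 ≤ d) (hΩ : IsOpen Ω) {𝒯₀ : Mesh Ω} (hA : IsDiffusion Ω 𝒯₀ A)
    (hc : IsPotential Ω c) : ∃ (a : H10 Ω →L[ℝ] H10 Ω →L[ℝ] ℝ) (α : ℝ), IsEnergyForm a α ∧
      ∀ u v, aForm A c u v = a u v := by
  have hap := fun u v => (energyForm_apply (fun i j => hA.memLp_top hΩ i j) hc.bounded u v).2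
  obtain ⟨α, hα, hcoer⟩ := exists_coercive hd hΩ hA hc
  refine ⟨energyForm (fun i j => hA.memLp_top hΩ i j) hc.bounded, α, ⟨hα, fun u v => ?_,
    fun u => ?_⟩, fun u v => (hap u v).symm⟩
  · rw [hap, hap, aForm_comm hA]
  · rw [hap]; exact hcoer u

theorem isSolOp_solOp (h : IsEnergyForm a α) (ha : ∀ u v, aForm A c u v = a u v)
    (V : Submodule ℝ (H10 Ω)) [CompleteSpace V] : IsSolOp A c V (solOp A c V) := by
  have hex : ∃ S, IsSolOp A c V S := by
    obtain ⟨S, hS⟩ := h.exists_solution V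
      (((innerSL ℝ : L2 Ω →L[ℝ] L2 Ω →L[ℝ] ℝ)).bilinearComp (.id ℝ _) (toL2L Ω))
    refine ⟨S, fun f => ⟨(hS f).1, fun v hv => ?_⟩⟩
    rw [ha, (hS f).2 v hv]
    rfl
  rw [solOp, dif_pos hex]
  exact hex.choose_spec

theorem isGalerkinProj_galerkinProj (h : IsEnergyForm a α) (ha : ∀ u v, aForm A c u v = a u v)
    (V : Submodule ℝ (H10 Ω)) [CompleteSpace V] :
    IsGalerkinProj A c V (galerkinProj A c V) := by
  have hex : ∃ R, IsGalerkinProj A c V R := by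
    obtain ⟨R, hR⟩ := h.exists_solution V a
    refine ⟨R, fun u => ⟨(hR u).1, fun v hv => ?_⟩⟩
    rw [ha, map_sub, sub_apply, (hR u).2 v hv, sub_self]
  rw [galerkinProj, dif_pos hex]
  exact hex.choose_spec

theorem opK_apply (h : IsEnergyForm a α) (ha : ∀ u v, aForm A c u v = a u v) (f : L2 Ω)
    (v : H10 Ω) : a (opK A c f) v = inner ℝ f (toL2L Ω v) := by
  have : CompleteSpace (⊤ : Submodule ℝ (H10 Ω)) :=
    (isClosed_univ (X := H10 Ω)).completeSpace_coe
  rw [← ha]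
  exact (isSolOp_solOp h ha ⊤ f).2 v trivial

theorem solOp_eq_galerkinProj_comp (h : IsEnergyForm a α) (ha : ∀ u v, aForm A c u v = a u v)
    (V : Submodule ℝ (H10 Ω)) [CompleteSpace V] :
    solOp A c V = galerkinProj A c V ∘L opK A c := by
  refine ContinuousLinearMap.ext fun f => ?_
  have h1 := isSolOp_solOp h ha V f
  have h2 := isGalerkinProj_galerkinProj h ha V (opK A c f)
  refine h.eq_of_forall (V := V) h1.1 h2.1 fun v hv => ?_
  have h3 := apply_eq_of_apply_sub_eq_zero ((ha _ _).symm.trans (h2.2 v hv))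
  exact ((ha _ _).symm.trans (h1.2 v hv)).trans ((opK_apply h ha f v).symm.trans h3)

theorem isEigvec_iff (ha : ∀ u v, aForm A c u v = a u v) {ν : ℝ} {u : H10 Ω} :
    IsEigvec A c ν u ↔ u ∈ relEigenspace a (toL2L Ω) ν :=
  forall_congr' fun v => by rw [ha]; rfl

theorem eigenspace_eq (ha : ∀ u v, aForm A c u v = a u v) (ν : ℝ) :
    eigenspace Ω A c ν = relEigenspace a (toL2L Ω) ν := by
  rw [eigenspace, show {u | IsEigvec A c ν u} = (relEigenspace a (toL2L Ω) ν : Set (H10 Ω)) from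
    ext fun u => isEigvec_iff ha, Submodule.span_eq]

theorem numBelow_eq (ha : ∀ u v, aForm A c u v = a u v) (ν : ℝ) :
    numBelow Ω A c ν
      = Module.finrank ℝ (⨆ κ : Iio ν, relEigenspace a (toL2L Ω) κ : Submodule ℝ (H10 Ω)) := by
  rw [numBelow, iSup_congr fun κ : Iio ν => eigenspace_eq ha κ.1]

theorem mult_eq (ha : ∀ u v, aForm A c u v = a u v) (ν : ℝ) :
    mult Ω A c ν = Module.finrank ℝ (relEigenspace a (toL2L Ω) ν) := by
  rw [mult, eigenspace_eq ha]

theorem rhoErr_nonneg (V : Submodule ℝ (H10 Ω)) : 0 ≤ rhoErr A c V :=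
  Real.iSup_nonneg fun _ => Real.iInf_nonneg fun _ => norm_nonneg _

theorem deltaErr_nonneg (V : Submodule ℝ (H10 Ω)) (ν : ℝ) : 0 ≤ deltaErr A c V ν :=
  Real.iSup_nonneg fun _ => Real.iInf_nonneg fun _ => Real.sqrt_nonneg _

/-- The real supremum is meaningful only for a bounded family; the choice `v = 0` bounds it by
`‖K‖`. -/
theorem iInf_le_rhoErr (V : Submodule ℝ (H10 Ω)) (f : L2 Ω) (hf : ‖f‖ = 1) :
    ⨅ v : V, ‖opK A c f - v‖ ≤ rhoErr A c V := by
  refine le_ciSup (f := fun f : {f : L2 Ω // ‖f‖ = 1} => ⨅ v : V, ‖opK A c f.1 - v.1‖)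
    ⟨‖(opK A c : L2 Ω →L[ℝ] H10 Ω)‖, ?_⟩ ⟨f, hf⟩
  rintro _ ⟨g, rfl⟩
  refine (ciInf_le ⟨0, ?_⟩ (0 : V)).trans ?_
  · rintro _ ⟨v, rfl⟩; exact norm_nonneg _
  · have h1 := (opK A c).le_opNorm g.1
    rw [g.2, mul_one] at h1
    simpa using h1

end Concrete


/-! ### Discrete eigensystems -/

section DiscreteCluster

variable {H X : Type*} [NormedAddCommGroup H] [InnerProductSpace ℝ H]
  [NormedAddCommGroup X] [InnerProductSpace ℝ X]
  {a : H →L[ℝ] H →L[ℝ] ℝ} {α : ℝ} {J : H →L[ℝ] X} {K : X →L[ℝ] H}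
  {V : Submodule ℝ H} {R : H →L[ℝ] H}

theorem exists_pos_forall_finite {β : Type*} {F : Set β} (hF : F.Finite) {P : β → ℝ → Prop}
    (hP : ∀ g s t, s ≤ t → P g t → P g s) (h : ∀ g ∈ F, ∃ t > 0, P g t) :
    ∃ t > 0, ∀ g ∈ F, P g t := by
  choose! t ht hPt using h
  have h1 : ∀ᶠ s in nhdsWithin (0 : ℝ) (Ioi 0), ∀ g ∈ F, s ≤ t g := by
    refine (Filter.eventually_all_finite hF).2 fun g hg => ?_
    filter_upwards [Ioc_mem_nhdsGT (ht g hg)] with s hs using hs.2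
  obtain ⟨s, hs, hs0⟩ := (h1.and self_mem_nhdsWithin).exists
  exact ⟨s, hs0, fun g hg => hP g s (t g) (hs g hg) (hPt g hg)⟩

theorem sum_filter_eq_sum_fin {n k q : ℕ} {M : Type*} [AddCommMonoid M] {p : Fin n → Prop}
    [DecidablePred p] (hp : ∀ i : Fin n, p i ↔ k ≤ i ∧ (i : ℕ) < k + q) (hkq : k + q ≤ n)
    (F : ℕ → M) : ∑ i with p i, F i = ∑ l : Fin q, F (k + l) := by
  symm
  refine Finset.sum_bij (fun l _ => ⟨k + l, by omega⟩) (fun l _ => ?_) (fun l _ l' _ h => ?_)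
    (fun i hi => ?_) fun l _ => rfl
  · rw [Finset.mem_filter]
    exact ⟨Finset.mem_univ _, (hp _).2 ⟨by simp, by simp⟩⟩
  · have := congrArg Fin.val h
    exact Fin.ext (by simpa using this)
  · obtain ⟨h1, h2⟩ := (hp i).1 (Finset.mem_filter.1 hi).2
    exact ⟨⟨i - k, by omega⟩, Finset.mem_univ _, Fin.ext (by simp; omega)⟩

theorem IsEnergyForm.exists_forall_card_eq [CompleteSpace X] (h : IsEnergyForm a α)
    (hK : ∀ f v, a (K f) v = inner ℝ f (J v)) (hJ : Function.Injective J)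
    (hc : IsCompactOperator J) {ν r : ℝ} (hν : 0 < ν) (hr : 0 < r) (hm : r < ν⁻¹)
    (hgap : ∀ μ, Module.End.HasEigenvalue ((J ∘L K : X →L[ℝ] X) : X →ₗ[ℝ] X) μ →
      |μ - ν⁻¹| ≤ r → μ = ν⁻¹) {k q : ℕ}
    (hk : k = Module.finrank ℝ (⨆ κ : Iio ν, relEigenspace a J κ : Submodule ℝ H))
    (hq : q = Module.finrank ℝ (relEigenspace a J ν)) :
    ∃ ε > 0, ∀ {ι : Type} [Fintype ι] (e : ι → X) (μ : ι → ℝ) (Th : X →L[ℝ] X),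
      Orthonormal ℝ e → IsDiagonal Th e μ → ‖Th - J ∘L K‖ < ε →
      (∀ i, μ i ≠ ν⁻¹ + r) ∧ (∀ i, μ i ≠ ν⁻¹ - r) ∧
      (Finset.univ.filter fun i => ν⁻¹ + r ≤ μ i).card = k ∧
      (Finset.univ.filter fun i => ν⁻¹ - r ≤ μ i).card = k + q := by
  rw [hk, hq, h.finrank_add_finrank_relEigenspace hK hJ hc hν,
    h.finrank_iSup_relEigenspace hK hJ hν]
  exact EigFEM.exists_forall_card_eq (h.isSymmetric hK) (hc.comp_clm K) hr hm hgap

theorem galerkin_comp_apply (hK : ∀ f v, a (K f) v = inner ℝ f (J v))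
    (hR : ∀ u, R u ∈ V ∧ ∀ v ∈ V, a (u - R u) v = 0) (f : X) :
    (R ∘L K) f ∈ V ∧ ∀ v ∈ V, a ((R ∘L K) f) v = inner ℝ f (J v) :=
  ⟨(hR _).1, fun v hv => (apply_eq_of_apply_sub_eq_zero ((hR _).2 v hv)).symm.trans (hK f v)⟩

theorem IsEnergyForm.isSymmetric_galerkin (h : IsEnergyForm a α)
    (hK : ∀ f v, a (K f) v = inner ℝ f (J v))
    (hR : ∀ u, R u ∈ V ∧ ∀ v ∈ V, a (u - R u) v = 0) :
    ((J ∘L (R ∘L K) : X →L[ℝ] X) : X →ₗ[ℝ] X).IsSymmetric := by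
  intro f g
  change inner ℝ (J ((R ∘L K) f)) g = inner ℝ f (J ((R ∘L K) g))
  rw [real_inner_comm, ← (galerkin_comp_apply hK hR g).2 _ (galerkin_comp_apply hK hR f).1,
    ← (galerkin_comp_apply hK hR f).2 _ (galerkin_comp_apply hK hR g).1, h.symm]

theorem exists_isDiagonal_galerkin (h : IsEnergyForm a α)
    (hK : ∀ f v, a (K f) v = inner ℝ f (J v)) (hJ : Function.Injective J)
    [FiniteDimensional ℝ V] (hR : ∀ u, R u ∈ V ∧ ∀ v ∈ V, a (u - R u) v = 0) :
    ∃ (e : Fin (Module.finrank ℝ V) → X) (μ : Fin (Module.finrank ℝ V) → ℝ),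
      Orthonormal ℝ e ∧ IsDiagonal (J ∘L (R ∘L K)) e μ := by
  rw [← finrank_map_eq_of_injective hJ V]
  exact exists_isDiagonal (h.isSymmetric_galerkin hK hR) (V.map (J : H →ₗ[ℝ] X)) fun f =>
    Submodule.mem_map_of_mem (galerkin_comp_apply hK hR f).1

/-- The reciprocals of the ordered discrete eigenvalues decrease, so those above a level form an
initial segment whose length is the count. The two counts therefore place the cluster at the indices
from `k` to `k + q - 1`. -/
theorem discrete_eigensystem_cluster (h : IsEnergyForm a α)
    (hK : ∀ f v, a (K f) v = inner ℝ f (J v))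
    [FiniteDimensional ℝ V] (hR : ∀ u, R u ∈ V ∧ ∀ v ∈ V, a (u - R u) v = 0)
    {m r : ℝ} {k q : ℕ}
    (hcard : ∀ (e : Fin (Module.finrank ℝ V) → X) (μ : Fin (Module.finrank ℝ V) → ℝ),
      Orthonormal ℝ e → IsDiagonal (J ∘L (R ∘L K)) e μ →
      (∀ i, μ i ≠ m + r) ∧ (∀ i, μ i ≠ m - r) ∧
      (Finset.univ.filter fun i => m + r ≤ μ i).card = k ∧
      (Finset.univ.filter fun i => m - r ≤ μ i).card = k + q)
    {Λ : ℕ → ℝ} {U : ℕ → H} (hmono : ∀ i j, i ≤ j → j < Module.finrank ℝ V → Λ i ≤ Λ j)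
    (hU : ∀ i < Module.finrank ℝ V, U i ∈ V)
    (he : ∀ i < Module.finrank ℝ V, ∀ j < Module.finrank ℝ V,
      inner ℝ (J (U i)) (J (U j)) = if i = j then (1 : ℝ) else 0)
    (hΛ : ∀ i < Module.finrank ℝ V, ∀ v ∈ V, a (U i) v = Λ i * inner ℝ (J (U i)) (J v)) :
    Orthonormal ℝ (fun i : Fin (Module.finrank ℝ V) => J (U i)) ∧
    IsDiagonal (J ∘L (R ∘L K)) (fun i : Fin (Module.finrank ℝ V) => J (U i))
      (fun i => (Λ i)⁻¹) ∧
    (∀ i : Fin (Module.finrank ℝ V), |(Λ i)⁻¹ - m| ≠ r) ∧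
    (∀ F : ℕ → X, ∑ i ∈ Finset.univ.filter (fun i : Fin (Module.finrank ℝ V) =>
        |(Λ i)⁻¹ - m| < r), F i
      = ∑ l : Fin q, F (k + l)) ∧
    (∀ F : ℕ → H, ∑ i ∈ Finset.univ.filter (fun i : Fin (Module.finrank ℝ V) =>
        |(Λ i)⁻¹ - m| < r), F i
      = ∑ l : Fin q, F (k + l)) ∧
    k + q ≤ Module.finrank ℝ V ∧
    (∀ i < Module.finrank ℝ V, Λ i • R (K (J (U i))) = U i) := by
  have hon : Orthonormal ℝ (fun i : Fin (Module.finrank ℝ V) => J (U i)) :=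
    orthonormal_iff_ite.2 fun i j => by
      rw [he i i.2 j j.2]
      simp [Fin.ext_iff]
  obtain ⟨hpos, hdiag⟩ := isDiagonal_of_discrete_eigensystem h (galerkin_comp_apply hK hR) rfl
    (U := fun i : Fin (Module.finrank ℝ V) => U i) (fun i => hU i i.2) hon
    (Λ := fun i => Λ i) fun i => hΛ i i.2
  obtain ⟨c1, c2, c3, c4⟩ := hcard _ _ hon hdiag
  have hanti : Antitone fun i : Fin (Module.finrank ℝ V) => (Λ i)⁻¹ := fun i j hij =>
    inv_anti₀ (hpos i) (hmono i j hij j.2)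
  have hkq : k + q ≤ Module.finrank ℝ V := by
    rw [← c4]
    exact (Finset.card_le_univ _).trans (Fintype.card_fin _).le
  have hmem : ∀ i : Fin (Module.finrank ℝ V),
      |(Λ i)⁻¹ - m| < r ↔ k ≤ i ∧ (i : ℕ) < k + q := fun i => by
    have h1 := le_iff_lt_card_of_antitone hanti (m + r) i
    have h2 := le_iff_lt_card_of_antitone hanti (m - r) i
    rw [c3] at h1
    rw [c4] at h2
    rw [← h2, ← not_lt, ← h1, abs_lt, not_le]
    constructor
    · rintro ⟨h3, h4⟩
      exact ⟨by linarith, by linarith⟩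
    · rintro ⟨h3, h4⟩
      have := lt_of_le_of_ne h4 (c2 i).symm
      exact ⟨by linarith, by linarith⟩
  refine ⟨hon, hdiag, fun i hi => ?_, fun F => sum_filter_eq_sum_fin hmem hkq F,
    fun F => sum_filter_eq_sum_fin hmem hkq F, hkq, fun i hi => ?_⟩
  · rcases abs_choice ((Λ i)⁻¹ - m) with h1 | h1
    · exact c1 i (by linarith)
    · exact c2 i (by linarith)
  · refine h.eq_of_forall (V := V) (V.smul_mem _ (hR _).1) (hU i hi) fun v hv => ?_
    rw [map_smul a, smul_apply, hΛ i hi v hv, smul_eq_mul]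
    congr 1
    exact (galerkin_comp_apply hK hR _).2 v hv

/-- The cluster estimate for all Galerkin spaces that approximate a certain finite set well. -/
theorem IsEnergyForm.exists_cluster_estimate [CompleteSpace X] (h : IsEnergyForm a α)
    (hK : ∀ f v, a (K f) v = inner ℝ f (J v)) (hJ : Function.Injective J)
    (hc : IsCompactOperator J) {ν r : ℝ} (hν : 0 < ν) (hr : 0 < r) (hm : r < ν⁻¹)
    (hgap : ∀ μ, Module.End.HasEigenvalue ((J ∘L K : X →L[ℝ] X) : X →ₗ[ℝ] X) μ →
      |μ - ν⁻¹| ≤ r → μ = ν⁻¹) {k q : ℕ}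
    (hk : k = Module.finrank ℝ (⨆ κ : Iio ν, relEigenspace a J κ : Submodule ℝ H))
    (hq : q = Module.finrank ℝ (relEigenspace a J ν)) :
    ∃ C > 0, ∃ F : Set H, F.Finite ∧ ∃ η > 0, ∀ (V : Submodule ℝ H) [FiniteDimensional ℝ V]
      (R : H →L[ℝ] H), (∀ u, R u ∈ V ∧ ∀ v ∈ V, a (u - R u) v = 0) →
      (∀ g ∈ F, ∃ v ∈ V, ‖g - v‖ < η) →
      k + q ≤ Module.finrank ℝ V ∧
      (∃ (e : Fin (Module.finrank ℝ V) → X) (μ : Fin (Module.finrank ℝ V) → ℝ),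
        Orthonormal ℝ e ∧ IsDiagonal (J ∘L (R ∘L K)) e μ ∧ ∀ i, |μ i - ν⁻¹| ≠ r) ∧
      ∀ (Λ : ℕ → ℝ) (U : ℕ → H), (∀ i j, i ≤ j → j < Module.finrank ℝ V → Λ i ≤ Λ j) →
      (∀ i < Module.finrank ℝ V, U i ∈ V) →
      (∀ i < Module.finrank ℝ V, ∀ j < Module.finrank ℝ V,
        inner ℝ (J (U i)) (J (U j)) = if i = j then (1 : ℝ) else 0) →
      (∀ i < Module.finrank ℝ V, ∀ v ∈ V, a (U i) v = Λ i * inner ℝ (J (U i)) (J v)) →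
      Orthonormal ℝ (fun i : Fin (Module.finrank ℝ V) => J (U i)) ∧
      IsDiagonal (J ∘L (R ∘L K)) (fun i : Fin (Module.finrank ℝ V) => J (U i))
        (fun i => (Λ i)⁻¹) ∧
      (∀ i : Fin (Module.finrank ℝ V), |(Λ i)⁻¹ - ν⁻¹| ≠ r) ∧
      ∀ u ∈ relEigenspace a J ν,
        (∑ i ∈ Finset.univ.filter (fun i : Fin (Module.finrank ℝ V) => |(Λ i)⁻¹ - ν⁻¹| < r),
          (inner ℝ (J (U i)) (J u) : ℝ) • J (U i)
            = J (∑ l : Fin q, (inner ℝ (J (U (k + l))) (J u) : ℝ) • U (k + l))) ∧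
        (∀ β : Fin q → ℝ, J (∑ l, β l • U (k + l))
            = J (∑ l : Fin q, (inner ℝ (J (U (k + l))) (J u) : ℝ) • U (k + l)) →
          β = fun l : Fin q => inner ℝ (J (U (k + l))) (J u)) ∧
        ∀ ρ : ℝ, 0 ≤ ρ → (∀ f : X, ‖f‖ = 1 → ⨅ v : V, ‖K f - v‖ ≤ ρ) → ∀ E w : H,
          E = ∑ l : Fin q, (inner ℝ (J (U (k + l))) (J u) : ℝ) • U (k + l) →
          w = ∑ l : Fin q, (inner ℝ (J (U (k + l))) (J u) * Λ (k + l)) • K (J (U (k + l))) →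
          E = R w ∧ |√(a (u - E) (u - E)) - √(a (w - R w) (w - R w))|
            ≤ C * ρ * √(a (u - E) (u - E)) := by
  obtain ⟨ε, hε, hcount⟩ := h.exists_forall_card_eq hK hJ hc hν hr hm hgap hk hq
  obtain ⟨F, hF, η, hη, happ⟩ := h.exists_finite_norm_sub_lt hK hc hε
  obtain ⟨C, hC, hsuper⟩ := h.exists_superclose hK hr hm
  refine ⟨C, hC, F, hF, η, hη, fun V _ R hR hFV => ?_⟩
  have hcard := fun e μ he hdiag => hcount (ι := Fin (Module.finrank ℝ V)) e μ _ he hdiag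
    (happ V R hR hFV)
  -- The dimension bound and the resolvent claim are asserted without a given eigensystem, so one is
  -- taken from the spectral theorem.
  obtain ⟨e, μ, he, hdiag⟩ := exists_isDiagonal_galerkin h hK hJ hR
  obtain ⟨c1, c2, -, c4⟩ := hcard e μ he hdiag
  have hkq : k + q ≤ Module.finrank ℝ V := by
    rw [← c4]
    exact (Finset.card_le_univ _).trans (Fintype.card_fin _).le
  refine ⟨hkq, ⟨e, μ, he, hdiag, fun i hi => ?_⟩, fun Λ U hmono hU hon hΛ => ?_⟩
  · rcases abs_choice (μ i - ν⁻¹) with h1 | h1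
    · exact c1 i (by linarith)
    · exact c2 i (by linarith)
  obtain ⟨hon, hdg, hne, hsX, hsH, -, hRK⟩ := discrete_eigensystem_cluster h hK hR hcard hmono hU
    hon hΛ
  refine ⟨hon, hdg, hne, fun u hu => ⟨?_, fun β hβ => ?_, fun ρ hρ0 hρ E w hE hw => ?_⟩⟩
  · rw [hsX fun n => (inner ℝ (J (U n)) (J u) : ℝ) • J (U n), map_sum]
    simp only [map_smul]
  · have hon' : Orthonormal ℝ fun l : Fin q => J (U (k + l)) :=
      hon.comp (fun l : Fin q => ⟨k + l, by omega⟩) fun l l' hll => by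
        have := congrArg Fin.val hll
        exact Fin.ext (by simpa using this)
    rw [map_sum, map_sum] at hβ
    simp only [map_smul] at hβ
    ext1 j
    rw [← hon'.inner_right_fintype β j, hβ, hon'.inner_right_fintype _ j]
  have hlt : ∀ l : Fin q, k + l < Module.finrank ℝ V := fun l => by omega
  have hEV : E ∈ V := by
    rw [hE]
    exact V.sum_mem fun l _ => V.smul_mem _ (hU _ (hlt l))
  have hRw : E = R w := by
    rw [hw, hE, map_sum]
    refine Finset.sum_congr rfl fun l _ => ?_
    rw [map_smul, mul_smul, hRK _ (hlt l)]
  refine ⟨hRw, ?_⟩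
  have hw2 : w = ∑ j ∈ Finset.univ.filter (fun i : Fin (Module.finrank ℝ V) =>
      |(Λ i)⁻¹ - ν⁻¹| < r), (((Λ j)⁻¹)⁻¹ * inner ℝ (J (U j)) (J u)) • K (J (U j)) := by
    rw [hsH fun n => (((Λ n)⁻¹)⁻¹ * inner ℝ (J (U n)) (J u)) • K (J (U n)), hw]
    refine Finset.sum_congr rfl fun l _ => ?_
    rw [inv_inv, mul_comm]
  have hfin := hsuper V R hR ρ hρ0 hρ _ _ hon hdg u
    (by rw [inv_inv]; exact (h.mem_relEigenspace_iff hK).1 hu) w hw2 E hEV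
  rw [← hRw]
  -- As `E = R w`, the two errors `u - E` and `w - E` differ by `u - w`.
  refine (h.abs_sqrt_sub_sqrt_le _ _).trans ?_
  rwa [sub_sub_sub_cancel_right]

end DiscreteCluster

/-! ### Finite element spaces as Galerkin spaces, and the isolated eigenvalue -/

section Concrete

variable {d : ℕ} {Ω : Set (Pt d)} {A : Pt d → Matrix (Fin d) (Fin d) ℝ} {c : Pt d → ℝ}
  {a : H10 Ω →L[ℝ] H10 Ω →L[ℝ] ℝ} {α : ℝ}

theorem exists_feSpace_approx_finite (hd : 1 ≤ d) (hΩ : IsOpen Ω) (hb : Bornology.IsBounded Ω)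
    {k : ℕ} (hk : 1 ≤ k) (γ : ℝ) {F : Set (H10 Ω)} (hF : F.Finite) {η : ℝ} (hη : 0 < η) :
    ∃ h₀ > 0, ∀ 𝒯 : Mesh Ω, 𝒯.ShapeRegular γ → 𝒯.size < h₀ →
      ∀ g ∈ F, ∃ v ∈ feSpace 𝒯 k, ‖g - v‖ < η := by
  obtain ⟨h₀, hh₀, hmesh⟩ := exists_pos_forall_finite hF
    (P := fun g t => ∀ 𝒯 : Mesh Ω, 𝒯.ShapeRegular γ → 𝒯.size < t →
      ∃ v ∈ feSpace 𝒯 k, ‖g - v‖ < η)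
    (fun g s t hst H 𝒯 h1 h2 => H 𝒯 h1 (h2.trans_le hst))
    fun g _ => exists_feSpace_approx hd hΩ hb hk γ g hη
  exact ⟨h₀, hh₀, fun 𝒯 h1 h2 g hg => hmesh g hg 𝒯 h1 h2⟩

theorem galerkinProj_apply (h : IsEnergyForm a α) (ha : ∀ u v, aForm A c u v = a u v)
    (V : Submodule ℝ (H10 Ω)) [FiniteDimensional ℝ V] (u : H10 Ω) :
    galerkinProj A c V u ∈ V ∧ ∀ v ∈ V, a (u - galerkinProj A c V u) v = 0 := by
  have : CompleteSpace V := FiniteDimensional.complete ℝ V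
  have hg := isGalerkinProj_galerkinProj h ha V u
  exact ⟨hg.1, fun v hv => (ha _ _).symm.trans (hg.2 v hv)⟩

theorem solOpC_eq (h : IsEnergyForm a α) (ha : ∀ u v, aForm A c u v = a u v)
    (V : Submodule ℝ (H10 Ω)) [FiniteDimensional ℝ V] :
    solOpC A c V = complexify (toL2L Ω ∘L (galerkinProj A c V ∘L opK A c)) := by
  have : CompleteSpace V := FiniteDimensional.complete ℝ V
  rw [solOpC, solOp_eq_galerkinProj_comp h ha V]

theorem pos_of_isEigval (h : IsEnergyForm a α) (ha : ∀ u v, aForm A c u v = a u v) {ν : ℝ}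
    (hν : IsEigval Ω A c ν) : 0 < ν := by
  by_contra hle
  obtain ⟨u, hu, hev⟩ := hν
  have h1 := (isEigvec_iff ha).1 hev
  rw [h.relEigenspace_eq_bot (not_lt.1 hle)] at h1
  exact hu h1

/-- An isolated eigenvalue of `K`, in real terms: the radius of the circle is smaller than its
centre, as the space `L²(Ω)` is infinite-dimensional. -/
theorem isolated_eigenvalue (h : IsEnergyForm a α) (ha : ∀ u v, aForm A c u v = a u v)
    (hd : 1 ≤ d) (hΩ : IsOpen Ω) (hb : Bornology.IsBounded Ω) (hne : Ω.Nonempty) {m r : ℝ}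
    (hm : 0 < m)
    (hΓ : ∀ z : ℂ, Module.End.HasEigenvalue
      (complexify (toL2L Ω ∘L opK A c) : L2C Ω →ₗ[ℂ] L2C Ω) z →
      z ∈ Metric.closedBall (m : ℂ) r → z = m) :
    r < m ∧ ∀ μ : ℝ, Module.End.HasEigenvalue
      ((toL2L Ω ∘L opK A c : L2 Ω →L[ℝ] L2 Ω) : L2 Ω →ₗ[ℝ] L2 Ω) μ → |μ - m| ≤ r → μ = m := by
  have hgap : ∀ μ : ℝ, Module.End.HasEigenvalue
      ((toL2L Ω ∘L opK A c : L2 Ω →L[ℝ] L2 Ω) : L2 Ω →ₗ[ℝ] L2 Ω) μ → |μ - m| ≤ r → μ = m := by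
    intro μ hμ hle
    have h1 := hΓ μ (hasEigenvalue_complexify hμ) (by
      rw [Metric.mem_closedBall, Complex.dist_eq, ← Complex.ofReal_sub, Complex.norm_real]
      exact hle)
    exact_mod_cast h1
  refine ⟨?_, hgap⟩
  by_contra hle
  push Not at hle
  -- If `m ≤ r`, the disc contains `[0, m)`, which is then free of eigenvalues.
  refine not_finiteDimensional_L2 hd hΩ hb hne
    (h.finiteDimensional_of_no_eigenvalue (opK_apply h ha) (isCompactOperator_toL2L hΩ hb) hm
      fun μ h0 h1 hev => h1.ne (hgap μ hev ?_))
  rw [abs_le]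
  constructor <;> linarith

end Concrete

end EigFEM

/-! ### Assembly of the theorem -/

set_option maxHeartbeats 1000000 in
theorem mainTheorem9 (d : ℕ) (hd : 1 ≤ d) (Ω : Set (EigFEM.Pt d))
    (hΩo : IsOpen Ω) (hΩc : IsConnected Ω)
    (𝒯₀ : EigFEM.Mesh Ω) {ι : Type*} (𝒯 : ι → EigFEM.Mesh Ω)
    (href : ∀ i, (𝒯 i).Refines 𝒯₀) (γ : ℝ) (hγ : ∀ i, (𝒯 i).ShapeRegular γ)
    (k : ℕ) (hk : 1 ≤ k)
    (A : EigFEM.Pt d → Matrix (Fin d) (Fin d) ℝ) (hA : EigFEM.IsDiffusion Ω 𝒯₀ A)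
    (c : EigFEM.Pt d → ℝ) (hc : EigFEM.IsPotential Ω c)
    (lam : ℝ) (hlam : EigFEM.IsEigval Ω A c lam)
    (r : ℝ) (hr : 0 < r)
    (hΓ : ∀ z : ℂ, Module.End.HasEigenvalue
        ((EigFEM.solOpC A c (⊤ : Submodule ℝ (EigFEM.H10 Ω)) :
          EigFEM.L2C Ω →L[ℂ] EigFEM.L2C Ω) : Module.End ℂ (EigFEM.L2C Ω)) z →
      z ∈ Metric.closedBall ((lam : ℂ)⁻¹) r → z = (lam : ℂ)⁻¹) :
    ∃ C > 0, ∃ h₀ > 0, ∀ i, (𝒯 i).size < h₀ →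
      EigFEM.numBelow Ω A c lam + EigFEM.mult Ω A c lam
          ≤ Module.finrank ℝ (EigFEM.feSpace (𝒯 i) k) ∧
      (∀ z ∈ Metric.sphere ((lam : ℂ)⁻¹) r,
        z ∈ resolventSet ℂ (EigFEM.solOpC A c (EigFEM.feSpace (𝒯 i) k))) ∧
      ∀ (Λ : ℕ → ℝ) (U : ℕ → EigFEM.H10 Ω),
        EigFEM.IsDiscreteEigensystem A c (EigFEM.feSpace (𝒯 i) k) Λ U →
        ∀ u : EigFEM.H10 Ω, EigFEM.IsEigvec A c lam u → EigFEM.bNorm u = 1 →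
          (∃! α : Fin (EigFEM.mult Ω A c lam) → ℝ,
            EigFEM.rieszProj (EigFEM.solOpC A c (EigFEM.feSpace (𝒯 i) k)) ((lam : ℂ)⁻¹) r
                (EigFEM.toC Ω (EigFEM.toL2 u))
              = EigFEM.toC Ω (EigFEM.toL2
                  (∑ l, α l • U (EigFEM.numBelow Ω A c lam + l)))) ∧
          ∀ (α : Fin (EigFEM.mult Ω A c lam) → ℝ) (Ehu wh : EigFEM.H10 Ω),
            EigFEM.rieszProj (EigFEM.solOpC A c (EigFEM.feSpace (𝒯 i) k)) ((lam : ℂ)⁻¹) r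
                (EigFEM.toC Ω (EigFEM.toL2 u)) = EigFEM.toC Ω (EigFEM.toL2 Ehu) →
            Ehu = ∑ l, α l • U (EigFEM.numBelow Ω A c lam + l) →
            wh = ∑ l, (α l * Λ (EigFEM.numBelow Ω A c lam + l)) •
                EigFEM.opK A c (EigFEM.toL2 (U (EigFEM.numBelow Ω A c lam + l))) →
            Ehu = EigFEM.galerkinProj A c (EigFEM.feSpace (𝒯 i) k) wh ∧
            |EigFEM.aNorm A c (u - Ehu)
                - EigFEM.aNorm A c
                    (wh - EigFEM.galerkinProj A c (EigFEM.feSpace (𝒯 i) k) wh)|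
              ≤ C * (EigFEM.rhoErr A c (EigFEM.feSpace (𝒯 i) k)
                    + EigFEM.deltaErr A c (EigFEM.feSpace (𝒯 i) k) lam)
                  * EigFEM.aNorm A c (u - Ehu) := by
  have hb := 𝒯₀.isBounded
  obtain ⟨a, α, h, ha⟩ := EigFEM.exists_energyForm hd hΩo hA hc
  have hlam0 := EigFEM.pos_of_isEigval h ha hlam
  have hmC : (lam : ℂ)⁻¹ = ((lam⁻¹ : ℝ) : ℂ) := (Complex.ofReal_inv lam).symm
  rw [hmC] at hΓ
  obtain ⟨hrm, hgap⟩ := EigFEM.isolated_eigenvalue h ha hd hΩo hb hΩc.nonempty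
    (inv_pos.2 hlam0) hΓ
  have hK := EigFEM.opK_apply h ha
  obtain ⟨C, hC, F, hF, η, hη, hmain⟩ := h.exists_cluster_estimate (J := EigFEM.toL2L Ω)
    (K := EigFEM.opK A c) hK (EigFEM.toL2_injective hΩo hb)
    (EigFEM.isCompactOperator_toL2L hΩo hb) hlam0 hr hrm hgap (EigFEM.numBelow_eq ha lam)
    (EigFEM.mult_eq ha lam)
  obtain ⟨h₀, hh₀, hmesh⟩ := EigFEM.exists_feSpace_approx_finite hd hΩo hb hk γ hF hη
  refine ⟨C, hC, h₀, hh₀, fun i hi => ?_⟩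
  have hfd := EigFEM.finiteDimensional_feSpace hΩo (𝒯 i) k
  have hFV := hmesh (𝒯 i) (hγ i) hi
  obtain ⟨hkq, ⟨e, μ, he, hdiag, hne⟩, hsys⟩ :=
    hmain _ _ (EigFEM.galerkinProj_apply h ha (EigFEM.feSpace (𝒯 i) k)) hFV
  rw [hmC, EigFEM.solOpC_eq h ha]
  refine ⟨hkq, hdiag.sphere_subset_resolventSet he hrm hne, fun Λ U hΛU u hu _ => ?_⟩
  obtain ⟨hon, hdg, hne', hu'⟩ := hsys Λ U hΛU.mono hΛU.mem hΛU.orthonormal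
    fun j hj v hv => (ha _ _).symm.trans (hΛU.eigen j hj v hv)
  obtain ⟨hproj, huniq, hest⟩ := hu' u ((EigFEM.isEigvec_iff ha).1 hu)
  have hR := hdg.rieszProj_toC hon hr.le hrm hne' (EigFEM.toL2L Ω u)
  rw [hproj] at hR
  -- Coefficients are unique because `toC` is injective and the `U (k₀ + l)` are orthonormal in
  -- `L²`.
  have huniq' := fun β hβ => huniq β (EigFEM.toC_injective (Eq.trans (Eq.symm hβ) hR))
  refine ⟨⟨_, hR, huniq'⟩, fun β Ehu wh hE1 hE2 hw => ?_⟩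
  have hβ := huniq' β (by rw [← hE2]; exact hE1)
  rw [hβ] at hE2 hw
  obtain ⟨h1, h2⟩ := hest _ (EigFEM.rhoErr_nonneg _) (EigFEM.iInf_le_rhoErr _) Ehu wh hE2 hw
  refine ⟨h1, ?_⟩
  rw [EigFEM.aNorm, EigFEM.aNorm, ha, ha]
  refine h2.trans ?_
  have hδ := EigFEM.deltaErr_nonneg (A := A) (c := c) (EigFEM.feSpace (𝒯 i) k) lam
  -- The estimate is already proved with `rhoErr` alone; enlarging it by the nonnegative `deltaErr`
  -- gives the stated form.
  gcongr
  exact le_add_of_nonneg_right hδ
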